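/- Notation. Let $m\ge 1$ and fix an orthonormal basis $e$ of ${\mathbb R}^m$ (for instance the canonical one); all cubes have sides parallel to $e$. The radius of a cube is half of its side length, and $Q^m_r$ is the open cube of radius $r$ centered at $0$. A cubication of ${\mathbb R}^m$ of radius $\eta>0$ is a family $\mathcal S^m$ of closed cubes of radius $\eta$ whose union is ${\mathbb R}^m$ and such that any two members that are not disjoint intersect along a common face (of some dimension in $\{0,\dots,m\}$). A subskeleton $\mathcal U^m$ of $\mathcal S^m$ is a subset of $\mathcal S^m$; $\mathcal U^d$ is the set of all $d$-dimensional faces of cubes of $\mathcal U^m$, and $U^d=\bigcup_{\sigma\in\mathcal U^d}\sigma$. For $\ell\in\{0,\dots,m-1\}$ put $\ell^*=m-\ell-1$; the dual skeleton $\mathcal T^{\ell^*}$ of $\mathcal U^\ell$ is the set of all $\sigma+x-a$, where $\sigma\in\mathcal U^{\ell^*}$, $a$ is the center and $x$ a vertex of a cube of $\mathcal U^m$; $T^{\ell^*}$ is the union of its elements. For $\Phi:{\mathbb R}^m\setminus T^{\ell^*}\to{\mathbb R}^m$, $\operatorname{Supp}\Phi$ is the closure in ${\mathbb R}^m$ of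 $\{x\in{\mathbb R}^m\setminus T^{\ell^*}:\Phi(x)\ne x\}$ and $\operatorname{jac}\Phi=|\det D\Phi|$; $|D^j\Phi|$ is the operator norm. $W^{k,p}$ is defined by weak derivatives. Statement. Let $\ell\in\{0,\dots,m-1\}$, $\eta>0$, $0<\rho<1$, let $\mathcal S^m$ be a cubication of ${\mathbb R}^m$ of radius $\eta$, $\mathcal U^m$ a subskeleton of $\mathcal S^m$, $\mathcal T^{\ell^*}$ the dual skeleton of $\mathcal U^\ell$, and $\Omega=U^m+Q^m_{\rho\eta}$. There exists a smooth map $\Phi:{\mathbb R}^m\setminus T^{\ell^*}\to{\mathbb R}^m$ such that (i) $\Phi$ is injective; (ii) $\Phi(\sigma^m\setminus T^{\ell^*})\subset\sigma^m\setminus T^{\ell^*}$ for every $\sigma^m\in\mathcal S^m$; (iii) $\operatorname{Supp}\Phi\subset U^m+Q^m_{\rho\eta}$ and $\Phi(U^m\setminus T^{\ell^*})\subset U^\ell+Q^m_{\rho\eta}$; (iv) for every integer $j\ge 1$ and every $x\in{\mathbb R}^m\setminus T^{\ell^*}$, where in the case $j=1$ we also require $x\in\Omega$, $$|D^j\Phi(x)|\le\frac{C\eta}{\operatorname{dist}(x,T^{\ell^*})^j},$$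 with $C>0$ depending only on $j,m,\rho$; (v) for every $0<\beta<\ell+1$, every integer $j\ge 1$ and every $x\in{\mathbb R}^m\setminus T^{\ell^*}$, $$\eta^{j-1}|D^j\Phi(x)|\le C'\bigl(\operatorname{jac}\Phi(x)\bigr)^{j/\beta},$$ with $C'>0$ depending only on $\beta,j,m,\rho$; (vi) for every integer $k\ge1$ and every real $p\ge 1$ with $\ell+1>kp$, every $\nu$ and every $u\in W^{k,p}(\Omega;{\mathbb R}^\nu)$, one has $u\circ\Phi\in W^{k,p}(\Omega;{\mathbb R}^\nu)$ and, for every $j\in\{1,\dots,k\}$, $$\eta^j\|D^j(u\circ\Phi)\|_{L^p(\Omega)}\le C''\sum_{i=1}^j\eta^i\|D^iu\|_{L^p(\Omega)},$$ with $C''>0$ depending only on $m,k,p,\rho$. -/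

import Mathlib

open MeasureTheory Set
open scoped Pointwise ContDiff

namespace Thickening

noncomputable section

/-- The closed cube of radius `r` (half of the side length) and center `a`, with sides parallel to
the orthonormal basis `e`. -/
def closedCube {m : ℕ} (e : OrthonormalBasis (Fin m) ℝ (EuclideanSpace ℝ (Fin m)))
    (a : EuclideanSpace ℝ (Fin m)) (r : ℝ) : Set (EuclideanSpace ℝ (Fin m)) :=
  {x | ∀ i, |e.repr x i - e.repr a i| ≤ r}

/-- The open cube of radius `r` and center `a`, with sides parallel to the basis `e`. -/
def openCube {m : ℕ} (e : OrthonormalBasis (Fin m) ℝ (EuclideanSpace ℝ (Fin m)))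
    (a : EuclideanSpace ℝ (Fin m)) (r : ℝ) : Set (EuclideanSpace ℝ (Fin m)) :=
  {x | ∀ i, |e.repr x i - e.repr a i| < r}

/-- The closed face of `closedCube e a r` with sign pattern `s`: the coordinates with `s i = 0` are
free, and the `i`-th coordinate is frozen to `aᵢ + r` if `s i = 1` and to `aᵢ - r` if
`s i = -1`. -/
def cubeFace {m : ℕ} (e : OrthonormalBasis (Fin m) ℝ (EuclideanSpace ℝ (Fin m)))
    (a : EuclideanSpace ℝ (Fin m)) (r : ℝ) (s : Fin m → SignType) :
    Set (EuclideanSpace ℝ (Fin m)) :=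
  {x | ∀ i, (s i = 0 → |e.repr x i - e.repr a i| ≤ r) ∧
    (s i ≠ 0 → e.repr x i = e.repr a i + (s i : ℝ) * r)}

/-- `τ` is a `d`-dimensional face of the closed cube `σ` of radius `r`. -/
def IsCubeFace {m : ℕ} (e : OrthonormalBasis (Fin m) ℝ (EuclideanSpace ℝ (Fin m)))
    (r : ℝ) (d : ℕ) (τ σ : Set (EuclideanSpace ℝ (Fin m))) : Prop :=
  ∃ (a : EuclideanSpace ℝ (Fin m)) (s : Fin m → SignType),
    σ = closedCube e a r ∧ τ = cubeFace e a r s ∧ (Finset.univ.filter fun i => s i = 0).card = d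

/-- The family `S` is a cubication of `A` of radius `η` (with cubes parallel to the basis `e`):
its members are closed cubes of radius `η`, their union is `A`, and two members which meet do so
along a common face. -/
structure IsCubication {m : ℕ} (e : OrthonormalBasis (Fin m) ℝ (EuclideanSpace ℝ (Fin m)))
    (η : ℝ) (S : Set (Set (EuclideanSpace ℝ (Fin m)))) (A : Set (EuclideanSpace ℝ (Fin m))) :
    Prop where
  isCube : ∀ σ ∈ S, ∃ a, σ = closedCube e a η
  sUnion_eq : ⋃₀ S = A
  inter_isFace : ∀ σ₁ ∈ S, ∀ σ₂ ∈ S, (σ₁ ∩ σ₂).Nonempty →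
    ∃ i, IsCubeFace e η i (σ₁ ∩ σ₂) σ₁ ∧ IsCubeFace e η i (σ₁ ∩ σ₂) σ₂

/-- The skeleton of dimension `d` of a family of cubes of radius `η`: all `d`-dimensional faces of
all its cubes. -/
def skeleton {m : ℕ} (e : OrthonormalBasis (Fin m) ℝ (EuclideanSpace ℝ (Fin m)))
    (η : ℝ) (S : Set (Set (EuclideanSpace ℝ (Fin m)))) (d : ℕ) :
    Set (Set (EuclideanSpace ℝ (Fin m))) :=
  {τ | ∃ σ ∈ S, IsCubeFace e η d τ σ}

/-- The dual skeleton, of dimension `m - ℓ - 1`, of the `ℓ`-dimensional skeleton of `S`: all sets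
`τ + x - a` with `τ` in the `(m - ℓ - 1)`-dimensional skeleton of `S`, `a` the center and `x` a
vertex of a cube of `S`. -/
def dualSkeleton {m : ℕ} (e : OrthonormalBasis (Fin m) ℝ (EuclideanSpace ℝ (Fin m)))
    (η : ℝ) (S : Set (Set (EuclideanSpace ℝ (Fin m)))) (ℓ : ℕ) :
    Set (Set (EuclideanSpace ℝ (Fin m))) :=
  {κ | ∃ τ ∈ skeleton e η S (m - ℓ - 1), ∃ a x : EuclideanSpace ℝ (Fin m),
    closedCube e a η ∈ S ∧ IsCubeFace e η 0 {x} (closedCube e a η) ∧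
      κ = (fun y => y + x - a) '' τ}

/-- The geometric support of a map `Φ` defined off the set `T`. -/
def geomSupport {m : ℕ} (T : Set (EuclideanSpace ℝ (Fin m)))
    (Φ : EuclideanSpace ℝ (Fin m) → EuclideanSpace ℝ (Fin m)) : Set (EuclideanSpace ℝ (Fin m)) :=
  closure {x | x ∉ T ∧ Φ x ≠ x}

/-- The Jacobian `|det DΦ(x)|`. -/
def jac {m : ℕ} (Φ : EuclideanSpace ℝ (Fin m) → EuclideanSpace ℝ (Fin m))
    (x : EuclideanSpace ℝ (Fin m)) : ℝ :=
  |(fderiv ℝ Φ x).det|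

/-- `g` is a weak derivative of order `i` of `u` on the open set `Ω`. -/
structure IsWeakDeriv {m ν : ℕ} (i : ℕ)
    (u : EuclideanSpace ℝ (Fin m) → EuclideanSpace ℝ (Fin ν))
    (g : EuclideanSpace ℝ (Fin m) →
      (EuclideanSpace ℝ (Fin m) [×i]→L[ℝ] EuclideanSpace ℝ (Fin ν)))
    (Ω : Set (EuclideanSpace ℝ (Fin m))) : Prop where
  locallyIntegrableOn : LocallyIntegrableOn u Ω
  locallyIntegrableOn_deriv : LocallyIntegrableOn g Ω
  integral_eq : ∀ φ : EuclideanSpace ℝ (Fin m) → ℝ, ContDiff ℝ ∞ φ → HasCompactSupport φ →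
    tsupport φ ⊆ Ω → ∀ v : Fin i → EuclideanSpace ℝ (Fin m),
      ∫ x in Ω, φ x • g x v = (-1 : ℝ) ^ i • ∫ x in Ω, iteratedFDeriv ℝ i φ x v • u x

/-- `u` belongs to the Sobolev space `W^{k,p}(Ω; ℝ^ν)`, for an open set `Ω` and `1 ≤ p < ∞`. -/
structure MemSobolev {m ν : ℕ} (k : ℕ) (p : ℝ)
    (u : EuclideanSpace ℝ (Fin m) → EuclideanSpace ℝ (Fin ν))
    (Ω : Set (EuclideanSpace ℝ (Fin m))) : Prop where
  memLp : MemLp u (ENNReal.ofReal p) (volume.restrict Ω)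
  exists_weakDeriv : ∀ i ∈ Finset.Icc 1 k, ∃ g, IsWeakDeriv i u g Ω ∧
    MemLp g (ENNReal.ofReal p) (volume.restrict Ω)

end

end Thickening

/-!
The map is given by one formula. A cubication of the whole space is a lattice of cubes
(`IsCubication.exists_eq_range_cell`), so in suitable coordinates the cubes have radius `1` and the
centres `2 z`, `z ∈ ℤ ^ m`, and the dual skeleton consists of points with at least `ℓ + 1` even
coordinates. In these coordinates the map `thick` acts on each coordinate `ξ`, measured from the
centre of its cell: near the given cubes it replaces `ξ` by `a ψ (λ ξ)`, where `a < 1` is close to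
`1`, `ψ` is the odd saturating profile `(2 / π) arctan (arsinh y)`, and the rate `λ` is common to all
coordinates. The rate is `λ = A w (2 - ψ w)`, where the weight `w` is comparable with the inverse of
the distance to the dual skeleton and satisfies `w² = ∑ J, (∑ j ∈ J, sin² (π x j / 2))⁻¹`, the sum
being over the sets `J` of `ℓ + 1` coordinates. Cutoffs, which do not feel the displacement, turn the
map into the identity away from the cubes and regularise the weight there.

* At most `ℓ` coordinates of a point can be small compared with `1 / w`, so for large `A` all others
  are pushed close to the boundary of the cell: cubes are mapped close to their `ℓ`-skeleton
  (`exists_pushed_coords`).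
* The rate increases with `w`, while `λ / w` decreases. If two points have the same image, and `μ` is
  the ratio of the larger rate to the smaller one, then the coordinates of the point with the smaller
  rate are at most `μ` times those of the other one. So the ratio of the weights is at most `μ`, which
  is impossible unless the rates agree; and then so do the points (`injOn_thick`).
* Each derivative of `w`, hence of the map, costs a factor `w`. This is proved with a calculus of
  symbols (`HasSymbolDeriv`, `IsSymbol`), and it gives `‖D ^ j Φ‖ ≤ C w ^ j`
  (`exists_bound_iteratedFDeriv_thick`), which is the estimate in terms of the distance to the dual
  skeleton.
* The derivative of the map is a diagonal matrix perturbed by two matrices of rank one, with an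
  explicit determinant. Since `ψ'` decays more slowly than every power `y ^ (-1 - δ)`, the Jacobian is
  at least `c w ^ β` for every `β < ℓ + 1` (`exists_mul_rpow_weight_le_jac_thick`). Together with the
  preceding bound, this gives the estimates of the derivatives by powers of the Jacobian.

The statement on Sobolev functions holds for every `Φ` which is an injective local diffeomorphism off
a closed null set with such estimates (`IsSingularDiffeo`, `DerivLEJac`). The candidate for the weak
derivative of `u ∘ Φ` is given by the formula of Faà di Bruno. Against a test function supported off
the singular set, the change of variables and the definition of the weak derivatives of `u` turn both
sides of the chain rule into integrals of `u` against test functions which do not depend on `u`; as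
the rule holds for smooth functions, these agree (`integral_pullDeriv_of_tsupport_subset`). No
approximation of `u` by smooth functions is needed. General test functions are multiplied by cutoffs
which vanish near the singular set and whose derivatives, of order `i`, are bounded by `w ^ i` and so
by the Jacobian; since the Jacobian times `u ∘ Φ` is locally integrable, the limit can be taken
(`isWeakDeriv_pullDeriv`). Finally, by the estimates with the exponent `β = j p`, the `p`-th power of
each term in the formula for the derivative of order `j` is at most a multiple of the Jacobian times
the `p`-th power of a derivative of `u` composed with `Φ`, and the change of variables gives the
estimate of the norms (`eLpNorm_pullDeriv_le`, `memSobolev_comp`).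
-/

namespace Thickening

/-! ### Functions whose derivatives are bounded in terms of a scale -/

section Symbol

variable {ι E : Type*} [NormedAddCommGroup E] [NormedSpace ℝ E]

/-- The family `f` is smooth on the sets `A i` and its derivatives of order `n ≥ 1` are bounded by
`C n * M * W ^ n` there, with constants that do not depend on the index `i`. Nothing is asked of the
values of `f`. -/
structure HasSymbolDeriv (A : ι → Set E) (f M W : ι → E → ℝ) : Prop where
  contDiffAt : ∀ i, ∀ x ∈ A i, ContDiffAt ℝ ∞ (f i) x
  bound : ∀ n, 1 ≤ n → ∃ C, 0 ≤ C ∧ ∀ i, ∀ x ∈ A i,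
    ‖iteratedFDeriv ℝ n (f i) x‖ ≤ C * (M i x * W i x ^ n)

/-- The family `f` is a symbol of size `M` and scale `1 / W` on the sets `A i`: it is smooth there
and each derivative costs a factor `W`, with constants that do not depend on the index `i`. -/
structure IsSymbol (A : ι → Set E) (f M W : ι → E → ℝ) : Prop where
  contDiffAt : ∀ i, ∀ x ∈ A i, ContDiffAt ℝ ∞ (f i) x
  bound : ∀ n, ∃ C, 0 ≤ C ∧ ∀ i, ∀ x ∈ A i,
    ‖iteratedFDeriv ℝ n (f i) x‖ ≤ C * (M i x * W i x ^ n)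

variable {A : ι → Set E} {f g M N W : ι → E → ℝ}

lemma IsSymbol.hasSymbolDeriv (h : IsSymbol A f M W) : HasSymbolDeriv A f M W :=
  ⟨h.contDiffAt, fun n _ => h.bound n⟩

lemma HasSymbolDeriv.isSymbol (h : HasSymbolDeriv A f M W) {C : ℝ} (hC : 0 ≤ C)
    (h0 : ∀ i, ∀ x ∈ A i, |f i x| ≤ C * M i x) : IsSymbol A f M W := by
  refine ⟨h.contDiffAt, fun n => ?_⟩
  rcases Nat.eq_zero_or_pos n with rfl | hn
  · exact ⟨C, hC, fun i x hx => by simpa using h0 i x hx⟩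
  · exact h.bound n hn

lemma HasSymbolDeriv.mono {M' W' : ι → E → ℝ} (h : HasSymbolDeriv A f M W)
    (hM : ∀ n, 1 ≤ n → ∃ C, 0 ≤ C ∧ ∀ i, ∀ x ∈ A i, M i x * W i x ^ n ≤ C * (M' i x * W' i x ^ n)) :
    HasSymbolDeriv A f M' W' := by
  refine ⟨h.contDiffAt, fun n hn => ?_⟩
  obtain ⟨C, hC, hb⟩ := h.bound n hn
  obtain ⟨C', hC', hb'⟩ := hM n hn
  exact ⟨C * C', mul_nonneg hC hC', fun i x hx => (hb i x hx).trans
    (by rw [mul_assoc]; exact mul_le_mul_of_nonneg_left (hb' i x hx) hC)⟩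

lemma IsSymbol.mono {M' W' : ι → E → ℝ} (h : IsSymbol A f M W)
    (hM : ∀ n : ℕ, ∃ C, 0 ≤ C ∧ ∀ i, ∀ x ∈ A i, M i x * W i x ^ n ≤ C * (M' i x * W' i x ^ n)) :
    IsSymbol A f M' W' := by
  refine ⟨h.contDiffAt, fun n => ?_⟩
  obtain ⟨C, hC, hb⟩ := h.bound n
  obtain ⟨C', hC', hb'⟩ := hM n
  exact ⟨C * C', mul_nonneg hC hC', fun i x hx => (hb i x hx).trans
    (by rw [mul_assoc]; exact mul_le_mul_of_nonneg_left (hb' i x hx) hC)⟩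

lemma IsSymbol.mono_size {M' : ι → E → ℝ} (h : IsSymbol A f M W) {C : ℝ} (hC : 0 ≤ C)
    (hW : ∀ i, ∀ x ∈ A i, 0 ≤ W i x)
    (hM : ∀ i, ∀ x ∈ A i, M i x ≤ C * M' i x) : IsSymbol A f M' W :=
  h.mono fun n => ⟨C, hC, fun i x hx => by
    rw [← mul_assoc]; exact mul_le_mul_of_nonneg_right (hM i x hx) (pow_nonneg (hW i x hx) n)⟩

lemma IsSymbol.congr {f' : ι → E → ℝ} (h : IsSymbol A f M W)
    (hf : ∀ i, ∀ x ∈ A i, f' i =ᶠ[nhds x] f i) : IsSymbol A f' M W := by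
  refine ⟨fun i x hx => (h.contDiffAt i x hx).congr_of_eventuallyEq (hf i x hx), fun n => ?_⟩
  obtain ⟨C, hC, hb⟩ := h.bound n
  exact ⟨C, hC, fun i x hx => by rw [((hf i x hx).iteratedFDeriv ℝ n).eq_of_nhds]; exact hb i x hx⟩

lemma IsSymbol.comap {κ : Type*} (σ : κ → ι) {B : κ → Set E} (h : IsSymbol A f M W)
    (hB : ∀ k, B k ⊆ A (σ k)) :
    IsSymbol B (fun k => f (σ k)) (fun k => M (σ k)) (fun k => W (σ k)) :=
  ⟨fun k x hx => h.contDiffAt _ x (hB k hx), fun n => by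
    obtain ⟨C, hC, hb⟩ := h.bound n
    exact ⟨C, hC, fun k x hx => hb _ x (hB k hx)⟩⟩

lemma isSymbol_const (c : ι → ℝ) (hW : ∀ i, ∀ x ∈ A i, 0 ≤ W i x)
    (hM : ∀ i, ∀ x ∈ A i, |c i| ≤ M i x) : IsSymbol A (fun i _ => c i) M W := by
  refine ⟨fun i x hx => contDiffAt_const, fun n => ⟨1, zero_le_one, fun i x hx => ?_⟩⟩
  rcases Nat.eq_zero_or_pos n with rfl | hn
  · simpa using hM i x hx
  · rw [iteratedFDeriv_const_of_ne (by omega)]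
    have := (abs_nonneg _).trans (hM i x hx)
    have := hW i x hx
    simp only [Pi.zero_apply, norm_zero]; positivity

lemma IsSymbol.add (hf : IsSymbol A f M W) (hg : IsSymbol A g M W) :
    IsSymbol A (fun i x => f i x + g i x) M W := by
  refine ⟨fun i x hx => (hf.contDiffAt i x hx).add (hg.contDiffAt i x hx), fun n => ?_⟩
  obtain ⟨C, hC, hb⟩ := hf.bound n
  obtain ⟨C', hC', hb'⟩ := hg.bound n
  refine ⟨C + C', by positivity, fun i x hx => ?_⟩
  have h1 : ContDiffAt ℝ n (f i) x := (hf.contDiffAt i x hx).of_le (by exact_mod_cast le_top)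
  have h2 : ContDiffAt ℝ n (g i) x := (hg.contDiffAt i x hx).of_le (by exact_mod_cast le_top)
  rw [fun_iteratedFDeriv_add_apply h1 h2, add_mul]
  exact (norm_add_le _ _).trans (add_le_add (hb i x hx) (hb' i x hx))

lemma IsSymbol.sum {κ : Type*} (s : Finset κ) {F : κ → ι → E → ℝ}
    (hW : ∀ i, ∀ x ∈ A i, 0 ≤ W i x) (hM : ∀ i, ∀ x ∈ A i, 0 ≤ M i x)
    (h : ∀ k ∈ s, IsSymbol A (F k) M W) : IsSymbol A (fun i x => ∑ k ∈ s, F k i x) M W := by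
  classical
  induction s using Finset.induction_on with
  | empty =>
    simp only [Finset.sum_empty]
    exact isSymbol_const (fun _ => 0) hW (by simpa using hM)
  | insert a s ha ih =>
    simp only [Finset.sum_insert ha]
    exact (h a (by simp)).add (ih fun k hk => h k (by simp [hk]))

lemma contDiffAt_exists_isOpen {F : Type*} [NormedAddCommGroup F] [NormedSpace ℝ F] {u : E → F}
    {x : E} (hu : ContDiffAt ℝ ∞ u x) (n : ℕ) :
    ∃ s, IsOpen s ∧ x ∈ s ∧ ContDiffOn ℝ n u s := by
  obtain ⟨s, hs, hx, h⟩ := ContDiffWithinAt.contDiffOn' (m := (n : ℕ∞ω))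
    (by exact_mod_cast le_top) (by simp) (contDiffWithinAt_univ.2 hu)
  exact ⟨s, hs, hx, by simpa using h⟩

/-- Leibniz bound for a product of a scalar and a vector function, smooth at one point only. -/
lemma norm_iteratedFDeriv_smul_le_of_contDiffAt {F : Type*} [NormedAddCommGroup F]
    [NormedSpace ℝ F] {u : E → ℝ} {v : E → F} {x : E} (hu : ContDiffAt ℝ ∞ u x)
    (hv : ContDiffAt ℝ ∞ v x) (n : ℕ) :
    ‖iteratedFDeriv ℝ n (fun y => u y • v y) x‖ ≤ ∑ i ∈ Finset.range (n + 1),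
      (n.choose i : ℝ) * ‖iteratedFDeriv ℝ i u x‖ * ‖iteratedFDeriv ℝ (n - i) v x‖ := by
  obtain ⟨s, hs, hxs, hus⟩ := contDiffAt_exists_isOpen hu n
  obtain ⟨t, ht, hxt, hvt⟩ := contDiffAt_exists_isOpen hv n
  have hst := hs.inter ht
  have h := norm_iteratedFDerivWithin_smul_le (hus.mono inter_subset_left)
    (hvt.mono inter_subset_right) hst.uniqueDiffOn (x := x) ⟨hxs, hxt⟩ (le_refl (n : ℕ∞ω))
  simpa only [iteratedFDerivWithin_of_isOpen _ hst (show x ∈ s ∩ t from ⟨hxs, hxt⟩)] using h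

lemma IsSymbol.mul (hf : IsSymbol A f M W) (hg : IsSymbol A g N W) :
    IsSymbol A (fun i x => f i x * g i x) (fun i x => M i x * N i x) W := by
  refine ⟨fun i x hx => (hf.contDiffAt i x hx).mul (hg.contDiffAt i x hx), fun n => ?_⟩
  choose C hC hb using hf.bound
  choose C' hC' hb' using hg.bound
  refine ⟨∑ k ∈ Finset.range (n + 1), (n.choose k : ℝ) * (C k * C' (n - k)),
    Finset.sum_nonneg fun k _ => mul_nonneg (by positivity) (mul_nonneg (hC _) (hC' _)),
    fun i x hx => ?_⟩
  refine (norm_iteratedFDeriv_smul_le_of_contDiffAt (hf.contDiffAt i x hx)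
    (hg.contDiffAt i x hx) n).trans ?_
  rw [Finset.sum_mul]
  refine Finset.sum_le_sum fun k hk => ?_
  have hk' : k ≤ n := by simpa [Nat.lt_succ_iff] using hk
  have h1 := hb k i x hx
  have h2 := hb' (n - k) i x hx
  have h3 : 0 ≤ C k * (M i x * W i x ^ k) := (norm_nonneg _).trans h1
  calc _ = (n.choose k : ℝ) * (‖iteratedFDeriv ℝ k (f i) x‖ * ‖iteratedFDeriv ℝ (n - k) (g i) x‖) :=
        mul_assoc _ _ _
    _ ≤ (n.choose k : ℝ) * ((C k * (M i x * W i x ^ k)) * (C' (n - k) * (N i x * W i x ^ (n - k)))) :=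
        mul_le_mul_of_nonneg_left (mul_le_mul h1 h2 (norm_nonneg _) h3) (by positivity)
    _ = _ := by
        rw [show W i x ^ n = W i x ^ k * W i x ^ (n - k) by rw [← pow_add]; congr 1; omega]; ring

lemma norm_taylorComp_le {F G : Type*} [NormedAddCommGroup F] [NormedSpace ℝ F]
    [NormedAddCommGroup G] [NormedSpace ℝ G] (q : FormalMultilinearSeries ℝ F G)
    (p : FormalMultilinearSeries ℝ E F) (n : ℕ) :
    ‖q.taylorComp p n‖ ≤ ∑ c : OrderedFinpartition n, ‖q c.length‖ * ∏ i, ‖p (c.partSize i)‖ :=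
  (norm_sum_le _ _).trans (Finset.sum_le_sum fun c _ =>
    c.norm_compAlongOrderedFinpartition_le _ _)

lemma OrderedFinpartition_prod_pow {n : ℕ} (c : OrderedFinpartition n) (w : ℝ) :
    ∏ i, w ^ c.partSize i = w ^ n := by
  have := c.prod_sigma_eq_prod (fun _ => w)
  simpa using this

/-- The chain rule, from the formula of Faà di Bruno: it suffices that the derivatives of `φ`, times
the powers of the size `B` of the derivatives of the inner function, are bounded by `N`. -/
lemma HasSymbolDeriv.comp {B : ι → E → ℝ} (hf : HasSymbolDeriv A f B W) {φ : ℝ → ℝ}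
    (hφ : ∀ i, ∀ x ∈ A i, ContDiffAt ℝ ∞ φ (f i x))
    (hφb : ∀ n, ∃ C, 0 ≤ C ∧ ∀ i, ∀ x ∈ A i,
      ‖iteratedFDeriv ℝ n φ (f i x)‖ * B i x ^ n ≤ C * N i x)
    (hW : ∀ i, ∀ x ∈ A i, 0 ≤ W i x) :
    IsSymbol A (fun i x => φ (f i x)) N W := by
  refine ⟨fun i x hx => (hφ i x hx).comp x (hf.contDiffAt i x hx), fun n => ?_⟩
  have hf' : ∀ n, ∃ C, 0 ≤ C ∧ (1 ≤ n → ∀ i, ∀ x ∈ A i,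
      ‖iteratedFDeriv ℝ n (f i) x‖ ≤ C * (B i x * W i x ^ n)) := fun n => by
    by_cases hn : 1 ≤ n
    · obtain ⟨C, hC, h⟩ := hf.bound n hn
      exact ⟨C, hC, fun _ => h⟩
    · exact ⟨0, le_rfl, fun h => absurd h hn⟩
  choose C hC hb using hf'
  choose C' hC' hb' using hφb
  refine ⟨∑ c : OrderedFinpartition n, C' c.length * ∏ i, C (c.partSize i),
    Finset.sum_nonneg fun c _ => mul_nonneg (hC' _) (Finset.prod_nonneg fun _ _ => hC _),
    fun i x hx => ?_⟩
  have h1 : iteratedFDeriv ℝ n (fun x => φ (f i x)) x =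
      (ftaylorSeries ℝ φ (f i x)).taylorComp (ftaylorSeries ℝ (f i) x) n :=
    iteratedFDeriv_comp (hφ i x hx) (hf.contDiffAt i x hx) (by exact_mod_cast le_top)
  rw [h1]
  refine (norm_taylorComp_le _ _ _).trans ?_
  rw [Finset.sum_mul]
  refine Finset.sum_le_sum fun c _ => ?_
  have h2 : ∏ k, ‖ftaylorSeries ℝ (f i) x (c.partSize k)‖ ≤
      ∏ k, (C (c.partSize k) * (B i x * W i x ^ c.partSize k)) :=
    Finset.prod_le_prod (fun _ _ => norm_nonneg _) fun k _ =>
      hb _ (c.partSize_pos k) i x hx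
  have h3 : ∏ k, (C (c.partSize k) * (B i x * W i x ^ c.partSize k)) =
      (∏ k, C (c.partSize k)) * (B i x ^ c.length * W i x ^ n) := by
    rw [Finset.prod_mul_distrib, Finset.prod_mul_distrib, OrderedFinpartition_prod_pow]; simp
  rw [h3] at h2
  have h4 := hb' c.length i x hx
  have h5 : 0 ≤ ∏ k, C (c.partSize k) := Finset.prod_nonneg fun _ _ => hC _
  calc _ ≤ ‖iteratedFDeriv ℝ c.length φ (f i x)‖ *
        ((∏ k, C (c.partSize k)) * (B i x ^ c.length * W i x ^ n)) :=
        mul_le_mul_of_nonneg_left h2 (norm_nonneg _)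
    _ = (‖iteratedFDeriv ℝ c.length φ (f i x)‖ * B i x ^ c.length) *
        ((∏ k, C (c.partSize k)) * W i x ^ n) := by ring
    _ ≤ (C' c.length * N i x) * ((∏ k, C (c.partSize k)) * W i x ^ n) :=
        mul_le_mul_of_nonneg_right h4 (mul_nonneg h5 (pow_nonneg (hW i x hx) n))
    _ = _ := by ring

/-- A real power of a positive symbol of its own size is a symbol of its own size. -/
lemma HasSymbolDeriv.rpow (hf : HasSymbolDeriv A f f W) (hpos : ∀ i, ∀ x ∈ A i, 0 < f i x)
    (hW : ∀ i, ∀ x ∈ A i, 0 ≤ W i x) (r : ℝ) :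
    IsSymbol A (fun i x => f i x ^ r) (fun i x => f i x ^ r) W := by
  refine hf.comp (φ := fun t => t ^ r)
    (fun i x hx => Real.contDiffAt_rpow_const_of_ne (hpos i x hx).ne')
    (fun n => ⟨|(descPochhammer ℝ n).eval r|, abs_nonneg _, fun i x hx => ?_⟩)
    hW
  have h := hpos i x hx
  rw [norm_iteratedFDeriv_eq_norm_iteratedDeriv, iteratedDeriv_eq_iterate,
    Real.iter_deriv_rpow_const, norm_mul, Real.norm_eq_abs, Real.norm_of_nonneg (by positivity),
    mul_assoc, Real.rpow_sub h, Real.rpow_natCast, div_mul_cancel₀ _ (by positivity)]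

lemma IsSymbol.inv (hf : IsSymbol A f f W) (hpos : ∀ i, ∀ x ∈ A i, 0 < f i x)
    (hW : ∀ i, ∀ x ∈ A i, 0 ≤ W i x) :
    IsSymbol A (fun i x => (f i x)⁻¹) (fun i x => (f i x)⁻¹) W := by
  simpa only [Real.rpow_neg_one] using hf.hasSymbolDeriv.rpow hpos hW (-1)

lemma IsSymbol.sqrt (hf : IsSymbol A f f W) (hpos : ∀ i, ∀ x ∈ A i, 0 < f i x)
    (hW : ∀ i, ∀ x ∈ A i, 0 ≤ W i x) :
    IsSymbol A (fun i x => √(f i x)) (fun i x => √(f i x)) W := by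
  simpa only [Real.sqrt_eq_rpow] using hf.hasSymbolDeriv.rpow hpos hW (1 / 2)

/-- Let `q` be a sum of squares of functions, each derivative of which costs at most a factor
`q ^ (-1/2)` relative to the size `q ^ (1/2)`. Then each derivative of `q` costs at most a factor
`q ^ (-1/2)`, relative to the size `q`. -/
lemma isSymbol_sum_sq {κ : Type*} (s : Finset κ) {F : κ → ι → E → ℝ} {q : ι → E → ℝ}
    (hq : ∀ i, q i = fun x => ∑ k ∈ s, F k i x ^ 2)
    (hpos : ∀ i, ∀ x ∈ A i, 0 < q i x)
    (hF : ∀ k ∈ s, HasSymbolDeriv A (F k) (fun i x => √(q i x)) (fun i x => (√(q i x))⁻¹)) :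
    IsSymbol A q q (fun i x => (√(q i x))⁻¹) := by
  have hW : ∀ i, ∀ x ∈ A i, 0 ≤ (√(q i x))⁻¹ := fun i x _ => by positivity
  have h1 : ∀ k ∈ s, IsSymbol A (fun i x => F k i x ^ 2) q (fun i x => (√(q i x))⁻¹) := by
    intro k hk
    have h2 : IsSymbol A (F k) (fun i x => √(q i x)) (fun i x => (√(q i x))⁻¹) :=
      (hF k hk).isSymbol zero_le_one fun i x hx => by
        rw [one_mul]
        refine Real.abs_le_sqrt ?_
        rw [hq i]
        exact Finset.single_le_sum (f := fun k => F k i x ^ 2) (fun _ _ => sq_nonneg _) hk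
    have h3 := (h2.mul h2).mono_size (M' := q) zero_le_one hW
      fun i x hx => by rw [one_mul, Real.mul_self_sqrt (hpos i x hx).le]
    simpa only [← sq] using h3
  have h2 := IsSymbol.sum s hW (fun i x hx => (hpos i x hx).le) h1
  exact h2.congr fun i x _ => by rw [hq i]

end Symbol

/-! ### Profiles of one variable -/

section OneVariable

lemma exists_bound_iteratedFDeriv_of_hasCompactSupport {E F : Type*} [NormedAddCommGroup E]
    [NormedSpace ℝ E] [NormedAddCommGroup F] [NormedSpace ℝ F] {f : E → F}
    (hf : ContDiff ℝ ∞ f) (hs : HasCompactSupport f) (n : ℕ) :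
    ∃ C, 0 ≤ C ∧ ∀ x, ‖iteratedFDeriv ℝ n f x‖ ≤ C := by
  obtain ⟨C, hC⟩ := (hs.iteratedFDeriv n).exists_bound_of_continuous
    (hf.continuous_iteratedFDeriv (m := n) (by exact_mod_cast le_top))
  exact ⟨C, (norm_nonneg _).trans (hC 0), hC⟩

lemma exists_bound_iteratedFDeriv_smoothTransition (n : ℕ) :
    ∃ C, 0 ≤ C ∧ ∀ x, ‖iteratedFDeriv ℝ n Real.smoothTransition x‖ ≤ C := by
  rcases Nat.eq_zero_or_pos n with rfl | hn
  · refine ⟨1, zero_le_one, fun x => ?_⟩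
    rw [norm_iteratedFDeriv_zero, Real.norm_of_nonneg (Real.smoothTransition.nonneg x)]
    exact Real.smoothTransition.le_one x
  · have hc : Continuous (iteratedFDeriv ℝ n Real.smoothTransition) :=
      (Real.smoothTransition.contDiff (n := ⊤)).continuous_iteratedFDeriv (m := n)
        (by exact_mod_cast le_top)
    obtain ⟨C, hC⟩ := (isCompact_Icc (a := (0 : ℝ)) (b := 1)).exists_bound_of_continuousOn
      hc.continuousOn
    have hC0 : 0 ≤ C := (norm_nonneg _).trans (hC 0 (by simp))
    have key : ∀ (c x : ℝ), Real.smoothTransition =ᶠ[nhds x] (fun _ => c) →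
        ‖iteratedFDeriv ℝ n Real.smoothTransition x‖ ≤ C := fun c x h => by
      rw [(h.iteratedFDeriv ℝ n).eq_of_nhds, iteratedFDeriv_const_of_ne (by omega)]
      simpa using hC0
    refine ⟨C, hC0, fun x => ?_⟩
    by_cases h0 : x < 0
    · exact key 0 x <| by
        filter_upwards [Iio_mem_nhds h0] with y hy using
          Real.smoothTransition.zero_of_nonpos (le_of_lt hy)
    by_cases h1 : 1 < x
    · exact key 1 x <| by
        filter_upwards [Ioi_mem_nhds h1] with y hy using
          Real.smoothTransition.one_of_one_le (le_of_lt hy)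
    · exact hC x ⟨not_lt.1 h0, not_lt.1 h1⟩

lemma norm_iteratedFDeriv_clm_add_le {E : Type*} [NormedAddCommGroup E] [NormedSpace ℝ E]
    (T : E →L[ℝ] ℝ) (c : ℝ) {n : ℕ} (hn : 1 ≤ n) (x : E) :
    ‖iteratedFDeriv ℝ n (fun y => T y + c) x‖ ≤ if n = 1 then ‖T‖ else 0 := by
  obtain ⟨k, rfl⟩ : ∃ k, n = k + 1 := ⟨n - 1, by omega⟩
  have h : fderiv ℝ (fun y => T y + c) = fun _ => T := by
    funext y
    exact (T.hasFDerivAt.add_const c).fderiv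
  rw [← norm_iteratedFDeriv_fderiv, h]
  rcases Nat.eq_zero_or_pos k with rfl | hk
  · simp
  · rw [iteratedFDeriv_const_of_ne (by omega), if_neg (by omega)]; simp

/-- A smooth even function on the line which is `1` on `[-c, c]` and `0` outside `[-d, d]`. -/
noncomputable def plateau (c d y : ℝ) : ℝ :=
  Real.smoothTransition ((d - y) / (d - c)) * Real.smoothTransition ((d + y) / (d - c))

lemma plateau_contDiff (c d : ℝ) : ContDiff ℝ ∞ (plateau c d) := by
  have h := Real.smoothTransition.contDiff (n := ⊤)
  unfold plateau
  exact (h.comp (by fun_prop)).mul (h.comp (by fun_prop))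

lemma plateau_nonneg (c d y : ℝ) : 0 ≤ plateau c d y :=
  mul_nonneg (Real.smoothTransition.nonneg _) (Real.smoothTransition.nonneg _)

lemma plateau_le_one (c d y : ℝ) : plateau c d y ≤ 1 :=
  mul_le_one₀ (Real.smoothTransition.le_one _) (Real.smoothTransition.nonneg _)
    (Real.smoothTransition.le_one _)

lemma plateau_neg (c d y : ℝ) : plateau c d (-y) = plateau c d y := by
  unfold plateau; rw [sub_neg_eq_add, mul_comm, ← sub_eq_add_neg]

lemma plateau_abs (c d y : ℝ) : plateau c d |y| = plateau c d y := by
  rcases abs_cases y with ⟨h, _⟩ | ⟨h, _⟩ <;> rw [h]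
  exact plateau_neg c d y

lemma plateau_of_neg_le {c d y : ℝ} (hcd : c < d) (hy : -c ≤ y) :
    plateau c d y = Real.smoothTransition ((d - y) / (d - c)) := by
  have : Real.smoothTransition ((d + y) / (d - c)) = 1 :=
    Real.smoothTransition.one_of_one_le (by rw [le_div_iff₀ (by linarith)]; linarith)
  rw [plateau, this, mul_one]

lemma plateau_eq_one {c d y : ℝ} (hcd : c < d) (hy : |y| ≤ c) : plateau c d y = 1 := by
  have h := abs_le.1 hy
  rw [plateau_of_neg_le hcd h.1]
  exact Real.smoothTransition.one_of_one_le (by rw [le_div_iff₀ (by linarith)]; linarith)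

lemma plateau_eq_zero {c d y : ℝ} (hc : 0 ≤ c) (hcd : c < d) (hy : d ≤ |y|) :
    plateau c d y = 0 := by
  rw [← plateau_abs, plateau_of_neg_le hcd (by linarith [abs_nonneg y])]
  exact Real.smoothTransition.zero_of_nonpos
    (div_nonpos_of_nonpos_of_nonneg (by linarith) (by linarith))

lemma plateau_anti {c d x y : ℝ} (hc : 0 ≤ c) (hcd : c < d) (hxy : |x| ≤ |y|) :
    plateau c d y ≤ plateau c d x := by
  rw [← plateau_abs c d x, ← plateau_abs c d y,
    plateau_of_neg_le (y := |x|) hcd (by linarith [abs_nonneg x]),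
    plateau_of_neg_le (y := |y|) hcd (by linarith [abs_nonneg y])]
  exact Real.smoothTransition.monotone (by gcongr)

lemma plateau_hasCompactSupport {c d : ℝ} (hc : 0 ≤ c) (hcd : c < d) :
    HasCompactSupport (plateau c d) :=
  HasCompactSupport.intro (isCompact_Icc (a := -d) (b := d)) fun x hx =>
    plateau_eq_zero hc hcd <| by
      by_contra h
      exact hx (abs_le.1 (not_le.1 h).le)

/-- The slow saturating profile `(2 / π) arctan (arsinh y)`. Its derivative decays like
`1 / (y log² y)`, which is barely integrable: slower than any power `y ^ (-1 - δ)`. -/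
noncomputable def psi (y : ℝ) : ℝ := 2 / Real.pi * Real.arctan (Real.arsinh y)

/-- The derivative of `psi`. -/
noncomputable def psi' (y : ℝ) : ℝ :=
  2 / Real.pi * (1 / (1 + Real.arsinh y ^ 2) * (√(1 + y ^ 2))⁻¹)

lemma psi_hasDerivAt (y : ℝ) : HasDerivAt psi (psi' y) y :=
  ((Real.hasDerivAt_arctan _).comp y (Real.hasDerivAt_arsinh y)).const_mul _

lemma psi_contDiff : ContDiff ℝ ∞ psi :=
  contDiff_const.mul (Real.contDiff_arctan.comp Real.contDiff_arsinh)

lemma psi_strictMono : StrictMono psi := fun _ _ h =>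
  mul_lt_mul_of_pos_left (Real.arctan_strictMono (Real.arsinh_lt_arsinh.2 h)) (by positivity)

@[simp] lemma psi_zero : psi 0 = 0 := by simp [psi]

lemma psi_neg (y : ℝ) : psi (-y) = -psi y := by simp [psi, Real.arctan_neg]

lemma psi_nonneg {y : ℝ} (hy : 0 ≤ y) : 0 ≤ psi y := by
  simpa using psi_strictMono.monotone hy

lemma psi_lt_one (y : ℝ) : psi y < 1 := by
  have h := Real.arctan_lt_pi_div_two (Real.arsinh y)
  have hpi := Real.pi_pos
  calc psi y < 2 / Real.pi * (Real.pi / 2) := mul_lt_mul_of_pos_left h (by positivity)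
    _ = 1 := by field_simp

lemma abs_psi_lt_one (y : ℝ) : |psi y| < 1 :=
  abs_lt.2 ⟨by have := psi_lt_one (-y); rw [psi_neg] at this; linarith, psi_lt_one y⟩

lemma psi'_pos (y : ℝ) : 0 < psi' y := by
  unfold psi'; have := Real.pi_pos; positivity

lemma psi'_le_inv_sqrt (y : ℝ) : psi' y ≤ (√(1 + y ^ 2))⁻¹ := by
  have h1 : 2 / Real.pi ≤ 1 := by
    rw [div_le_one Real.pi_pos]; exact Real.two_le_pi
  have h2 : 1 / (1 + Real.arsinh y ^ 2) ≤ 1 := by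
    rw [div_le_one (by positivity)]; nlinarith [sq_nonneg (Real.arsinh y)]
  have h3 : 0 ≤ (√(1 + y ^ 2))⁻¹ := by positivity
  unfold psi'
  rw [← mul_assoc]
  exact mul_le_of_le_one_left h3 (mul_le_one₀ h1 (by positivity) h2)

lemma one_le_sqrt_one_add_sq (y : ℝ) : 1 ≤ √(1 + y ^ 2) :=
  Real.one_le_sqrt.2 (by nlinarith [sq_nonneg y])

lemma abs_le_sqrt_one_add_sq (y : ℝ) : |y| ≤ √(1 + y ^ 2) :=
  Real.abs_le_sqrt (by linarith)

lemma psi'_le_one (y : ℝ) : psi' y ≤ 1 :=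
  (psi'_le_inv_sqrt y).trans (inv_le_one_of_one_le₀ (one_le_sqrt_one_add_sq y))

lemma abs_mul_psi'_le_one (y : ℝ) : |y| * psi' y ≤ 1 := by
  calc |y| * psi' y ≤ √(1 + y ^ 2) * (√(1 + y ^ 2))⁻¹ :=
        mul_le_mul (abs_le_sqrt_one_add_sq y) (psi'_le_inv_sqrt y) (psi'_pos y).le (by positivity)
    _ = 1 := mul_inv_cancel₀ (by positivity)

lemma psi_tendsto : Filter.Tendsto psi Filter.atTop (nhds 1) := by
  have h1 : Filter.Tendsto (fun y => Real.arctan (Real.arsinh y)) Filter.atTop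
      (nhds (Real.pi / 2)) := by
    refine (Real.tendsto_arctan_atTop.mono_right nhdsWithin_le_nhds).comp ?_
    refine Filter.tendsto_atTop.2 fun b => ?_
    filter_upwards [Filter.eventually_ge_atTop (Real.sinh b)] with y hy
    rw [← Real.arsinh_sinh b]
    exact Real.arsinh_le_arsinh.2 hy
  have h2 := h1.const_mul (2 / Real.pi)
  have h3 : 2 / Real.pi * (Real.pi / 2) = 1 := by have := Real.pi_ne_zero; field_simp
  rw [h3] at h2
  exact h2

lemma isSymbol_one_add_sq :
    IsSymbol (fun _ : Unit => (univ : Set ℝ)) (fun _ y => 1 + y ^ 2) (fun _ y => 1 + y ^ 2)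
      (fun _ y => (√(1 + y ^ 2))⁻¹) := by
  refine isSymbol_sum_sq (Finset.univ : Finset Bool)
    (F := fun b _ y => if b then 1 else y) (fun _ => by funext y; simp)
    (fun _ x _ => by positivity) fun b _ => ?_
  cases b
  · refine ⟨fun _ x _ => by simp only [Bool.false_eq_true, if_false]; fun_prop,
      fun n hn => ⟨1, zero_le_one, fun _ x _ => ?_⟩⟩
    have h0 : 0 < √(1 + x ^ 2) := by positivity
    have h := norm_iteratedFDeriv_clm_add_le (ContinuousLinearMap.id ℝ ℝ) 0 hn x
    simp only [ContinuousLinearMap.id_apply, add_zero, Bool.false_eq_true, if_false] at h ⊢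
    rcases Nat.lt_or_ge 1 n with hn1 | hn1
    · rw [if_neg (by omega)] at h
      exact h.trans (by positivity)
    · obtain rfl : n = 1 := by omega
      rw [if_pos rfl, ContinuousLinearMap.norm_id] at h
      rw [one_mul, pow_one, mul_inv_cancel₀ h0.ne']
      exact h
  · simp only [if_true]
    exact (isSymbol_const (fun _ => 1) (fun _ x _ => by positivity)
      (fun _ x _ => by simpa using one_le_sqrt_one_add_sq x)).hasSymbolDeriv

lemma norm_iteratedFDeriv_succ_eq_deriv {f f' : ℝ → ℝ} (hf : ∀ y, HasDerivAt f (f' y) y) (n : ℕ)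
    (y : ℝ) : ‖iteratedFDeriv ℝ (n + 1) f y‖ = ‖iteratedFDeriv ℝ n f' y‖ := by
  rw [norm_iteratedFDeriv_eq_norm_iteratedDeriv, norm_iteratedFDeriv_eq_norm_iteratedDeriv,
    iteratedDeriv_succ', show deriv f = f' from funext fun y => (hf y).deriv]

lemma exists_bound_iteratedFDeriv_arctan (n : ℕ) :
    ∃ C, 0 ≤ C ∧ ∀ y, ‖iteratedFDeriv ℝ n Real.arctan y‖ ≤ C := by
  cases n with
  | zero =>
    refine ⟨Real.pi / 2, by positivity, fun y => ?_⟩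
    rw [norm_iteratedFDeriv_zero, Real.norm_eq_abs]
    exact abs_le.2 ⟨(Real.neg_pi_div_two_lt_arctan y).le, (Real.arctan_lt_pi_div_two y).le⟩
  | succ n =>
    obtain ⟨C, hC, hb⟩ := (isSymbol_one_add_sq.inv (fun _ x _ => by positivity)
      (fun _ x _ => by positivity)).bound n
    refine ⟨C, hC, fun y => ?_⟩
    rw [norm_iteratedFDeriv_succ_eq_deriv (f' := fun y => (1 + y ^ 2)⁻¹)
      (fun y => by simpa using Real.hasDerivAt_arctan y)]
    refine (hb () y (mem_univ y)).trans (mul_le_of_le_one_right hC ?_)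
    refine mul_le_one₀ (inv_le_one_of_one_le₀ (by nlinarith [sq_nonneg y])) (by positivity)
      (pow_le_one₀ (by positivity) (inv_le_one_of_one_le₀ (one_le_sqrt_one_add_sq y)))

lemma hasSymbolDeriv_arsinh :
    HasSymbolDeriv (fun _ : Unit => (univ : Set ℝ)) (fun _ => Real.arsinh) (fun _ _ => 1)
      (fun _ y => (√(1 + y ^ 2))⁻¹) := by
  refine ⟨fun _ x _ => Real.contDiff_arsinh.contDiffAt, fun n hn => ?_⟩
  obtain ⟨n, rfl⟩ : ∃ k, n = k + 1 := ⟨n - 1, by omega⟩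
  have h1 := isSymbol_one_add_sq.sqrt (fun _ x _ => by positivity) (fun _ x _ => by positivity)
  obtain ⟨C, hC, hb⟩ := (h1.inv (fun _ x _ => by positivity) (fun _ x _ => by positivity)).bound n
  refine ⟨C, hC, fun _ y hy => ?_⟩
  rw [norm_iteratedFDeriv_succ_eq_deriv Real.hasDerivAt_arsinh, one_mul, pow_succ']
  exact hb () y hy

lemma exists_bound_iteratedFDeriv_psi (n : ℕ) :
    ∃ C, 0 ≤ C ∧ ∀ y, ‖iteratedFDeriv ℝ n psi y‖ * √(1 + y ^ 2) ^ n ≤ C := by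
  have h1 : IsSymbol (fun _ : Unit => (univ : Set ℝ)) (fun _ y => Real.arctan (Real.arsinh y))
      (fun _ _ => 1) (fun _ y => (√(1 + y ^ 2))⁻¹) := by
    refine hasSymbolDeriv_arsinh.comp (fun _ x _ => Real.contDiff_arctan.contDiffAt)
      (fun n => ?_) (fun _ x _ => by positivity)
    obtain ⟨C, hC, hb⟩ := exists_bound_iteratedFDeriv_arctan n
    exact ⟨C, hC, fun _ x _ => by simpa using hb _⟩
  have h2 : IsSymbol (fun _ : Unit => (univ : Set ℝ)) (fun _ => psi)
      (fun _ _ => |2 / Real.pi| * 1) (fun _ y => (√(1 + y ^ 2))⁻¹) :=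
    (isSymbol_const (fun _ => 2 / Real.pi) (fun _ x _ => by positivity)
      (fun _ x _ => le_rfl)).mul h1
  obtain ⟨C, hC, hb⟩ := h2.bound n
  refine ⟨C * (|2 / Real.pi| * 1), by positivity, fun y => ?_⟩
  refine (mul_le_mul_of_nonneg_right (hb () y (mem_univ y)) (by positivity)).trans_eq ?_
  have h0 : √(1 + y ^ 2) ≠ 0 := by positivity
  rw [inv_pow]; field_simp

/-- `psi'` decays slower than any power of exponent less than `-1`. -/
lemma exists_le_psi' {δ : ℝ} (hδ : 0 < δ) :
    ∃ c, 0 < c ∧ ∀ y, c * (1 + |y|) ^ (-1 - δ) ≤ psi' y := by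
  -- `arsinh |y| ≤ log (2 (1 + |y|)) ≤ (2 (1 + |y|)) ^ (δ / 2) / (δ / 2)`
  have harsinh : ∀ y, Real.arsinh y ^ 2 ≤ (2 ^ (δ / 2) / (δ / 2)) ^ 2 * (1 + |y|) ^ δ := fun y => by
    have h0 : 0 < 1 + |y| := by positivity
    have h1 : |Real.arsinh y| = Real.arsinh |y| := by
      rcases abs_cases y with ⟨h, h'⟩ | ⟨h, h'⟩
      · rw [h, abs_of_nonneg (Real.arsinh_nonneg_iff.2 h')]
      · rw [h, Real.arsinh_neg, abs_of_neg (Real.arsinh_neg_iff.2 h')]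
    have h2 : Real.arsinh |y| ≤ Real.log (2 * (1 + |y|)) := by
      unfold Real.arsinh
      refine Real.log_le_log (by positivity) ?_
      have : √(1 + |y| ^ 2) ≤ 1 + |y| := Real.sqrt_le_iff.2 ⟨h0.le, by nlinarith [abs_nonneg y]⟩
      linarith
    have h3 : Real.log (2 * (1 + |y|)) ≤ (2 * (1 + |y|)) ^ (δ / 2) / (δ / 2) :=
      Real.log_le_rpow_div (by positivity) (by positivity)
    have h4 : |Real.arsinh y| ≤ 2 ^ (δ / 2) / (δ / 2) * (1 + |y|) ^ (δ / 2) := by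
      rw [h1]; refine h2.trans (h3.trans_eq ?_)
      rw [Real.mul_rpow (by norm_num) h0.le]; ring
    calc Real.arsinh y ^ 2 = |Real.arsinh y| ^ 2 := (sq_abs _).symm
      _ ≤ (2 ^ (δ / 2) / (δ / 2) * (1 + |y|) ^ (δ / 2)) ^ 2 := by gcongr
      _ = _ := by
        rw [mul_pow, ← Real.rpow_natCast ((1 + |y|) ^ (δ / 2)), ← Real.rpow_mul h0.le]
        norm_num
  set K := (2 ^ (δ / 2) / (δ / 2)) ^ 2 with hK
  have hK0 : 0 ≤ K := by positivity
  have hpi := Real.pi_pos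
  refine ⟨2 / Real.pi / (1 + K), by positivity, fun y => ?_⟩
  have h0 : 0 < 1 + |y| := by positivity
  have h1 : 1 + Real.arsinh y ^ 2 ≤ (1 + K) * (1 + |y|) ^ δ := by
    have : 1 ≤ (1 + |y|) ^ δ := Real.one_le_rpow (by linarith [abs_nonneg y]) hδ.le
    nlinarith [harsinh y]
  have h2 : √(1 + y ^ 2) ≤ 1 + |y| :=
    Real.sqrt_le_iff.2 ⟨h0.le, by nlinarith [abs_nonneg y, sq_abs y]⟩
  have h3 : (1 + |y|) ^ (-1 - δ) = ((1 + |y|) ^ δ * (1 + |y|))⁻¹ := by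
    rw [show -1 - δ = -(δ + 1) by ring, Real.rpow_neg h0.le, Real.rpow_add h0, Real.rpow_one]
  unfold psi'
  rw [h3, div_mul_eq_mul_div, mul_div_assoc]
  refine mul_le_mul_of_nonneg_left ?_ (by positivity)
  rw [one_div, ← mul_inv, div_eq_mul_inv, ← mul_inv]
  refine inv_anti₀ (by positivity) ?_
  calc _ ≤ ((1 + K) * (1 + |y|) ^ δ) * (1 + |y|) :=
        mul_le_mul h1 h2 (by positivity) (by positivity)
    _ = _ := by ring

end OneVariable

/-! ### The thickening map of the lattice of cubes of radius `1` -/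

section Symbol

variable {ι E : Type*} [NormedAddCommGroup E] [NormedSpace ℝ E]
variable {A : ι → Set E} {f g M N W : ι → E → ℝ}

lemma IsSymbol.prod {κ : Type*} (s : Finset κ) {F : κ → ι → E → ℝ}
    (hW : ∀ i, ∀ x ∈ A i, 0 ≤ W i x) (h : ∀ k ∈ s, IsSymbol A (F k) (fun _ _ => 1) W) :
    IsSymbol A (fun i x => ∏ k ∈ s, F k i x) (fun _ _ => 1) W := by
  classical
  induction s using Finset.induction_on with
  | empty =>
    simp only [Finset.prod_empty]
    exact isSymbol_const (fun _ => 1) hW (by simp)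
  | insert a s ha ih =>
    simp only [Finset.prod_insert ha]
    simpa using (h a (by simp)).mul (ih fun k hk => h k (by simp [hk]))

/-- Setting a symbol to zero for some of the indices leaves a symbol. -/
lemma IsSymbol.ite (p : ι → Prop) [DecidablePred p]
    (h : IsSymbol (fun i => {x | x ∈ A i ∧ p i}) f M W)
    (hW : ∀ i, ∀ x ∈ A i, 0 ≤ W i x) (hM : ∀ i, ∀ x ∈ A i, 0 ≤ M i x) :
    IsSymbol A (fun i x => if p i then f i x else 0) M W := by
  refine ⟨fun i x hx => ?_, fun n => ?_⟩
  · by_cases hp : p i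
    · simpa [hp] using h.contDiffAt i x ⟨hx, hp⟩
    · simpa [hp] using contDiffAt_const
  · obtain ⟨C, hC, hb⟩ := h.bound n
    refine ⟨C, hC, fun i x hx => ?_⟩
    by_cases hp : p i
    · simpa [hp] using hb i x ⟨hx, hp⟩
    · have h0 : iteratedFDeriv ℝ n (fun _ : E => (0 : ℝ)) x = 0 := by simp
      have := hM i x hx
      have := hW i x hx
      simp only [hp, if_false, h0, norm_zero]
      positivity

/-- Functions with bounded derivatives are symbols at every scale which is bounded above. -/
lemma IsSymbol.one_of_one_le_mul (h : IsSymbol A f (fun _ _ => 1) (fun _ _ => 1)) {c : ℝ}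
    (hc : 0 ≤ c) (hW : ∀ i, ∀ x ∈ A i, 1 ≤ c * W i x) : IsSymbol A f (fun _ _ => 1) W :=
  h.mono fun n => ⟨c ^ n, by positivity, fun i x hx => by
    simpa [mul_pow] using one_le_pow₀ (n := n) (hW i x hx)⟩

end Symbol

section Construction

variable {m : ℕ}

/-- The centred coordinate of a real number: its signed distance to the nearest even integer. -/
noncomputable def ctr (t : ℝ) : ℝ := t - 2 * (round (t / 2) : ℝ)

lemma abs_ctr_le_one (t : ℝ) : |ctr t| ≤ 1 := by
  have h := abs_sub_round (t / 2)
  have : ctr t = 2 * (t / 2 - round (t / 2)) := by unfold ctr; ring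
  rw [this, abs_mul, abs_two]; linarith

/-- Around the cell of an integer `c`, the centred coordinate is `t - 2 * c`, except close to the
boundary of the cell. -/
lemma round_eq_or_near {d t : ℝ} (hd0 : 0 < d) {c : ℤ} (h : |t - 2 * c| < 1 + d) :
    round (t / 2) = c ∨ (1 - d ≤ |ctr t| ∧ 1 - d ≤ |t - 2 * c|) := by
  by_cases hc : round (t / 2) = c
  · exact Or.inl hc
  refine Or.inr ?_
  have h1 : (1 : ℝ) ≤ |(round (t / 2) : ℝ) - c| := by
    have : 1 ≤ |round (t / 2) - c| := Int.one_le_abs (sub_ne_zero.2 hc)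
    exact_mod_cast this
  have h2 := abs_ctr_le_one t
  have h3 : 2 * ((round (t / 2) : ℝ) - c) = (t - 2 * c) - ctr t := by unfold ctr; ring
  have h4 : 2 * |(round (t / 2) : ℝ) - c| ≤ |t - 2 * c| + |ctr t| := by
    have h5 : |2 * ((round (t / 2) : ℝ) - c)| = 2 * |(round (t / 2) : ℝ) - c| := by
      rw [abs_mul, abs_two]
    rw [← h5, h3]; exact abs_sub _ _
  constructor <;> linarith

/-- The smooth bump of the cube of radius `1` and centre `2 z`: it is `1` on that cube and vanishes
outside the cube of radius `1 + ρ / 3`. -/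
noncomputable def cubeBump (ρ : ℝ) (z : Fin m → ℤ) (x : EuclideanSpace ℝ (Fin m)) : ℝ :=
  ∏ i, plateau 1 (1 + ρ / 3) (x i - 2 * (z i : ℝ))

/-- The number of cubes with centre in `2 V` around `x`, counted smoothly. -/
noncomputable def cubeCount (ρ : ℝ) (V : Set (Fin m → ℤ)) (x : EuclideanSpace ℝ (Fin m)) : ℝ :=
  ∑ᶠ z : Fin m → ℤ, V.indicator (fun z => cubeBump ρ z x) z

/-- A smooth function which vanishes on the cubes with centre in `2 V` and is `1` away from them. -/
noncomputable def offset (ρ : ℝ) (V : Set (Fin m → ℤ)) (x : EuclideanSpace ℝ (Fin m)) : ℝ :=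
  Real.smoothTransition (1 - cubeCount ρ V x)

/-- A smooth function which is `1` where `offset` is small and vanishes away from the cubes with
centre in `2 V`. -/
noncomputable def cutoff (ρ : ℝ) (V : Set (Fin m → ℤ)) (x : EuclideanSpace ℝ (Fin m)) : ℝ :=
  Real.smoothTransition (2 * cubeCount ρ V x)

/-- The regularised squared distance to the subspaces on which the centred coordinates with index
in `J` vanish. -/
noncomputable def sqDist (ρ : ℝ) (V : Set (Fin m → ℤ)) (J : Finset (Fin m))
    (x : EuclideanSpace ℝ (Fin m)) : ℝ :=
  ∑ j ∈ J, Real.sin (Real.pi / 2 * x j) ^ 2 + offset ρ V x ^ 2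

/-- The sum of the inverse regularised squared distances over all `J` with `ℓ + 1` elements. -/
noncomputable def invSqDist (ρ : ℝ) (V : Set (Fin m → ℤ)) (ℓ : ℕ)
    (x : EuclideanSpace ℝ (Fin m)) : ℝ :=
  ∑ J : Finset (Fin m), if J.card = ℓ + 1 then (sqDist ρ V J x)⁻¹ else 0

/-- The weight: comparable with the inverse of the distance to the dual skeleton, near it. -/
noncomputable def weight (ρ : ℝ) (V : Set (Fin m → ℤ)) (ℓ : ℕ)
    (x : EuclideanSpace ℝ (Fin m)) : ℝ := √(invSqDist ρ V ℓ x)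

/-- The rate of dilation as a function of the weight: increasing, while `dilation A w / w` is
decreasing. -/
noncomputable def dilation (A w : ℝ) : ℝ := A * w * (2 - psi w)

/-- The displacement of the centred coordinate `ξ` at dilation rate `l` and cutoff `k`. For `k = 1`
the coordinate is moved to `(1 - 2 * ρ / 3) * psi (l * ξ)` if `|ξ| ≤ 1 - 2 * ρ / 3`; nothing is moved
if `1 - ρ / 3 ≤ |ξ|`, which makes the map smooth across the faces of the cells. -/
noncomputable def displacement (ρ k l ξ : ℝ) : ℝ :=
  k * plateau (1 - 2 * ρ / 3) (1 - ρ / 3) ξ * ((1 - 2 * ρ / 3) * psi (l * ξ) - ξ)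

/-- The thickening map for cubes of radius `1` with centres in `2 ℤ ^ m`, for the family of the cubes
with centre in `2 V`: all centred coordinates are dilated at a common rate, given by the weight, and
then compressed by `psi`. -/
noncomputable def thick (ρ A : ℝ) (V : Set (Fin m → ℤ)) (ℓ : ℕ) (x : EuclideanSpace ℝ (Fin m)) :
    EuclideanSpace ℝ (Fin m) :=
  WithLp.toLp 2 fun i =>
    x i + displacement ρ (cutoff ρ V x) (dilation A (weight ρ V ℓ x)) (ctr (x i))

/-- The set of points where all the regularised distances are positive. -/
def regularSet (ρ : ℝ) (V : Set (Fin m → ℤ)) (ℓ : ℕ) : Set (EuclideanSpace ℝ (Fin m)) :=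
  {x | ∀ J : Finset (Fin m), J.card = ℓ + 1 → 0 < sqDist ρ V J x}

/-! ### Bounded derivatives of the cutoff functions -/

lemma norm_proj_le (i : Fin m) : ‖(EuclideanSpace.proj i : EuclideanSpace ℝ (Fin m) →L[ℝ] ℝ)‖ ≤ 1 :=
  ContinuousLinearMap.opNorm_le_bound _ zero_le_one fun x => by
    simpa using PiLp.norm_apply_le x i 

lemma hasSymbolDeriv_coord {ι : Type*} {A : ι → Set (EuclideanSpace ℝ (Fin m))} (i : ι → Fin m)
    (c : ι → ℝ) :
    HasSymbolDeriv A (fun k x => x (i k) + c k) (fun _ _ => 1) (fun _ _ => 1) :=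
  ⟨fun k x _ => by fun_prop, fun n hn => ⟨1, zero_le_one, fun k x _ => by
    have h := norm_iteratedFDeriv_clm_add_le (EuclideanSpace.proj (i k) :
      EuclideanSpace ℝ (Fin m) →L[ℝ] ℝ) (c k) hn x
    have h2 := norm_proj_le (m := m) (i k)
    refine h.trans ?_
    split_ifs <;> simp [h2]⟩⟩

lemma isSymbol_cubeBump {ρ : ℝ} (hρ : 0 < ρ) :
    IsSymbol (fun _ : Fin m → ℤ => (univ : Set (EuclideanSpace ℝ (Fin m)))) (cubeBump ρ)
      (fun _ _ => 1) (fun _ _ => 1) := by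
  refine IsSymbol.prod _ (fun _ _ _ => zero_le_one) fun i _ => ?_
  have h := hasSymbolDeriv_coord (A := fun _ : Fin m → ℤ => (univ : Set (EuclideanSpace ℝ (Fin m))))
    (fun _ => i) (fun z => -(2 * (z i : ℝ)))
  refine h.comp (φ := plateau 1 (1 + ρ / 3)) (fun _ _ _ => (plateau_contDiff _ _).contDiffAt)
    (fun n => ?_) (fun _ _ _ => zero_le_one)
  obtain ⟨C, hC, hb⟩ := exists_bound_iteratedFDeriv_of_hasCompactSupport (plateau_contDiff 1 (1 + ρ / 3))
    (plateau_hasCompactSupport zero_le_one (by linarith)) n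
  exact ⟨C, hC, fun _ x _ => by simpa using hb _⟩

/-- A finite set of indices which contains those of all cubes close to `x`. -/
noncomputable def nearBox (x : EuclideanSpace ℝ (Fin m)) : Finset (Fin m → ℤ) :=
  Fintype.piFinset fun i => Finset.Icc ⌈(x i - 4) / 2⌉ ⌊(x i + 4) / 2⌋

lemma card_nearBox_le (x : EuclideanSpace ℝ (Fin m)) : (nearBox x).card ≤ 5 ^ m := by
  rw [nearBox, Fintype.card_piFinset]
  refine (Finset.prod_le_prod' fun i _ => ?_).trans_eq (by simp : ∏ _i : Fin m, 5 = 5 ^ m)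
  rw [Int.card_Icc]
  have h1 := Int.le_ceil ((x i - 4) / 2)
  have h2 := Int.floor_le ((x i + 4) / 2)
  have h3 : ((⌊(x i + 4) / 2⌋ : ℝ) - ⌈(x i - 4) / 2⌉) ≤ 4 := by linarith
  have h4 : ⌊(x i + 4) / 2⌋ - ⌈(x i - 4) / 2⌉ ≤ 4 := by exact_mod_cast h3
  omega

lemma cubeBump_eq_zero {ρ : ℝ} (hρ : 0 < ρ) {z : Fin m → ℤ} {x : EuclideanSpace ℝ (Fin m)}
    {i : Fin m} (h : 1 + ρ / 3 ≤ |x i - 2 * (z i : ℝ)|) : cubeBump ρ z x = 0 :=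
  Finset.prod_eq_zero (Finset.mem_univ i) (plateau_eq_zero zero_le_one (by linarith) h)

lemma cubeBump_nonneg (ρ : ℝ) (z : Fin m → ℤ) (x : EuclideanSpace ℝ (Fin m)) :
    0 ≤ cubeBump ρ z x :=
  Finset.prod_nonneg fun _ _ => plateau_nonneg _ _ _

open scoped Classical in
lemma cubeCount_eq_sum {ρ : ℝ} (hρ₀ : 0 < ρ) (hρ₁ : ρ < 1) (V : Set (Fin m → ℤ))
    {x y : EuclideanSpace ℝ (Fin m)} (hxy : ∀ i, |y i - x i| ≤ 1) :
    cubeCount ρ V y = ∑ z ∈ nearBox x, if z ∈ V then cubeBump ρ z y else 0 := by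
  unfold cubeCount
  rw [finsum_eq_sum_of_support_subset (s := nearBox x)]
  · rfl
  intro z hz
  by_contra hzb
  refine hz ?_
  obtain ⟨i, hi⟩ : ∃ i, z i ∉ Finset.Icc ⌈(x i - 4) / 2⌉ ⌊(x i + 4) / 2⌋ := by
    by_contra hcon
    push Not at hcon
    exact hzb (Finset.mem_coe.2 (Fintype.mem_piFinset.2 hcon))
  have h0 : cubeBump ρ z y = 0 := by
    refine cubeBump_eq_zero hρ₀ (i := i) ?_
    have h1 := abs_le.1 (hxy i)
    rw [Finset.mem_Icc, Int.ceil_le, Int.le_floor, not_and_or, not_le, not_le] at hi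
    rcases hi with hi | hi
    · exact le_trans (by linarith) (le_abs_self _)
    · exact le_trans (by linarith) (neg_le_abs _)
  simp [Set.indicator, h0]

lemma isSymbol_cubeCount {ρ : ℝ} (hρ₀ : 0 < ρ) (hρ₁ : ρ < 1) :
    IsSymbol (fun _ : Set (Fin m → ℤ) => (univ : Set (EuclideanSpace ℝ (Fin m)))) (cubeCount ρ)
      (fun _ _ => 1) (fun _ _ => 1) := by
  classical
  have hb := isSymbol_cubeBump (m := m) hρ₀
  have hev : ∀ (V : Set (Fin m → ℤ)) (x : EuclideanSpace ℝ (Fin m)),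
      cubeCount ρ V =ᶠ[nhds x] fun y => ∑ z ∈ nearBox x, if z ∈ V then cubeBump ρ z y else 0 := by
    intro V x
    filter_upwards [Metric.ball_mem_nhds x one_pos] with y hy
    refine cubeCount_eq_sum hρ₀ hρ₁ V fun i => ?_
    have h1 := PiLp.norm_apply_le (y - x) i
    rw [← dist_eq_norm] at h1
    exact h1.trans (Metric.mem_ball.1 hy).le
  have hd : ∀ (V : Set (Fin m → ℤ)) (z : Fin m → ℤ),
      ContDiff ℝ ∞ (fun y => if z ∈ V then cubeBump ρ z y else 0) := fun V z => by
    by_cases hz : z ∈ V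
    · simpa [hz] using contDiff_iff_contDiffAt.2 fun y => hb.contDiffAt z y (mem_univ _)
    · simpa [hz] using contDiff_const
  refine ⟨fun V x _ => ?_, fun n => ?_⟩
  · exact (ContDiff.sum fun z _ => hd V z).contDiffAt.congr_of_eventuallyEq (hev V x)
  · obtain ⟨C, hC, hC'⟩ := hb.bound n
    refine ⟨5 ^ m * C, by positivity, fun V x _ => ?_⟩
    rw [((hev V x).iteratedFDeriv ℝ n).eq_of_nhds, iteratedFDeriv_fun_sum_apply
      (fun z _ => ((hd V z).of_le (by exact_mod_cast le_top)).contDiffAt)]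
    refine (norm_sum_le_of_le _ (f := fun z => _) (n := fun _ => C) fun z _ => ?_).trans ?_
    · by_cases hz : z ∈ V
      · simpa [hz] using hC' z x (mem_univ _)
      · have h0 : iteratedFDeriv ℝ n (fun _ : EuclideanSpace ℝ (Fin m) => (0 : ℝ)) x = 0 := by simp
        simp only [hz, if_false, h0, norm_zero]; exact hC
    · rw [Finset.sum_const, nsmul_eq_mul]
      simp only [one_pow, mul_one]
      have : ((nearBox x).card : ℝ) ≤ 5 ^ m := by exact_mod_cast card_nearBox_le x
      gcongr

lemma isSymbol_smoothTransition_comp {ι E : Type*} [NormedAddCommGroup E] [NormedSpace ℝ E]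
    {A : ι → Set E} {f W : ι → E → ℝ} (hf : HasSymbolDeriv A f (fun _ _ => 1) W)
    (hW : ∀ i, ∀ x ∈ A i, 0 ≤ W i x) :
    IsSymbol A (fun i x => Real.smoothTransition (f i x)) (fun _ _ => 1) W :=
  hf.comp (fun _ _ _ => Real.smoothTransition.contDiffAt (n := ⊤)) (fun n => by
    obtain ⟨C, hC, hb⟩ := exists_bound_iteratedFDeriv_smoothTransition n
    exact ⟨C, hC, fun _ x _ => by simpa using hb _⟩) hW

lemma isSymbol_offset {ρ : ℝ} (hρ₀ : 0 < ρ) (hρ₁ : ρ < 1) :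
    IsSymbol (fun _ : Set (Fin m → ℤ) => (univ : Set (EuclideanSpace ℝ (Fin m)))) (offset ρ)
      (fun _ _ => 1) (fun _ _ => 1) := by
  have h0 := isSymbol_cubeCount (m := m) hρ₀ hρ₁
  have h1 : IsSymbol (fun _ : Set (Fin m → ℤ) => (univ : Set (EuclideanSpace ℝ (Fin m))))
      (fun _ _ => -1) (fun _ _ => 1) (fun _ _ => 1) :=
    isSymbol_const _ (fun _ _ _ => zero_le_one) (by simp)
  have h2 : IsSymbol (fun _ : Set (Fin m → ℤ) => (univ : Set (EuclideanSpace ℝ (Fin m))))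
      (fun _ _ => 1) (fun _ _ => 1) (fun _ _ => 1) :=
    isSymbol_const _ (fun _ _ _ => zero_le_one) (by simp)
  refine isSymbol_smoothTransition_comp (IsSymbol.hasSymbolDeriv ?_) (fun _ _ _ => zero_le_one)
  have h3 := h1.mul h0
  simp only [mul_one] at h3
  exact (h2.add h3).congr fun V x _ => Filter.Eventually.of_forall fun y => by ring

lemma isSymbol_cutoff {ρ : ℝ} (hρ₀ : 0 < ρ) (hρ₁ : ρ < 1) :
    IsSymbol (fun _ : Set (Fin m → ℤ) => (univ : Set (EuclideanSpace ℝ (Fin m)))) (cutoff ρ)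
      (fun _ _ => 1) (fun _ _ => 1) := by
  have h0 := isSymbol_cubeCount (m := m) hρ₀ hρ₁
  refine isSymbol_smoothTransition_comp (IsSymbol.hasSymbolDeriv ?_) (fun _ _ _ => zero_le_one)
  exact (h0.add h0).congr fun V x _ => Filter.Eventually.of_forall fun y => by ring

end Construction

section Estimates

variable {m : ℕ} {ρ : ℝ}

/-! ### Symbol estimates for the weight and for the thickening map -/

lemma offset_nonneg (ρ : ℝ) (V : Set (Fin m → ℤ)) (x : EuclideanSpace ℝ (Fin m)) :
    0 ≤ offset ρ V x := Real.smoothTransition.nonneg _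

lemma offset_le_one (ρ : ℝ) (V : Set (Fin m → ℤ)) (x : EuclideanSpace ℝ (Fin m)) :
    offset ρ V x ≤ 1 := Real.smoothTransition.le_one _

lemma sqDist_nonneg (ρ : ℝ) (V : Set (Fin m → ℤ)) (J : Finset (Fin m))
    (x : EuclideanSpace ℝ (Fin m)) : 0 ≤ sqDist ρ V J x := by
  unfold sqDist; positivity

lemma sqDist_le (ρ : ℝ) (V : Set (Fin m → ℤ)) (J : Finset (Fin m))
    (x : EuclideanSpace ℝ (Fin m)) : sqDist ρ V J x ≤ m + 1 := by
  unfold sqDist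
  have h1 : ∑ j ∈ J, Real.sin (Real.pi / 2 * x j) ^ 2 ≤ m :=
    calc _ ≤ ∑ _j ∈ J, (1 : ℝ) := Finset.sum_le_sum fun j _ => Real.sin_sq_le_one _
      _ = J.card := by simp
      _ ≤ m := by exact_mod_cast (Finset.card_le_univ J).trans_eq (Fintype.card_fin m)
  have h2 := pow_le_one₀ (n := 2) (offset_nonneg ρ V x) (offset_le_one ρ V x)
  linarith

lemma exists_bound_iteratedFDeriv_sin (n : ℕ) :
    ∃ C, 0 ≤ C ∧ ∀ y, ‖iteratedFDeriv ℝ n (fun t => Real.sin (Real.pi / 2 * t)) y‖ ≤ C := by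
  refine ⟨(Real.pi / 2) ^ n, by positivity, fun y => ?_⟩
  rw [norm_iteratedFDeriv_eq_norm_iteratedDeriv, iteratedDeriv_comp_const_mul Real.contDiff_sin,
    norm_mul, Real.norm_of_nonneg (by positivity)]
  refine mul_le_of_le_one_right (by positivity) ?_
  exact Real.abs_iteratedDeriv_sin_le_one n _

lemma isSymbol_sin {ι : Type*} {A : ι → Set (EuclideanSpace ℝ (Fin m))} (j : ι → Fin m) :
    IsSymbol A (fun i x => Real.sin (Real.pi / 2 * x (j i))) (fun _ _ => 1) (fun _ _ => 1) := by
  have h := hasSymbolDeriv_coord (A := A) j (fun _ => 0)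
  simp only [add_zero] at h
  refine h.comp (φ := fun t => Real.sin (Real.pi / 2 * t)) (fun _ _ _ => by fun_prop)
    (fun n => ?_) (fun _ _ _ => zero_le_one)
  obtain ⟨C, hC, hb⟩ := exists_bound_iteratedFDeriv_sin n
  exact ⟨C, hC, fun _ x _ => by simpa using hb _⟩

lemma isSymbol_sqDist (hρ₀ : 0 < ρ) (hρ₁ : ρ < 1) :
    IsSymbol (fun i : Set (Fin m → ℤ) × Finset (Fin m) => {x | 0 < sqDist ρ i.1 i.2 x})
      (fun i => sqDist ρ i.1 i.2) (fun i => sqDist ρ i.1 i.2)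
      (fun i x => (√(sqDist ρ i.1 i.2 x))⁻¹) := by
  classical
  -- functions with bounded derivatives satisfy the bounds asked of the terms of a sum of squares
  have key : ∀ F : Set (Fin m → ℤ) × Finset (Fin m) → EuclideanSpace ℝ (Fin m) → ℝ,
      IsSymbol (fun i : Set (Fin m → ℤ) × Finset (Fin m) => {x | 0 < sqDist ρ i.1 i.2 x}) F
        (fun _ _ => 1) (fun _ _ => 1) →
      HasSymbolDeriv (fun i : Set (Fin m → ℤ) × Finset (Fin m) => {x | 0 < sqDist ρ i.1 i.2 x}) F
        (fun i x => √(sqDist ρ i.1 i.2 x)) (fun i x => (√(sqDist ρ i.1 i.2 x))⁻¹) := by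
    intro F hF
    refine hF.hasSymbolDeriv.mono fun n hn => ⟨√(m + 1) ^ n, by positivity, fun i x hx => ?_⟩
    obtain ⟨k, rfl⟩ : ∃ k, n = k + 1 := ⟨n - 1, by omega⟩
    have hs : 0 < √(sqDist ρ i.1 i.2 x) := Real.sqrt_pos.2 hx
    have hsQ : √(sqDist ρ i.1 i.2 x) ≤ √(m + 1) := Real.sqrt_le_sqrt (sqDist_le _ _ _ _)
    have hQ : 1 ≤ √((m : ℝ) + 1) := Real.one_le_sqrt.2 (by linarith [Nat.cast_nonneg (α := ℝ) m])
    have h1 : 1 ≤ (√(m + 1) * (√(sqDist ρ i.1 i.2 x))⁻¹) ^ k :=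
      one_le_pow₀ (by rw [← div_eq_mul_inv, one_le_div hs]; exact hsQ)
    calc (1 : ℝ) * 1 ^ (k + 1) = 1 * 1 := by simp
      _ ≤ √(m + 1) * (√(m + 1) * (√(sqDist ρ i.1 i.2 x))⁻¹) ^ k :=
        mul_le_mul hQ h1 zero_le_one (by positivity)
      _ = _ := by rw [pow_succ (√(sqDist ρ i.1 i.2 x))⁻¹, mul_pow]; field_simp; ring
  have hterm : ∀ j : Option (Fin m), HasSymbolDeriv
      (fun i : Set (Fin m → ℤ) × Finset (Fin m) => {x | 0 < sqDist ρ i.1 i.2 x})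
      (fun i x => match j with
        | none => offset ρ i.1 x
        | some j => if j ∈ i.2 then Real.sin (Real.pi / 2 * x j) else 0)
      (fun i x => √(sqDist ρ i.1 i.2 x)) (fun i x => (√(sqDist ρ i.1 i.2 x))⁻¹) := by
    intro j
    refine key _ ?_
    cases j with
    | none => exact (isSymbol_offset hρ₀ hρ₁).comap Prod.fst (fun _ => subset_univ _)
    | some j =>
      exact (isSymbol_sin fun _ => j).ite
        (fun i : Set (Fin m → ℤ) × Finset (Fin m) => j ∈ i.2) (fun _ _ _ => zero_le_one)
        (fun _ _ _ => zero_le_one)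
  refine isSymbol_sum_sq Finset.univ (fun i => ?_) (fun i x hx => hx) fun j _ => hterm j
  funext x
  rw [Fintype.sum_option, sqDist, add_comm]
  congr 1
  simp only [ite_pow, ne_eq, OfNat.ofNat_ne_zero, not_false_eq_true, zero_pow]
  rw [Finset.sum_ite_mem, Finset.univ_inter]

lemma invSqDist_term_nonneg (ρ : ℝ) (V : Set (Fin m → ℤ)) (ℓ : ℕ) (J : Finset (Fin m))
    (x : EuclideanSpace ℝ (Fin m)) :
    0 ≤ if J.card = ℓ + 1 then (sqDist ρ V J x)⁻¹ else 0 := by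
  split_ifs
  · exact inv_nonneg.2 (sqDist_nonneg _ _ _ _)
  · exact le_rfl

lemma invSqDist_nonneg (ρ : ℝ) (V : Set (Fin m → ℤ)) (ℓ : ℕ) (x : EuclideanSpace ℝ (Fin m)) :
    0 ≤ invSqDist ρ V ℓ x := Finset.sum_nonneg fun J _ => invSqDist_term_nonneg ρ V ℓ J x

lemma inv_sqDist_le_invSqDist {V : Set (Fin m → ℤ)} {ℓ : ℕ} {J : Finset (Fin m)}
    (hJ : J.card = ℓ + 1) (x : EuclideanSpace ℝ (Fin m)) :
    (sqDist ρ V J x)⁻¹ ≤ invSqDist ρ V ℓ x := by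
  have h := Finset.single_le_sum (f := fun J : Finset (Fin m) =>
    if J.card = ℓ + 1 then (sqDist ρ V J x)⁻¹ else 0)
    (fun J _ => invSqDist_term_nonneg ρ V ℓ J x) (Finset.mem_univ J)
  simpa [hJ, invSqDist] using h

lemma exists_card_eq {ℓ : ℕ} (hℓ : ℓ < m) : ∃ J : Finset (Fin m), J.card = ℓ + 1 := by
  obtain ⟨J, _, hJ⟩ := Finset.exists_subset_card_eq (s := (Finset.univ : Finset (Fin m)))
    (n := ℓ + 1) (by simpa using hℓ)
  exact ⟨J, hJ⟩

lemma inv_le_invSqDist {V : Set (Fin m → ℤ)} {ℓ : ℕ} (hℓ : ℓ < m) {x : EuclideanSpace ℝ (Fin m)}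
    (hx : x ∈ regularSet ρ V ℓ) : ((m : ℝ) + 1)⁻¹ ≤ invSqDist ρ V ℓ x := by
  obtain ⟨J, hJ⟩ := exists_card_eq hℓ
  exact (inv_anti₀ (hx J hJ) (sqDist_le _ _ _ _)).trans (inv_sqDist_le_invSqDist hJ x)

lemma invSqDist_pos {V : Set (Fin m → ℤ)} {ℓ : ℕ} (hℓ : ℓ < m) {x : EuclideanSpace ℝ (Fin m)}
    (hx : x ∈ regularSet ρ V ℓ) : 0 < invSqDist ρ V ℓ x :=
  lt_of_lt_of_le (by positivity) (inv_le_invSqDist hℓ hx)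

lemma weight_nonneg (ρ : ℝ) (V : Set (Fin m → ℤ)) (ℓ : ℕ) (x : EuclideanSpace ℝ (Fin m)) :
    0 ≤ weight ρ V ℓ x := Real.sqrt_nonneg _

lemma weight_pos {V : Set (Fin m → ℤ)} {ℓ : ℕ} (hℓ : ℓ < m) {x : EuclideanSpace ℝ (Fin m)}
    (hx : x ∈ regularSet ρ V ℓ) : 0 < weight ρ V ℓ x := Real.sqrt_pos.2 (invSqDist_pos hℓ hx)

lemma weight_sq {V : Set (Fin m → ℤ)} {ℓ : ℕ} (x : EuclideanSpace ℝ (Fin m)) :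
    weight ρ V ℓ x ^ 2 = invSqDist ρ V ℓ x := Real.sq_sqrt (invSqDist_nonneg _ _ _ _)

lemma one_le_mul_weight {V : Set (Fin m → ℤ)} {ℓ : ℕ} (hℓ : ℓ < m) {x : EuclideanSpace ℝ (Fin m)}
    (hx : x ∈ regularSet ρ V ℓ) : 1 ≤ √(m + 1) * weight ρ V ℓ x := by
  have h := Real.sqrt_le_sqrt (inv_le_invSqDist hℓ hx)
  rw [Real.sqrt_inv] at h
  have h0 : 0 < √((m : ℝ) + 1) := by positivity
  calc (1 : ℝ) = √(m + 1) * (√(m + 1))⁻¹ := (mul_inv_cancel₀ h0.ne').symm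
    _ ≤ _ := mul_le_mul_of_nonneg_left h h0.le

/-- The domain of the thickening maps with respect to all families of cubes and all dimensions. -/
abbrev domains (m : ℕ) (ρ : ℝ) : Set (Fin m → ℤ) × Fin m → Set (EuclideanSpace ℝ (Fin m)) :=
  fun i => regularSet ρ i.1 i.2

lemma isSymbol_invSqDist (hρ₀ : 0 < ρ) (hρ₁ : ρ < 1) :
    IsSymbol (domains m ρ) (fun i => invSqDist ρ i.1 i.2) (fun i => invSqDist ρ i.1 i.2)
      (fun i => weight ρ i.1 i.2) := by
  refine IsSymbol.sum _ (fun i x _ => weight_nonneg _ _ _ _) (fun i x _ => invSqDist_nonneg _ _ _ _)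
    fun J _ => IsSymbol.ite
      (fun i : Set (Fin m → ℤ) × Fin m => J.card = (i.2 : ℕ) + 1) ?_ (fun i x _ => weight_nonneg _ _ _ _)
      (fun i x _ => invSqDist_nonneg _ _ _ _)
  have h1 := (isSymbol_sqDist (m := m) hρ₀ hρ₁).inv (fun i x hx => hx) (fun i x _ => by positivity)
  refine (h1.comap (fun i : Set (Fin m → ℤ) × Fin m => (i.1, J))
    (B := fun i => {x | x ∈ domains m ρ i ∧ J.card = (i.2 : ℕ) + 1})
    (fun i x hx => hx.1 J hx.2)).mono fun n => ⟨1, zero_le_one, fun i x hx => ?_⟩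
  have h2 := inv_sqDist_le_invSqDist (ρ := ρ) (V := i.1) hx.2 x
  have h3 : 0 ≤ (sqDist ρ i.1 J x)⁻¹ := inv_nonneg.2 (sqDist_nonneg _ _ _ _)
  rw [one_mul]
  have h4 : (√(sqDist ρ i.1 J x))⁻¹ ≤ weight ρ i.1 i.2 x := by
    rw [← Real.sqrt_inv]; exact Real.sqrt_le_sqrt h2
  have h5 := invSqDist_nonneg ρ i.1 i.2 x
  gcongr

lemma isSymbol_weight (hρ₀ : 0 < ρ) (hρ₁ : ρ < 1) :
    IsSymbol (domains m ρ) (fun i => weight ρ i.1 i.2) (fun i => weight ρ i.1 i.2)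
      (fun i => weight ρ i.1 i.2) :=
  (isSymbol_invSqDist hρ₀ hρ₁).sqrt (fun i _ hx => invSqDist_pos i.2.2 hx)
    (fun _ _ _ => weight_nonneg _ _ _ _)

lemma isSymbol_dilation (hρ₀ : 0 < ρ) (hρ₁ : ρ < 1) (A : ℝ) :
    IsSymbol (domains m ρ) (fun i x => dilation A (weight ρ i.1 i.2 x))
      (fun i => weight ρ i.1 i.2) (fun i => weight ρ i.1 i.2) := by
  have hW : ∀ i, ∀ x ∈ domains m ρ i, 0 ≤ weight ρ i.1 i.2 x := fun _ _ _ => weight_nonneg _ _ _ _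
  have h0 := isSymbol_weight (m := m) hρ₀ hρ₁
  have h1 : IsSymbol (domains m ρ) (fun i x => psi (weight ρ i.1 i.2 x)) (fun _ _ => 1)
      (fun i => weight ρ i.1 i.2) := by
    refine h0.hasSymbolDeriv.comp (fun _ _ _ => psi_contDiff.contDiffAt) (fun n => ?_) hW
    obtain ⟨C, hC, hb⟩ := exists_bound_iteratedFDeriv_psi n
    refine ⟨C, hC, fun i x hx => ?_⟩
    rw [mul_one]
    refine (mul_le_mul_of_nonneg_left (pow_le_pow_left₀ (hW i x hx) ?_ n) (norm_nonneg _)).trans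
      (hb (weight ρ i.1 i.2 x))
    exact (le_abs_self _).trans (abs_le_sqrt_one_add_sq _)
  have h2 : IsSymbol (domains m ρ) (fun i x => 2 * A + (-A) * psi (weight ρ i.1 i.2 x))
      (fun _ _ => 2 * |A|) (fun i => weight ρ i.1 i.2) := by
    refine IsSymbol.add (isSymbol_const (fun _ => 2 * A) hW
      fun i x hx => by rw [abs_mul, abs_two]) ?_
    refine ((isSymbol_const (M := fun _ _ => |A|) (fun _ => -A) hW
      fun i x hx => by rw [abs_neg]).mul h1).mono_size (C := 1) zero_le_one hW fun i x hx => ?_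
    have := abs_nonneg A
    linarith
  refine ((h0.mul h2).mono_size (C := 2 * |A|) (by positivity) hW
    fun i x _ => (mul_comm _ _).le).congr fun i x _ => Filter.Eventually.of_forall fun y => ?_
  unfold dilation; ring

lemma dilation_nonneg {A w : ℝ} (hA : 0 ≤ A) (hw : 0 ≤ w) : 0 ≤ dilation A w :=
  mul_nonneg (mul_nonneg hA hw) (by linarith [psi_lt_one w])

lemma mul_le_dilation {A w : ℝ} (hA : 0 ≤ A) (hw : 0 ≤ w) : A * w ≤ dilation A w := by
  have := mul_nonneg hA hw
  have := psi_lt_one w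
  unfold dilation; nlinarith

lemma dilation_le {A w : ℝ} (hA : 0 ≤ A) (hw : 0 ≤ w) : dilation A w ≤ 2 * A * w := by
  have := mul_nonneg hA hw
  have := psi_nonneg hw
  unfold dilation; nlinarith

/-- In the cell of centre `2 c`, the displacement of a coordinate is a symbol of size `1`: the
dilation rate is large near the dual skeleton, but it only enters through the product with the
coordinate, and derivatives of `psi` absorb such products. -/
lemma isSymbol_displacement (hρ₀ : 0 < ρ) (hρ₁ : ρ < 1) {A : ℝ} (hA : 1 ≤ A) :
    IsSymbol (fun i : (Set (Fin m → ℤ) × Fin m) × (Fin m × ℤ) =>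
        {x | x ∈ domains m ρ i.1 ∧ |x i.2.1 - 2 * (i.2.2 : ℝ)| ≤ 1})
      (fun i x => displacement ρ (cutoff ρ i.1.1 x) (dilation A (weight ρ i.1.1 i.1.2 x))
        (x i.2.1 - 2 * (i.2.2 : ℝ)))
      (fun _ _ => 1) (fun i => weight ρ i.1.1 i.1.2) := by
  set B : (Set (Fin m → ℤ) × Fin m) × (Fin m × ℤ) → Set (EuclideanSpace ℝ (Fin m)) :=
    fun i => {x | x ∈ domains m ρ i.1 ∧ |x i.2.1 - 2 * (i.2.2 : ℝ)| ≤ 1} with hB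
  have hW : ∀ i, ∀ x ∈ B i, 0 ≤ weight ρ i.1.1 i.1.2 x := fun _ _ _ => weight_nonneg _ _ _ _
  have hW1 : ∀ i, ∀ x ∈ B i, 1 ≤ √(m + 1) * weight ρ i.1.1 i.1.2 x :=
    fun i x hx => one_le_mul_weight i.1.2.2 hx.1
  have hc : HasSymbolDeriv B (fun i x => x i.2.1 - 2 * (i.2.2 : ℝ)) (fun _ _ => 1) (fun _ _ => 1) := by
    simpa only [sub_eq_add_neg] using hasSymbolDeriv_coord (A := B) (fun i => i.2.1)
      (fun i => -(2 * (i.2.2 : ℝ)))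
  have hc0 : IsSymbol B (fun i x => x i.2.1 - 2 * (i.2.2 : ℝ)) (fun _ _ => 1)
      (fun i => weight ρ i.1.1 i.1.2) :=
    (hc.isSymbol zero_le_one fun i x hx => by simpa using hx.2).one_of_one_le_mul
      (Real.sqrt_nonneg _) hW1
  have hk : IsSymbol B (fun i => cutoff ρ i.1.1) (fun _ _ => 1) (fun i => weight ρ i.1.1 i.1.2) :=
    ((isSymbol_cutoff hρ₀ hρ₁).comap (fun i : (Set (Fin m → ℤ) × Fin m) × (Fin m × ℤ) => i.1.1)
      (B := B) (fun _ => subset_univ _)).one_of_one_le_mul (Real.sqrt_nonneg _) hW1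
  have ht : IsSymbol B (fun i x => plateau (1 - 2 * ρ / 3) (1 - ρ / 3) (x i.2.1 - 2 * (i.2.2 : ℝ)))
      (fun _ _ => 1) (fun i => weight ρ i.1.1 i.1.2) := by
    refine IsSymbol.one_of_one_le_mul (hc.comp (φ := plateau (1 - 2 * ρ / 3) (1 - ρ / 3))
      (fun _ _ _ => (plateau_contDiff _ _).contDiffAt) (fun n => ?_) (fun _ _ _ => zero_le_one))
      (Real.sqrt_nonneg _) hW1
    obtain ⟨C, hC, hb⟩ := exists_bound_iteratedFDeriv_of_hasCompactSupport
      (plateau_contDiff (1 - 2 * ρ / 3) (1 - ρ / 3))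
      (plateau_hasCompactSupport (by linarith) (by linarith)) n
    exact ⟨C, hC, fun _ x _ => by simpa using hb _⟩
  have hl : IsSymbol B (fun i x => dilation A (weight ρ i.1.1 i.1.2 x))
      (fun i => weight ρ i.1.1 i.1.2) (fun i => weight ρ i.1.1 i.1.2) :=
    (isSymbol_dilation hρ₀ hρ₁ A).comap Prod.fst fun i x hx => hx.1
  -- the coordinate itself has the sharper size `|ξ| + 1 / W`
  have hc1 : IsSymbol B (fun i x => x i.2.1 - 2 * (i.2.2 : ℝ))
      (fun i x => |x i.2.1 - 2 * (i.2.2 : ℝ)| + (weight ρ i.1.1 i.1.2 x)⁻¹)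
      (fun i => weight ρ i.1.1 i.1.2) := by
    refine HasSymbolDeriv.isSymbol (C := 1) ?_ zero_le_one fun i x hx => ?_
    · refine hc.mono fun n hn => ⟨√(m + 1) ^ n, by positivity, fun i x hx => ?_⟩
      obtain ⟨k, rfl⟩ : ∃ k, n = k + 1 := ⟨n - 1, by omega⟩
      have hw : 0 < weight ρ i.1.1 i.1.2 x := weight_pos i.1.2.2 hx.1
      have hQ : 1 ≤ √((m : ℝ) + 1) := Real.one_le_sqrt.2 (by linarith [Nat.cast_nonneg (α := ℝ) m])
      have h1 := one_le_pow₀ (n := k) (hW1 i x hx)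
      calc (1 : ℝ) * 1 ^ (k + 1) = 1 * 1 := by simp
        _ ≤ √(m + 1) * (√(m + 1) * weight ρ i.1.1 i.1.2 x) ^ k :=
          mul_le_mul hQ h1 zero_le_one (by positivity)
        _ = √(m + 1) ^ (k + 1) * ((weight ρ i.1.1 i.1.2 x)⁻¹ * weight ρ i.1.1 i.1.2 x ^ (k + 1)) := by
          rw [mul_pow, pow_succ' (weight ρ i.1.1 i.1.2 x)]; field_simp; ring
        _ ≤ _ := by
          gcongr
          exact le_add_of_nonneg_left (abs_nonneg _)
    · rw [one_mul]
      exact le_add_of_nonneg_right (inv_nonneg.2 (hW i x hx))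
  have hlc := hl.mul hc1
  have hpsi : IsSymbol B (fun i x => psi (dilation A (weight ρ i.1.1 i.1.2 x) *
      (x i.2.1 - 2 * (i.2.2 : ℝ)))) (fun _ _ => 1) (fun i => weight ρ i.1.1 i.1.2) := by
    refine hlc.hasSymbolDeriv.comp (φ := psi) (fun _ _ _ => psi_contDiff.contDiffAt) (fun n => ?_) hW
    obtain ⟨C, hC, hb⟩ := exists_bound_iteratedFDeriv_psi n
    refine ⟨C * 2 ^ n, by positivity, fun i x hx => ?_⟩
    have hw : 0 < weight ρ i.1.1 i.1.2 x := weight_pos i.1.2.2 hx.1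
    set w := weight ρ i.1.1 i.1.2 x
    set ξ := x i.2.1 - 2 * (i.2.2 : ℝ)
    have h1 : w * (|ξ| + w⁻¹) ≤ 2 * √(1 + (dilation A w * ξ) ^ 2) := by
      have h2 := abs_le_sqrt_one_add_sq (dilation A w * ξ)
      have h3 := one_le_sqrt_one_add_sq (dilation A w * ξ)
      have h4 : w ≤ dilation A w :=
        le_trans (by nlinarith) (mul_le_dilation (by linarith) hw.le)
      rw [abs_mul, abs_of_nonneg (hw.le.trans h4)] at h2
      rw [mul_add, mul_inv_cancel₀ hw.ne']
      have := mul_le_mul_of_nonneg_right h4 (abs_nonneg ξ)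
      linarith
    calc _ ≤ ‖iteratedFDeriv ℝ n psi (dilation A w * ξ)‖ *
          (2 * √(1 + (dilation A w * ξ) ^ 2)) ^ n := by gcongr
      _ = (‖iteratedFDeriv ℝ n psi (dilation A w * ξ)‖ *
          √(1 + (dilation A w * ξ) ^ 2) ^ n) * 2 ^ n := by rw [mul_pow]; ring
      _ ≤ C * 2 ^ n * 1 := by
          rw [mul_one]; gcongr; exact hb _
  have hconst : ∀ c : ℝ, IsSymbol B (fun _ _ => c) (fun _ _ => |c|)
      (fun i => weight ρ i.1.1 i.1.2) := fun c => isSymbol_const _ hW fun _ _ _ => le_rfl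
  have h1 := (hconst (1 - 2 * ρ / 3)).mul hpsi
  have h2 := (hconst (-1)).mul hc0
  have h3 := IsSymbol.add (h1.mono_size (M' := fun _ _ => 1) (C := |1 - 2 * ρ / 3|) (abs_nonneg _)
    hW fun _ _ _ => le_rfl) (h2.mono_size (M' := fun _ _ => 1) (C := |(-1 : ℝ)|) (abs_nonneg _)
    hW fun _ _ _ => le_rfl)
  have h4 := (hk.mul ht).mul h3
  simp only [mul_one] at h4
  exact h4.congr fun i x _ => Filter.Eventually.of_forall fun y => by
    unfold displacement; ring

end Estimates

/-! ### Smoothness and derivative bounds of the thickening map -/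

section Thick

variable {m : ℕ} {ρ A : ℝ} {V : Set (Fin m → ℤ)} {ℓ : ℕ}

lemma displacement_eq_zero (hρ₀ : 0 < ρ) (hρ₁ : ρ < 1) (k l : ℝ) {ξ : ℝ} (h : 1 - ρ / 3 ≤ |ξ|) :
    displacement ρ k l ξ = 0 := by
  rw [displacement, plateau_eq_zero (by linarith) (by linarith) h]; ring

lemma displacement_ctr_eq (hρ₀ : 0 < ρ) (hρ₁ : ρ < 1) (k l : ℝ) {t : ℝ} {c : ℤ}
    (h : |t - 2 * (c : ℝ)| < 1 + ρ / 3) :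
    displacement ρ k l (ctr t) = displacement ρ k l (t - 2 * c) := by
  rcases round_eq_or_near (by linarith) h with h1 | ⟨h1, h2⟩
  · rw [ctr, h1]
  · rw [displacement_eq_zero hρ₀ hρ₁ _ _ h1, displacement_eq_zero hρ₀ hρ₁ _ _ h2]

lemma abs_apply_sub_le_dist (x y : EuclideanSpace ℝ (Fin m)) (i : Fin m) : |y i - x i| ≤ dist y x := by
  have h1 := PiLp.norm_apply_le (y - x) i
  rwa [← dist_eq_norm] at h1

lemma thick_apply (x : EuclideanSpace ℝ (Fin m)) (i : Fin m) : thick ρ A V ℓ x i =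
    x i + displacement ρ (cutoff ρ V x) (dilation A (weight ρ V ℓ x)) (ctr (x i)) := rfl

/-- Near a point, the discontinuous centred coordinates can be replaced by affine functions. -/
lemma eventually_displacement_ctr_eq (hρ₀ : 0 < ρ) (hρ₁ : ρ < 1) (x : EuclideanSpace ℝ (Fin m)) :
    ∀ᶠ y in nhds x, ∀ (i : Fin m) (k l : ℝ),
      displacement ρ k l (ctr (y i)) = displacement ρ k l (y i - 2 * (round (x i / 2) : ℝ)) := by
  filter_upwards [Metric.ball_mem_nhds x (show 0 < ρ / 3 by linarith)] with y hy i k l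
  refine displacement_ctr_eq hρ₀ hρ₁ k l ?_
  have h1 := abs_apply_sub_le_dist x y i
  have h2 := Metric.mem_ball.1 hy
  have h3 : |x i - 2 * (round (x i / 2) : ℝ)| ≤ 1 := abs_ctr_le_one (x i)
  calc |y i - 2 * (round (x i / 2) : ℝ)| = |(y i - x i) + (x i - 2 * (round (x i / 2) : ℝ))| := by
        ring_nf
    _ ≤ |y i - x i| + |x i - 2 * (round (x i / 2) : ℝ)| := abs_add_le _ _
    _ < 1 + ρ / 3 := by linarith

lemma euclidean_eq_sum (f : Fin m → ℝ) :
    (WithLp.toLp 2 f : EuclideanSpace ℝ (Fin m)) = ∑ i, f i • EuclideanSpace.single i (1 : ℝ) := by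
  ext j
  simp [Pi.single_apply]

lemma norm_iteratedFDeriv_toLp_le {E : Type*} [NormedAddCommGroup E] [NormedSpace ℝ E]
    {f : Fin m → E → ℝ} {x : E} (hf : ∀ i, ContDiffAt ℝ ∞ (f i) x) (n : ℕ) :
    ‖iteratedFDeriv ℝ n (fun y => (WithLp.toLp 2 fun i => f i y : EuclideanSpace ℝ (Fin m))) x‖ ≤
      ∑ i, ‖iteratedFDeriv ℝ n (f i) x‖ := by
  have hn : ∀ i, ContDiffAt ℝ n (f i) x := fun i => (hf i).of_le (by exact_mod_cast le_top)
  simp only [euclidean_eq_sum]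
  rw [iteratedFDeriv_fun_sum_apply
    (f := fun i y => f i y • (EuclideanSpace.single i (1 : ℝ) : EuclideanSpace ℝ (Fin m)))
    fun i _ => (hn i).smul contDiffAt_const]
  refine norm_sum_le_of_le _ fun i _ => ?_
  rw [iteratedFDeriv_smul_const_apply (hn i)]
  refine (ContinuousLinearMap.norm_compContinuousMultilinearMap_le _ _).trans ?_
  refine mul_le_of_le_one_left (norm_nonneg _) ?_
  rw [ContinuousLinearMap.norm_smulRight_apply]
  simp

/-- The thickening map in the neighbourhood of a regular point, in affine coordinates. -/
lemma thick_eventuallyEq (hρ₀ : 0 < ρ) (hρ₁ : ρ < 1) (x : EuclideanSpace ℝ (Fin m)) :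
    thick ρ A V ℓ =ᶠ[nhds x] fun y => WithLp.toLp 2 fun i => y i +
      displacement ρ (cutoff ρ V y) (dilation A (weight ρ V ℓ y))
        (y i - 2 * (round (x i / 2) : ℝ)) := by
  filter_upwards [eventually_displacement_ctr_eq hρ₀ hρ₁ x] with y hy
  unfold thick
  congr 1
  funext i
  rw [hy]

lemma contDiffAt_displacement (hρ₀ : 0 < ρ) (hρ₁ : ρ < 1) (hA : 1 ≤ A) (hℓ : ℓ < m)
    {x : EuclideanSpace ℝ (Fin m)} (hx : x ∈ regularSet ρ V ℓ) (i : Fin m) :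
    ContDiffAt ℝ ∞ (fun y : EuclideanSpace ℝ (Fin m) => displacement ρ (cutoff ρ V y)
      (dilation A (weight ρ V ℓ y)) (y i - 2 * (round (x i / 2) : ℝ))) x :=
  (isSymbol_displacement hρ₀ hρ₁ hA).contDiffAt ((V, ⟨ℓ, hℓ⟩), (i, round (x i / 2))) x
    ⟨hx, abs_ctr_le_one (x i)⟩

lemma contDiffAt_coord (x : EuclideanSpace ℝ (Fin m)) (i : Fin m) :
    ContDiffAt ℝ ∞ (fun y : EuclideanSpace ℝ (Fin m) => y i) x := by fun_prop

lemma contDiffAt_thick (hρ₀ : 0 < ρ) (hρ₁ : ρ < 1) (hA : 1 ≤ A) (hℓ : ℓ < m)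
    {x : EuclideanSpace ℝ (Fin m)} (hx : x ∈ regularSet ρ V ℓ) :
    ContDiffAt ℝ ∞ (thick ρ A V ℓ) x := by
  refine ContDiffAt.congr_of_eventuallyEq ?_ (thick_eventuallyEq hρ₀ hρ₁ x)
  exact contDiffAt_euclidean.2 fun i =>
    (contDiffAt_coord x i).add (contDiffAt_displacement hρ₀ hρ₁ hA hℓ hx i)

/-- Each derivative of the thickening map costs a factor comparable with the weight, uniformly in
the family of cubes. -/
lemma exists_bound_iteratedFDeriv_thick (m : ℕ) (hρ₀ : 0 < ρ) (hρ₁ : ρ < 1) (hA : 1 ≤ A) {n : ℕ}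
    (hn : 1 ≤ n) : ∃ C, 0 ≤ C ∧ ∀ (V : Set (Fin m → ℤ)) (ℓ : ℕ), ℓ < m → ∀ x ∈ regularSet ρ V ℓ,
      ‖iteratedFDeriv ℝ n (thick ρ A V ℓ) x‖ ≤ C * weight ρ V ℓ x ^ n := by
  obtain ⟨C, hC, hb⟩ := (isSymbol_displacement (m := m) hρ₀ hρ₁ hA).bound n
  refine ⟨m * (√(m + 1) ^ n + C), by positivity, fun V ℓ hℓ x hx => ?_⟩
  have hd := contDiffAt_displacement hρ₀ hρ₁ hA hℓ hx
  rw [((thick_eventuallyEq hρ₀ hρ₁ x).iteratedFDeriv ℝ n).eq_of_nhds]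
  refine (norm_iteratedFDeriv_toLp_le (fun i => (contDiffAt_coord x i).add (hd i)) n).trans ?_
  have hi : ∀ i ∈ (Finset.univ : Finset (Fin m)), ‖iteratedFDeriv ℝ n
      (fun y : EuclideanSpace ℝ (Fin m) => y i + displacement ρ (cutoff ρ V y)
        (dilation A (weight ρ V ℓ y)) (y i - 2 * (round (x i / 2) : ℝ))) x‖ ≤
      (√(m + 1) ^ n + C) * weight ρ V ℓ x ^ n := by
    intro i _
    rw [fun_iteratedFDeriv_add_apply ((contDiffAt_coord x i).of_le (by exact_mod_cast le_top))
      ((hd i).of_le (by exact_mod_cast le_top)), add_mul]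
    refine (norm_add_le _ _).trans (add_le_add ?_ ?_)
    · have h1 := norm_iteratedFDeriv_clm_add_le (EuclideanSpace.proj i :
        EuclideanSpace ℝ (Fin m) →L[ℝ] ℝ) 0 hn x
      simp only [add_zero] at h1
      refine h1.trans ?_
      rw [← mul_pow]
      refine le_trans ?_ (one_le_pow₀ (one_le_mul_weight hℓ hx))
      split_ifs
      · exact norm_proj_le i
      · exact zero_le_one
    · have := hb ((V, ⟨ℓ, hℓ⟩), (i, round (x i / 2))) x ⟨hx, abs_ctr_le_one (x i)⟩
      simpa using this
  refine (Finset.sum_le_sum hi).trans_eq ?_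
  simp; ring

/-! ### The displacement in one variable -/

/-- The value `ξ + displacement` is a convex combination of `ξ` and a multiple of `psi (l ξ)`. -/
lemma add_displacement_eq (k l ξ : ℝ) : ξ + displacement ρ k l ξ =
    (1 - k * plateau (1 - 2 * ρ / 3) (1 - ρ / 3) ξ) * ξ +
      k * plateau (1 - 2 * ρ / 3) (1 - ρ / 3) ξ * ((1 - 2 * ρ / 3) * psi (l * ξ)) := by
  unfold displacement; ring

lemma displacement_neg (k l ξ : ℝ) : displacement ρ k l (-ξ) = -displacement ρ k l ξ := by
  unfold displacement; rw [plateau_neg, mul_neg, psi_neg]; ring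

variable {k l l' ξ ξ' : ℝ}

lemma convex_weight_mem (hk₀ : 0 ≤ k) (hk₁ : k ≤ 1) (ξ : ℝ) :
    0 ≤ k * plateau (1 - 2 * ρ / 3) (1 - ρ / 3) ξ ∧
      k * plateau (1 - 2 * ρ / 3) (1 - ρ / 3) ξ ≤ 1 :=
  ⟨mul_nonneg hk₀ (plateau_nonneg _ _ _), mul_le_one₀ hk₁ (plateau_nonneg _ _ _) (plateau_le_one _ _ _)⟩

lemma abs_add_displacement_lt (hρ₀ : 0 < ρ) (hρ₁ : ρ < 1) (hk₀ : 0 ≤ k) (hk₁ : k ≤ 1)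
    (h : |ξ| < 1 - ρ / 3) : |ξ + displacement ρ k l ξ| < 1 - ρ / 3 := by
  rw [add_displacement_eq]
  obtain ⟨h0, h1⟩ := convex_weight_mem (ρ := ρ) hk₀ hk₁ ξ
  set t := k * plateau (1 - 2 * ρ / 3) (1 - ρ / 3) ξ
  have h2 := abs_lt.1 (abs_psi_lt_one (l * ξ))
  have h3 := abs_lt.1 h
  have ha : 0 < 1 - 2 * ρ / 3 := by linarith
  have h4 : (1 - 2 * ρ / 3) * psi (l * ξ) < 1 - ρ / 3 := by nlinarith
  have h5 : -(1 - ρ / 3) < (1 - 2 * ρ / 3) * psi (l * ξ) := by nlinarith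
  rcases h0.eq_or_lt with h0 | h0
  · rw [← h0]; simpa using h
  · rw [abs_lt]; constructor <;> nlinarith

lemma add_displacement_pos (hρ₁ : ρ < 1) (hk₀ : 0 ≤ k) (hk₁ : k ≤ 1) (hl : 0 < l) (h : 0 < ξ) :
    0 < ξ + displacement ρ k l ξ := by
  rw [add_displacement_eq]
  obtain ⟨h0, h1⟩ := convex_weight_mem (ρ := ρ) hk₀ hk₁ ξ
  set t := k * plateau (1 - 2 * ρ / 3) (1 - ρ / 3) ξ
  have ha : 0 < 1 - 2 * ρ / 3 := by linarith
  have h2 : 0 < psi (l * ξ) := by simpa using psi_strictMono (mul_pos hl h)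
  have h3 : 0 < (1 - 2 * ρ / 3) * psi (l * ξ) := mul_pos ha h2
  rcases h1.eq_or_lt with h1 | h1
  · rw [h1]; linarith
  · have := mul_pos (sub_pos.2 h1) h
    have := mul_nonneg h0 h3.le
    linarith

/-- If two nonnegative coordinates, displaced with the same cutoff and with rates `l'` and `l`,
satisfy `l ξ < l' ξ'` and `ξ < ξ'`, then the displaced coordinates are in the same order. -/
lemma add_displacement_lt (hρ₀ : 0 < ρ) (hρ₁ : ρ < 1) (hk₀ : 0 ≤ k) (hk₁ : k ≤ 1) (hξ : 0 ≤ ξ)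
    (h : ξ < ξ') (hl : l * ξ < l' * ξ') :
    ξ + displacement ρ k l ξ < ξ' + displacement ρ k l' ξ' := by
  unfold displacement
  have hp := plateau_anti (c := 1 - 2 * ρ / 3) (d := 1 - ρ / 3) (x := ξ) (y := ξ')
    (by linarith) (by linarith) (by rw [abs_of_nonneg hξ, abs_of_pos (hξ.trans_lt h)]; exact h.le)
  have hp0 := plateau_nonneg (1 - 2 * ρ / 3) (1 - ρ / 3) ξ
  have hp1 := plateau_le_one (1 - 2 * ρ / 3) (1 - ρ / 3) ξ
  have ha : 0 < 1 - 2 * ρ / 3 := by linarith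
  have hlt : (1 - 2 * ρ / 3) * psi (l * ξ) < (1 - 2 * ρ / 3) * psi (l' * ξ') :=
    mul_lt_mul_of_pos_left (psi_strictMono hl) ha
  -- where the plateau function varies, the saturated profile is below the coordinate
  have hvar : 0 ≤ (plateau (1 - 2 * ρ / 3) (1 - ρ / 3) ξ - plateau (1 - 2 * ρ / 3) (1 - ρ / 3) ξ') *
      (ξ' - (1 - 2 * ρ / 3) * psi (l' * ξ')) := by
    by_cases hξ' : |ξ'| ≤ 1 - 2 * ρ / 3
    · rw [plateau_eq_one (by linarith) hξ', plateau_eq_one (by linarith)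
        (by rw [abs_of_nonneg hξ]; rw [abs_of_pos (hξ.trans_lt h)] at hξ'; linarith)]
      simp
    · rw [abs_of_pos (hξ.trans_lt h), not_le] at hξ'
      refine mul_nonneg (by linarith) ?_
      nlinarith [psi_lt_one (l' * ξ')]
  set τ := plateau (1 - 2 * ρ / 3) (1 - ρ / 3) ξ
  set τ' := plateau (1 - 2 * ρ / 3) (1 - ρ / 3) ξ'
  set P := (1 - 2 * ρ / 3) * psi (l * ξ)
  set P' := (1 - 2 * ρ / 3) * psi (l' * ξ')
  have h1 : ξ' + k * τ' * (P' - ξ') - (ξ + k * τ * (P - ξ)) =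
      (1 - k) * (ξ' - ξ) + k * (τ * (P' - P) + (1 - τ) * (ξ' - ξ) + (τ - τ') * (ξ' - P')) := by ring
  have h2 : 0 < τ * (P' - P) + (1 - τ) * (ξ' - ξ) + (τ - τ') * (ξ' - P') := by
    rcases hp0.eq_or_lt with h0 | h0
    · have : τ = 0 := h0.symm
      rw [this] at hvar ⊢; linarith
    · have := mul_pos h0 (sub_pos.2 hlt)
      have := mul_nonneg (sub_nonneg.2 hp1) (sub_pos.2 h).le
      linarith
  rcases hk₀.eq_or_lt with h0 | h0
  · rw [← h0] at h1 ⊢; linarith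
  · have := mul_pos h0 h2
    have := mul_nonneg (sub_nonneg.2 hk₁) (sub_pos.2 h).le
    linarith

/-- Along a level set of the displaced coordinate, the coordinate grows at most like the inverse of
the dilation rate. -/
lemma abs_mul_le_of_add_displacement_eq (hρ₀ : 0 < ρ) (hρ₁ : ρ < 1) (hk₀ : 0 ≤ k) (hk₁ : k ≤ 1)
    (hl' : 0 < l') (hll' : l' ≤ l)
    (h : ξ + displacement ρ k l ξ = ξ' + displacement ρ k l' ξ') : l' * |ξ'| ≤ l * |ξ| := by
  -- by symmetry, both coordinates may be assumed nonnegative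
  have key : ∀ ξ ξ' : ℝ, 0 ≤ ξ → ξ + displacement ρ k l ξ = ξ' + displacement ρ k l' ξ' →
      l' * |ξ'| ≤ l * |ξ| := by
    intro ξ ξ' hξ h
    have hξ' : 0 ≤ ξ' := by
      by_contra hneg
      have h1 := add_displacement_pos (ρ := ρ) (ξ := -ξ') hρ₁ hk₀ hk₁ hl' (by linarith)
      rw [displacement_neg] at h1
      rcases hξ.eq_or_lt with h0 | h0
      · rw [← h0] at h; simp [displacement] at h; simp only [displacement] at h1; linarith
      · have h2 := add_displacement_pos (ρ := ρ) hρ₁ hk₀ hk₁ (hl'.trans_le hll') h0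
        linarith
    rw [abs_of_nonneg hξ, abs_of_nonneg hξ']
    by_contra hlt
    push Not at hlt
    have h1 : ξ < ξ' := by
      by_contra hge
      push Not at hge
      have : l' * ξ' ≤ l * ξ := mul_le_mul hll' hge hξ' (hl'.le.trans hll')
      linarith
    exact absurd h (add_displacement_lt hρ₀ hρ₁ hk₀ hk₁ hξ h1 hlt).ne
  rcases le_total 0 ξ with hξ | hξ
  · exact key ξ ξ' hξ h
  · have h1 := key (-ξ) (-ξ') (by linarith) (by rw [displacement_neg, displacement_neg]; linarith)
    rwa [abs_neg, abs_neg] at h1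

lemma abs_add_displacement_le_one (hρ₀ : 0 < ρ) (hρ₁ : ρ < 1) (hk₀ : 0 ≤ k) (hk₁ : k ≤ 1)
    (h : |ξ| ≤ 1) : |ξ + displacement ρ k l ξ| ≤ 1 := by
  rcases lt_or_ge |ξ| (1 - ρ / 3) with h1 | h1
  · exact (abs_add_displacement_lt hρ₀ hρ₁ hk₀ hk₁ h1).le.trans (by linarith)
  · rwa [displacement_eq_zero hρ₀ hρ₁ _ _ h1, add_zero]

end Thick

section Geometry

variable {m : ℕ} {ρ A : ℝ} {V : Set (Fin m → ℤ)} {ℓ : ℕ}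

/-! ### Centred coordinates and their sines -/

lemma two_mul_round_add_ctr (t : ℝ) : 2 * (round (t / 2) : ℝ) + ctr t = t := by unfold ctr; ring

/-- Points of two cells, one of them interior to its cell, are equal only if the cells are. -/
lemma int_eq_of_two_mul_add_eq {c c' : ℤ} {s t : ℝ} (hs : |s| < 1) (ht : |t| ≤ 1)
    (h : 2 * (c : ℝ) + s = 2 * c' + t) : c = c' := by
  have h1 := abs_lt.1 hs
  have h2 := abs_le.1 ht
  have h3 : ((c - c' : ℤ) : ℝ) < 1 := by push_cast; linarith
  have h4 : (-1 : ℝ) < ((c - c' : ℤ) : ℝ) := by push_cast; linarith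
  have h5 : c - c' < 1 := by exact_mod_cast h3
  have h6 : -1 < c - c' := by exact_mod_cast h4
  omega

lemma sin_sq_eq (t : ℝ) :
    Real.sin (Real.pi / 2 * t) ^ 2 = Real.sin (Real.pi / 2 * |ctr t|) ^ 2 := by
  have h1 : Real.sin (Real.pi / 2 * |ctr t|) ^ 2 = Real.sin (Real.pi / 2 * ctr t) ^ 2 := by
    rcases abs_cases (ctr t) with ⟨h, _⟩ | ⟨h, _⟩ <;> rw [h]
    rw [mul_neg, Real.sin_neg, neg_sq]
  have h2 : Real.pi / 2 * t = Real.pi / 2 * ctr t + (round (t / 2) : ℝ) * Real.pi := by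
    unfold ctr; ring
  rw [h1, h2, Real.sin_add_int_mul_pi, mul_pow]
  rcases Int.even_or_odd (round (t / 2)) with h | h
  · rw [h.neg_one_zpow]; simp
  · rw [h.neg_one_zpow]; simp

lemma abs_ctr_le_sin (t : ℝ) : |ctr t| ≤ Real.sin (Real.pi / 2 * |ctr t|) := by
  have hpi := Real.pi_pos
  have h := Real.mul_le_sin (x := Real.pi / 2 * |ctr t|) (by positivity)
    (by nlinarith [abs_ctr_le_one t])
  rwa [← mul_assoc, show 2 / Real.pi * (Real.pi / 2) = 1 by field_simp, one_mul] at h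

lemma ctr_sq_le_sin_sq (t : ℝ) : ctr t ^ 2 ≤ Real.sin (Real.pi / 2 * t) ^ 2 := by
  rw [sin_sq_eq, ← sq_abs]
  exact pow_le_pow_left₀ (abs_nonneg _) (abs_ctr_le_sin t) 2

lemma sin_sq_le_ctr_sq (t : ℝ) :
    Real.sin (Real.pi / 2 * t) ^ 2 ≤ (Real.pi / 2) ^ 2 * ctr t ^ 2 := by
  have hpi := Real.pi_pos
  rw [sin_sq_eq, ← sq_abs (ctr t), ← mul_pow]
  exact pow_le_pow_left₀ ((abs_nonneg _).trans (abs_ctr_le_sin t)) (Real.sin_le (by positivity)) 2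

lemma sin_le_mul_sin {u v μ : ℝ} (hu1 : u ≤ 1) (hv : 0 ≤ v) (hv1 : v ≤ 1) (hμ : 1 ≤ μ)
    (h : v ≤ μ * u) : Real.sin (Real.pi / 2 * v) ≤ μ * Real.sin (Real.pi / 2 * u) := by
  have hpi := Real.pi_pos
  have hμ0 : 0 < μ := by linarith
  have hcv := strictConcaveOn_sin_Icc.concaveOn.right
  have h1 := hcv (show Real.pi / 2 * v ∈ Icc 0 Real.pi from ⟨by positivity, by nlinarith⟩)
    (show (0 : ℝ) ∈ Icc 0 Real.pi from ⟨le_rfl, hpi.le⟩) (inv_nonneg.2 hμ0.le)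
    (sub_nonneg.2 (inv_le_one_of_one_le₀ hμ)) (by ring)
  simp only [smul_eq_mul, Real.sin_zero, mul_zero, add_zero] at h1
  have h2 : Real.sin (μ⁻¹ * (Real.pi / 2 * v)) ≤ Real.sin (Real.pi / 2 * u) := by
    refine Real.sin_le_sin_of_le_of_le_pi_div_two ?_ (by nlinarith) ?_
    · have : 0 ≤ μ⁻¹ * (Real.pi / 2 * v) := by positivity
      linarith
    · rw [inv_mul_le_iff₀ hμ0]; nlinarith
  calc _ = μ * (μ⁻¹ * Real.sin (Real.pi / 2 * v)) := by field_simp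
    _ ≤ _ := mul_le_mul_of_nonneg_left (h1.trans h2) hμ0.le

/-! ### The cutoffs do not see the displacement -/

/-- Away from the boundary of its cell, a coordinate enters the bumps only through its cell. -/
lemma plateau_eq_of_round_eq (hρ₀ : 0 < ρ) {s t : ℝ} (h : round (s / 2) = round (t / 2))
    (hs : |ctr s| ≤ 1 - ρ / 3) (ht : |ctr t| ≤ 1 - ρ / 3) (z : ℤ) :
    plateau 1 (1 + ρ / 3) (s - 2 * (z : ℝ)) = plateau 1 (1 + ρ / 3) (t - 2 * (z : ℝ)) := by
  have key : ∀ r : ℝ, |ctr r| ≤ 1 - ρ / 3 →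
      plateau 1 (1 + ρ / 3) (r - 2 * (z : ℝ)) = if round (r / 2) = z then 1 else 0 := by
    intro r hr
    split_ifs with hz
    · rw [← hz]
      exact plateau_eq_one (by linarith) (hr.trans (by linarith))
    · refine plateau_eq_zero zero_le_one (by linarith) ?_
      by_contra hlt
      push Not at hlt
      have h1 : (1 : ℝ) ≤ |(round (r / 2) : ℝ) - z| := by
        have : 1 ≤ |round (r / 2) - z| := Int.one_le_abs (sub_ne_zero.2 hz)
        exact_mod_cast this
      have h3 : 2 * ((round (r / 2) : ℝ) - z) = (r - 2 * z) - ctr r := by unfold ctr; ring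
      have h4 : 2 * |(round (r / 2) : ℝ) - z| ≤ |r - 2 * z| + |ctr r| := by
        have h5 : |2 * ((round (r / 2) : ℝ) - z)| = 2 * |(round (r / 2) : ℝ) - z| := by
          rw [abs_mul, abs_two]
        rw [← h5, h3]; exact abs_sub _ _
      linarith
  rw [key s hs, key t ht, h]

lemma cubeCount_congr (hρ₀ : 0 < ρ) {x y : EuclideanSpace ℝ (Fin m)}
    (h : ∀ i, x i = y i ∨ (round (x i / 2) = round (y i / 2) ∧ |ctr (x i)| < 1 - ρ / 3 ∧
      |ctr (y i)| < 1 - ρ / 3)) : cubeCount ρ V x = cubeCount ρ V y := by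
  unfold cubeCount
  refine finsum_congr fun z => ?_
  have : cubeBump ρ z x = cubeBump ρ z y := Finset.prod_congr rfl fun i _ => by
    rcases h i with h | ⟨h1, h2, h3⟩
    · rw [h]
    · exact plateau_eq_of_round_eq hρ₀ h1 h2.le h3.le (z i)
  simp only [Set.indicator, this]

lemma cutoff_nonneg (ρ : ℝ) (V : Set (Fin m → ℤ)) (x : EuclideanSpace ℝ (Fin m)) :
    0 ≤ cutoff ρ V x := Real.smoothTransition.nonneg _

lemma cutoff_le_one (ρ : ℝ) (V : Set (Fin m → ℤ)) (x : EuclideanSpace ℝ (Fin m)) :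
    cutoff ρ V x ≤ 1 := Real.smoothTransition.le_one _

lemma exists_mem_of_cubeCount_pos {x : EuclideanSpace ℝ (Fin m)} (hρ₀ : 0 < ρ)
    (h : 0 < cubeCount ρ V x) : ∃ z ∈ V, ∀ i, |x i - 2 * (z i : ℝ)| < 1 + ρ / 3 := by
  obtain ⟨z, hz⟩ : ∃ z, V.indicator (fun z => cubeBump ρ z x) z ≠ 0 := by
    by_contra hcon
    push Not at hcon
    exact h.ne' (finsum_eq_zero_of_forall_eq_zero hcon)
  have hzV : z ∈ V := by
    by_contra hzV
    simp [hzV] at hz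
  refine ⟨z, hzV, fun i => ?_⟩
  by_contra hi
  rw [Set.indicator_of_mem hzV, cubeBump_eq_zero hρ₀ (not_lt.1 hi)] at hz
  exact hz rfl

lemma one_le_cubeCount (hρ₀ : 0 < ρ) (hρ₁ : ρ < 1) {x : EuclideanSpace ℝ (Fin m)} {z : Fin m → ℤ}
    (hz : z ∈ V) (hx : ∀ i, |x i - 2 * (z i : ℝ)| ≤ 1) : 1 ≤ cubeCount ρ V x := by
  classical
  rw [cubeCount_eq_sum hρ₀ hρ₁ V (x := x) fun i => by simp]
  have h1 : cubeBump ρ z x = 1 :=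
    Finset.prod_eq_one fun i _ => plateau_eq_one (by linarith) (hx i)
  have h2 : z ∈ nearBox x := Fintype.mem_piFinset.2 fun i => by
    have := abs_le.1 (hx i)
    rw [Finset.mem_Icc, Int.ceil_le, Int.le_floor]
    constructor <;> linarith
  have h3 := Finset.single_le_sum (f := fun z => if z ∈ V then cubeBump ρ z x else 0)
    (fun z _ => by split_ifs; exacts [cubeBump_nonneg _ _ _, le_rfl]) h2
  simpa [hz, h1] using h3

lemma exists_near_of_cutoff_ne_zero (hρ₀ : 0 < ρ) {x : EuclideanSpace ℝ (Fin m)}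
    (h : cutoff ρ V x ≠ 0) : ∃ z ∈ V, ∀ i, |x i - 2 * (z i : ℝ)| < 1 + ρ / 3 := by
  refine exists_mem_of_cubeCount_pos hρ₀ ?_
  by_contra hle
  exact h (Real.smoothTransition.zero_of_nonpos (by linarith))

lemma exists_near_of_thick_ne (hρ₀ : 0 < ρ) {x : EuclideanSpace ℝ (Fin m)}
    (h : thick ρ A V ℓ x ≠ x) : ∃ z ∈ V, ∀ i, |x i - 2 * (z i : ℝ)| < 1 + ρ / 3 := by
  refine exists_near_of_cutoff_ne_zero hρ₀ fun h0 => h ?_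
  ext i
  rw [thick_apply, h0]
  simp [displacement]

/-- The points which have at least `ℓ + 1` even integer coordinates: the dual skeleton of the full
lattice of cubes. A number `t` is an even integer if and only if `sin (π t / 2) = 0`. -/
def evenSet (m ℓ : ℕ) : Set (EuclideanSpace ℝ (Fin m)) :=
  {x | ∃ J : Finset (Fin m), J.card = ℓ + 1 ∧ ∀ j ∈ J, Real.sin (Real.pi / 2 * x j) = 0}

lemma isClosed_evenSet : IsClosed (evenSet m ℓ) := by
  have : evenSet m ℓ = ⋃ J ∈ {J : Finset (Fin m) | J.card = ℓ + 1},
      ⋂ j ∈ J, {x : EuclideanSpace ℝ (Fin m) | Real.sin (Real.pi / 2 * x j) = 0} := by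
    ext x; simp [evenSet]
  rw [this]
  refine (Set.toFinite _).isClosed_biUnion fun J _ => isClosed_biInter fun j _ => ?_
  exact isClosed_eq (by fun_prop) continuous_const

lemma sin_eq_zero_iff (t : ℝ) : Real.sin (Real.pi / 2 * t) = 0 ↔ ctr t = 0 := by
  constructor
  · intro h
    have h1 := ctr_sq_le_sin_sq t
    rw [h] at h1
    exact pow_eq_zero_iff (n := 2) (by norm_num) |>.1 (le_antisymm (by simpa using h1) (sq_nonneg _))
  · intro h
    have h1 := sin_sq_le_ctr_sq t
    rw [h] at h1
    exact pow_eq_zero_iff (n := 2) (by norm_num) |>.1 (le_antisymm (by simpa using h1) (sq_nonneg _))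

/-- A singular point is on the even set and near one of the cubes. -/
lemma near_of_notMem_regularSet (hρ₀ : 0 < ρ) {x : EuclideanSpace ℝ (Fin m)}
    (hx : x ∉ regularSet ρ V ℓ) :
    x ∈ evenSet m ℓ ∧ ∃ z ∈ V, ∀ i, |x i - 2 * (z i : ℝ)| < 1 + ρ / 3 := by
  simp only [regularSet, mem_ofPred_eq, not_forall, not_lt] at hx
  obtain ⟨J, hJ, hle⟩ := hx
  have h0 : sqDist ρ V J x = 0 := le_antisymm hle (sqDist_nonneg _ _ _ _)
  unfold sqDist at h0
  have hs : 0 ≤ ∑ j ∈ J, Real.sin (Real.pi / 2 * x j) ^ 2 := Finset.sum_nonneg fun _ _ => sq_nonneg _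
  have h1 : ∑ j ∈ J, Real.sin (Real.pi / 2 * x j) ^ 2 = 0 := by nlinarith [sq_nonneg (offset ρ V x)]
  have h2 : offset ρ V x = 0 := by
    have : offset ρ V x ^ 2 = 0 := by linarith
    exact pow_eq_zero_iff (n := 2) (by norm_num) |>.1 this
  refine ⟨⟨J, hJ, fun j hj => ?_⟩, exists_mem_of_cubeCount_pos hρ₀ ?_⟩
  · have := (Finset.sum_eq_zero_iff_of_nonneg fun j _ => sq_nonneg _).1 h1 j hj
    exact pow_eq_zero_iff (n := 2) (by norm_num) |>.1 this
  · have := Real.smoothTransition.zero_iff_nonpos.1 h2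
    linarith

lemma isOpen_regularSet (hρ₀ : 0 < ρ) (hρ₁ : ρ < 1) : IsOpen (regularSet ρ V ℓ) := by
  have h : ∀ J : Finset (Fin m), Continuous (sqDist ρ V J) := fun J => by
    have h1 : Continuous (offset ρ V) := continuous_iff_continuousAt.2 fun x =>
      ((isSymbol_offset hρ₀ hρ₁).contDiffAt V x (mem_univ _)).continuousAt
    unfold sqDist; fun_prop
  have : regularSet ρ V ℓ = ⋂ J ∈ {J : Finset (Fin m) | J.card = ℓ + 1}, {x | 0 < sqDist ρ V J x} := by
    ext x; simp [regularSet]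
  rw [this]
  exact (Set.toFinite _).isOpen_biInter fun J _ => isOpen_lt continuous_const (h J)

/-! ### Injectivity -/

lemma dilation_mono {A : ℝ} (hA : 0 ≤ A) {w w' : ℝ} (hw : 0 ≤ w) (h : w ≤ w') :
    dilation A w ≤ dilation A w' := by
  have hd : ∀ t, HasDerivAt (dilation A) (A * (2 - psi t) + A * t * (0 - psi' t)) t := fun t => by
    have h1 : HasDerivAt (fun t : ℝ => A * t) A t := by simpa using (hasDerivAt_id t).const_mul A
    exact h1.mul ((hasDerivAt_const t (2 : ℝ)).sub (psi_hasDerivAt t))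
  refine monotoneOn_of_deriv_nonneg (convex_Ici (0 : ℝ))
    (fun t _ => (hd t).continuousAt.continuousWithinAt)
    (fun t _ => (hd t).differentiableAt.differentiableWithinAt) (fun t ht => ?_) hw (hw.trans h) h
  rw [(hd t).deriv]
  have h1 := psi_lt_one t
  have h2 := abs_mul_psi'_le_one t
  rw [interior_Ici] at ht
  rw [abs_of_pos ht] at h2
  have : A * (2 - psi t) + A * t * (0 - psi' t) = A * ((2 - psi t) - t * psi' t) := by ring
  rw [this]
  exact mul_nonneg hA (by linarith)

/-- Two regular points with the same image have coordinates in the same cells; those close to the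
boundary of the cells are equal. -/
lemma coord_of_thick_eq (hρ₀ : 0 < ρ) (hρ₁ : ρ < 1) {x y : EuclideanSpace ℝ (Fin m)}
    (h : thick ρ A V ℓ x = thick ρ A V ℓ y) (i : Fin m) :
    x i = y i ∨ (round (x i / 2) = round (y i / 2) ∧ |ctr (x i)| < 1 - ρ / 3 ∧
      |ctr (y i)| < 1 - ρ / 3) := by
  have hi : thick ρ A V ℓ x i = thick ρ A V ℓ y i := by rw [h]
  rw [thick_apply, thick_apply] at hi
  have hx := two_mul_round_add_ctr (x i)
  have hy := two_mul_round_add_ctr (y i)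
  have hx1 := fun l => abs_add_displacement_lt (l := l) (ξ := ctr (x i)) hρ₀ hρ₁
    (cutoff_nonneg ρ V x) (cutoff_le_one ρ V x)
  have hy1 := fun l => abs_add_displacement_lt (l := l) (ξ := ctr (y i)) hρ₀ hρ₁
    (cutoff_nonneg ρ V y) (cutoff_le_one ρ V y)
  have hx2 := fun k l => displacement_eq_zero hρ₀ hρ₁ k l (ξ := ctr (x i))
  have hy2 := fun k l => displacement_eq_zero hρ₀ hρ₁ k l (ξ := ctr (y i))
  rcases lt_or_ge |ctr (x i)| (1 - ρ / 3) with h1 | h1 <;>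
    rcases lt_or_ge |ctr (y i)| (1 - ρ / 3) with h2 | h2
  · refine Or.inr ⟨int_eq_of_two_mul_add_eq ((hx1 (dilation A (weight ρ V ℓ x)) h1).trans
      (by linarith)) ((hy1 (dilation A (weight ρ V ℓ y)) h2).le.trans (by linarith)) (by linarith),
      h1, h2⟩
  · rw [hy2 _ _ h2] at hi
    have h3 := hx1 (dilation A (weight ρ V ℓ x)) h1
    have h4 := int_eq_of_two_mul_add_eq (c := round (x i / 2)) (c' := round (y i / 2))
      (h3.trans (by linarith)) (abs_ctr_le_one (y i)) (by linarith)
    rw [show ctr (x i) + displacement ρ (cutoff ρ V x) (dilation A (weight ρ V ℓ x)) (ctr (x i)) =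
      ctr (y i) by rw [h4] at hx; linarith] at h3
    linarith
  · rw [hx2 _ _ h1] at hi
    have h3 := hy1 (dilation A (weight ρ V ℓ y)) h2
    have h4 := int_eq_of_two_mul_add_eq (c := round (y i / 2)) (c' := round (x i / 2))
      (h3.trans (by linarith)) (abs_ctr_le_one (x i)) (by linarith)
    rw [show ctr (y i) + displacement ρ (cutoff ρ V y) (dilation A (weight ρ V ℓ y)) (ctr (y i)) =
      ctr (x i) by rw [h4] at hy; linarith] at h3
    linarith
  · rw [hx2 _ _ h1, hy2 _ _ h2] at hi
    left; linarith

/-- Multiplying the centred coordinates by at most `μ` divides the weight by at most `μ`. -/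
lemma weight_le_mul_weight {x y : EuclideanSpace ℝ (Fin m)} {μ : ℝ} (hμ : 1 ≤ μ)
    (hy : y ∈ regularSet ρ V ℓ) (hxy : cubeCount ρ V x = cubeCount ρ V y)
    (h : ∀ i, |ctr (y i)| ≤ μ * |ctr (x i)|) : weight ρ V ℓ x ≤ μ * weight ρ V ℓ y := by
  have hμ0 : 0 < μ := by linarith
  have hq : ∀ J, sqDist ρ V J y ≤ μ ^ 2 * sqDist ρ V J x := fun J => by
    unfold sqDist offset
    rw [hxy, mul_add, Finset.mul_sum]
    refine add_le_add (Finset.sum_le_sum fun j _ => ?_) ?_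
    · rw [sin_sq_eq (y j), sin_sq_eq (x j), ← mul_pow]
      exact pow_le_pow_left₀ ((abs_nonneg _).trans (abs_ctr_le_sin _))
        (sin_le_mul_sin (abs_ctr_le_one _) (abs_nonneg _) (abs_ctr_le_one _) hμ (h j)) 2
    · exact le_mul_of_one_le_left (sq_nonneg _) (one_le_pow₀ hμ)
  have hL : invSqDist ρ V ℓ x ≤ μ ^ 2 * invSqDist ρ V ℓ y := by
    unfold invSqDist
    rw [Finset.mul_sum]
    refine Finset.sum_le_sum fun J _ => ?_
    split_ifs with hJ
    · have h1 := hy J hJ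
      have h2 : 0 < sqDist ρ V J x := by
        by_contra h3
        nlinarith [hq J, sq_nonneg μ, not_lt.1 h3]
      rw [← div_eq_mul_inv, le_div_iff₀ h1, inv_mul_le_iff₀ h2, mul_comm]
      exact hq J
    · simp
  calc weight ρ V ℓ x ≤ √(μ ^ 2 * invSqDist ρ V ℓ y) := Real.sqrt_le_sqrt hL
    _ = μ * weight ρ V ℓ y := by
      rw [Real.sqrt_mul (sq_nonneg μ), Real.sqrt_sq hμ0.le, weight]

/-- The thickening map is injective. Two points with the same image have the same cutoff. If the
dilation rate at `x` were larger than at `y`, by a factor `μ`, then the coordinates of `y` would be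
at most `μ` times those of `x`, so the weight at `x` would be at most `μ` times the weight at `y`;
but `dilation A w / w` is decreasing in `w`, so `μ` is smaller than the ratio of the weights. Hence
the rates agree, and the map is strictly monotone in each coordinate. -/
lemma injOn_thick (hρ₀ : 0 < ρ) (hρ₁ : ρ < 1) (hA : 1 ≤ A) (hℓ : ℓ < m) :
    InjOn (thick ρ A V ℓ) (regularSet ρ V ℓ) := by
  have hA0 : 0 ≤ A := by linarith
  have hlpos : ∀ x ∈ regularSet ρ V ℓ, 0 < dilation A (weight ρ V ℓ x) := fun x hx =>
    (mul_pos (by linarith) (weight_pos hℓ hx)).trans_le (mul_le_dilation hA0 (weight_nonneg _ _ _ _))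
  -- comparison of the centred coordinates when the dilation rates are ordered
  have hcoord : ∀ x ∈ regularSet ρ V ℓ, ∀ y ∈ regularSet ρ V ℓ,
      thick ρ A V ℓ x = thick ρ A V ℓ y →
      dilation A (weight ρ V ℓ y) ≤ dilation A (weight ρ V ℓ x) → ∀ i,
      dilation A (weight ρ V ℓ y) * |ctr (y i)| ≤ dilation A (weight ρ V ℓ x) * |ctr (x i)| := by
    intro x hx y hy hxy hle i
    have hc := coord_of_thick_eq hρ₀ hρ₁ hxy
    have hk : cutoff ρ V x = cutoff ρ V y := by unfold cutoff; rw [cubeCount_congr hρ₀ hc]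
    rcases hc i with h | ⟨h1, h2, h3⟩
    · rw [h]; exact mul_le_mul_of_nonneg_right hle (abs_nonneg _)
    · refine abs_mul_le_of_add_displacement_eq hρ₀ hρ₁ (cutoff_nonneg ρ V x) (cutoff_le_one ρ V x)
        (hlpos y hy) hle ?_
      have hi : thick ρ A V ℓ x i = thick ρ A V ℓ y i := by rw [hxy]
      rw [thick_apply, thick_apply, ← hk] at hi
      have e1 := two_mul_round_add_ctr (x i)
      have e2 := two_mul_round_add_ctr (y i)
      rw [h1] at e1
      linarith
  -- the dilation rates are equal
  have hle : ∀ x ∈ regularSet ρ V ℓ, ∀ y ∈ regularSet ρ V ℓ,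
      thick ρ A V ℓ x = thick ρ A V ℓ y →
      dilation A (weight ρ V ℓ x) ≤ dilation A (weight ρ V ℓ y) := by
    intro x hx y hy hxy
    by_contra hlt
    push Not at hlt
    have hly := hlpos y hy
    have hlx := hlpos x hx
    have h1 := weight_le_mul_weight (μ := dilation A (weight ρ V ℓ x) / dilation A (weight ρ V ℓ y))
      ((one_le_div hly).2 hlt.le) hy (cubeCount_congr hρ₀ (coord_of_thick_eq hρ₀ hρ₁ hxy)) fun i => by
        rw [div_mul_eq_mul_div, le_div_iff₀ hly, mul_comm]
        exact hcoord x hx y hy hxy hlt.le i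
    have hwx := weight_pos hℓ hx
    have hwy := weight_pos hℓ hy
    rw [div_mul_eq_mul_div, le_div_iff₀ hly] at h1
    have h2 : weight ρ V ℓ x ≤ weight ρ V ℓ y := by
      rw [← psi_strictMono.le_iff_le]
      have hp : 0 < A * (weight ρ V ℓ x * weight ρ V ℓ y) := by positivity
      unfold dilation at h1
      by_contra hcon
      push Not at hcon
      nlinarith
    exact absurd (dilation_mono hA0 hwx.le h2) (not_le.2 hlt)
  intro x hx y hy hxy
  have hleq := le_antisymm (hle x hx y hy hxy) (hle y hy x hx hxy.symm)
  ext i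
  have hc := coord_of_thick_eq hρ₀ hρ₁ hxy
  rcases hc i with h | ⟨h1, h2, h3⟩
  · exact h
  have hk : cutoff ρ V x = cutoff ρ V y := by unfold cutoff; rw [cubeCount_congr hρ₀ hc]
  have hl := hlpos x hx
  have ha : |ctr (x i)| = |ctr (y i)| := by
    have e1 := hcoord x hx y hy hxy hleq.ge i
    have e2 := hcoord y hy x hx hxy.symm hleq.le i
    rw [← hleq] at e1 e2
    exact le_antisymm (le_of_mul_le_mul_left e2 hl) (le_of_mul_le_mul_left e1 hl)
  have e1 := two_mul_round_add_ctr (x i)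
  have e2 := two_mul_round_add_ctr (y i)
  rw [h1] at e1
  have hi : thick ρ A V ℓ x i = thick ρ A V ℓ y i := by rw [hxy]
  rw [thick_apply, thick_apply, ← hk, ← hleq] at hi
  rcases abs_eq_abs.1 ha with h | h
  · linarith
  · have h5 : ctr (y i) + displacement ρ (cutoff ρ V x) (dilation A (weight ρ V ℓ x)) (ctr (y i)) = 0 := by
      rw [h, displacement_neg] at hi; linarith
    have hpos := fun ξ => add_displacement_pos (ρ := ρ) (ξ := ξ) hρ₁ (cutoff_nonneg ρ V x)
      (cutoff_le_one ρ V x) hl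
    rcases lt_trichotomy (ctr (y i)) 0 with h0 | h0 | h0
    · have := hpos (-ctr (y i)) (by linarith)
      rw [displacement_neg] at this
      linarith
    · linarith
    · have := hpos _ h0
      linarith

end Geometry

section Images

variable {m : ℕ} {ρ A : ℝ} {V : Set (Fin m → ℤ)} {ℓ : ℕ}

/-! ### Images of cubes and of the even set -/

lemma thick_apply_eq_or (hρ₀ : 0 < ρ) (hρ₁ : ρ < 1) (x : EuclideanSpace ℝ (Fin m)) (i : Fin m) {z : ℤ}
    (h : |x i - 2 * (z : ℝ)| ≤ 1) :
    (thick ρ A V ℓ x i = x i ∧ 1 - ρ / 3 ≤ |x i - 2 * (z : ℝ)|) ∨ x i - 2 * (z : ℝ) = ctr (x i) ∧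
      thick ρ A V ℓ x i - 2 * (z : ℝ) =
        ctr (x i) + displacement ρ (cutoff ρ V x) (dilation A (weight ρ V ℓ x)) (ctr (x i)) := by
  rcases round_eq_or_near (d := ρ / 3) (by linarith) (h.trans_lt (by linarith)) with h1 | ⟨h1, h2⟩
  · right
    have := two_mul_round_add_ctr (x i)
    rw [h1] at this
    rw [thick_apply]
    constructor <;> linarith
  · left
    rw [thick_apply, displacement_eq_zero hρ₀ hρ₁ _ _ h1, add_zero]
    exact ⟨rfl, h2⟩

/-- The thickening map preserves every cube of the grid. -/
lemma abs_thick_sub_le_one (hρ₀ : 0 < ρ) (hρ₁ : ρ < 1) {x : EuclideanSpace ℝ (Fin m)} {i : Fin m}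
    {z : ℤ} (h : |x i - 2 * (z : ℝ)| ≤ 1) : |thick ρ A V ℓ x i - 2 * (z : ℝ)| ≤ 1 := by
  rcases thick_apply_eq_or (A := A) (V := V) (ℓ := ℓ) hρ₀ hρ₁ x i h with ⟨h1, _⟩ | ⟨_, h1⟩
  · rwa [h1]
  · rw [h1]
    exact abs_add_displacement_le_one hρ₀ hρ₁ (cutoff_nonneg _ _ _) (cutoff_le_one _ _ _)
      (abs_ctr_le_one _)

/-- A coordinate which is not an even integer is not moved to an even integer. -/
lemma mem_evenSet_of_thick_mem (hρ₀ : 0 < ρ) (hρ₁ : ρ < 1) (hA : 1 ≤ A) (hℓ : ℓ < m)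
    {x : EuclideanSpace ℝ (Fin m)} (hx : x ∈ regularSet ρ V ℓ)
    (h : thick ρ A V ℓ x ∈ evenSet m ℓ) : x ∈ evenSet m ℓ := by
  obtain ⟨J, hJ, h0⟩ := h
  refine ⟨J, hJ, fun j hj => ?_⟩
  have h1 := (sin_eq_zero_iff _).1 (h0 j hj)
  rw [sin_eq_zero_iff]
  rcases lt_or_ge |ctr (x j)| (1 - ρ / 3) with h2 | h2
  · have h3 := abs_add_displacement_lt (l := dilation A (weight ρ V ℓ x)) hρ₀ hρ₁
      (cutoff_nonneg ρ V x) (cutoff_le_one ρ V x) h2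
    have e1 := two_mul_round_add_ctr (thick ρ A V ℓ x j)
    have e2 := two_mul_round_add_ctr (x j)
    have e3 := thick_apply (ρ := ρ) (A := A) (V := V) (ℓ := ℓ) x j
    have e4 := int_eq_of_two_mul_add_eq (c := round (x j / 2))
      (c' := round (thick ρ A V ℓ x j / 2)) (h3.trans (by linarith))
      (abs_ctr_le_one (thick ρ A V ℓ x j)) (by linarith)
    have h5 : ctr (x j) + displacement ρ (cutoff ρ V x) (dilation A (weight ρ V ℓ x)) (ctr (x j)) = 0 := by
      rw [e4] at e2; linarith
    have hl : 0 < dilation A (weight ρ V ℓ x) :=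
      (mul_pos (by linarith) (weight_pos hℓ hx)).trans_le
        (mul_le_dilation (by linarith) (weight_nonneg _ _ _ _))
    have hpos := fun ξ => add_displacement_pos (ρ := ρ) (ξ := ξ) hρ₁ (cutoff_nonneg ρ V x)
      (cutoff_le_one ρ V x) hl
    rcases lt_trichotomy (ctr (x j)) 0 with h0 | h0 | h0
    · have := hpos (-ctr (x j)) (by linarith)
      rw [displacement_neg] at this
      linarith
    · exact h0
    · have := hpos _ h0
      linarith
  · rwa [thick_apply, displacement_eq_zero hρ₀ hρ₁ _ _ h2, add_zero] at h1

/-- The factor `A` for which the thickening map pushes the cubes into a neighbourhood of their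
`ℓ`-dimensional skeleton. -/
lemma exists_factor (m : ℕ) (hρ₀ : 0 < ρ) :
    ∃ A : ℝ, 1 ≤ A ∧ 1 - ρ < (1 - 2 * ρ / 3) * psi (A * (1 / (2 * ((m : ℝ) + 1)))) := by
  have hc : 0 < 1 / (2 * ((m : ℝ) + 1)) := by positivity
  have h1 := (psi_tendsto.comp (Filter.tendsto_id.atTop_mul_const hc)).const_mul (1 - 2 * ρ / 3)
  have h2 := h1.eventually (lt_mem_nhds (show 1 - ρ < (1 - 2 * ρ / 3) * 1 by linarith))
  obtain ⟨A, hA1, hA2⟩ := (h2.and (Filter.eventually_ge_atTop 1)).exists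
  exact ⟨A, hA2, hA1⟩

/-- In the cubes of the family, all but `ℓ` coordinates are pushed close to the boundary: at most
`ℓ` coordinates can be small compared with the inverse of the weight. -/
lemma exists_pushed_coords (hρ₀ : 0 < ρ) (hρ₁ : ρ < 1) (hA : 1 ≤ A)
    (hA' : 1 - ρ < (1 - 2 * ρ / 3) * psi (A * (1 / (2 * ((m : ℝ) + 1)))))
    {x : EuclideanSpace ℝ (Fin m)} (hx : x ∈ regularSet ρ V ℓ) {z : Fin m → ℤ} (hz : z ∈ V)
    (hxz : ∀ i, |x i - 2 * (z i : ℝ)| ≤ 1) :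
    ∃ I : Finset (Fin m), I.card = m - ℓ ∧ ∀ i ∈ I, 1 - ρ < |thick ρ A V ℓ x i - 2 * (z i : ℝ)| := by
  classical
  have hN := one_le_cubeCount hρ₀ hρ₁ hz hxz
  have hk : cutoff ρ V x = 1 := Real.smoothTransition.one_of_one_le (by linarith)
  have hg : offset ρ V x = 0 := Real.smoothTransition.zero_of_nonpos (by linarith)
  set P : Fin m → Prop := fun i => 1 - ρ < |thick ρ A V ℓ x i - 2 * (z i : ℝ)| with hP
  suffices h : (Finset.univ.filter fun i => ¬ P i).card ≤ ℓ by
    have h1 := Finset.card_filter_add_card_filter_not (s := (Finset.univ : Finset (Fin m))) P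
    rw [Finset.card_univ, Fintype.card_fin] at h1
    obtain ⟨I, hI, hIc⟩ := Finset.exists_subset_card_eq (s := Finset.univ.filter P) (n := m - ℓ)
      (by omega)
    exact ⟨I, hIc, fun i hi => (Finset.mem_filter.1 (hI hi)).2⟩
  by_contra hcard
  obtain ⟨J, hJ, hJc⟩ := Finset.exists_subset_card_eq (s := Finset.univ.filter fun i => ¬ P i)
    (n := ℓ + 1) (by omega)
  set w := weight ρ V ℓ x with hw
  have hw0 : 0 ≤ w := weight_nonneg _ _ _ _
  have hA0 : 0 ≤ A := by linarith
  -- the coordinates which are not pushed far enough are small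
  have hsmall : ∀ i ∈ J, w * |ctr (x i)| ≤ 1 / (2 * ((m : ℝ) + 1)) := by
    intro i hi
    have hnP : |thick ρ A V ℓ x i - 2 * (z i : ℝ)| ≤ 1 - ρ := not_lt.1 (Finset.mem_filter.1 (hJ hi)).2
    rcases thick_apply_eq_or (A := A) (V := V) (ℓ := ℓ) hρ₀ hρ₁ x i (hxz i) with ⟨h1, h2⟩ | ⟨_, h1⟩
    · rw [h1] at hnP; linarith
    rw [h1, hk] at hnP
    have hl0 : 0 ≤ dilation A w := dilation_nonneg hA0 hw0
    have habs : |ctr (x i) + displacement ρ 1 (dilation A w) (ctr (x i))| =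
        |ctr (x i)| + displacement ρ 1 (dilation A w) |ctr (x i)| := by
      have h3 : ∀ ξ : ℝ, 0 ≤ ξ → 0 ≤ ξ + displacement ρ 1 (dilation A w) ξ := fun ξ hξ => by
        rw [add_displacement_eq]
        obtain ⟨h0, h1⟩ := convex_weight_mem (ρ := ρ) zero_le_one le_rfl ξ
        have := psi_nonneg (mul_nonneg hl0 hξ)
        have ha : 0 < 1 - 2 * ρ / 3 := by linarith
        have := mul_nonneg (sub_nonneg.2 h1) hξ
        positivity
      rcases abs_cases (ctr (x i)) with ⟨h4, h5⟩ | ⟨h4, h5⟩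
      · rw [h4, abs_of_nonneg (h3 _ h5)]
      · have h6 := h3 (-ctr (x i)) (by linarith)
        rw [h4]
        rw [displacement_neg] at h6 ⊢
        rw [abs_of_nonpos (by linarith)]; ring
    rw [← hw, habs, add_displacement_eq, one_mul] at hnP
    set u := |ctr (x i)|
    have hu : 0 ≤ u := abs_nonneg _
    have hpsi : (1 - 2 * ρ / 3) * psi (dilation A w * u) ≤ 1 - ρ := by
      by_contra hcon
      push Not at hcon
      rcases le_or_gt u (1 - 2 * ρ / 3) with h3 | h3
      · rw [plateau_eq_one (by linarith) (by rwa [abs_of_nonneg hu])] at hnP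
        linarith
      · have h4 := plateau_nonneg (1 - 2 * ρ / 3) (1 - ρ / 3) u
        have h5 := plateau_le_one (1 - 2 * ρ / 3) (1 - ρ / 3) u
        rcases h4.eq_or_lt with h6 | h6
        · rw [← h6] at hnP; linarith
        · have := mul_pos h6 (sub_pos.2 hcon)
          have := mul_nonneg (sub_nonneg.2 h5) (show 0 ≤ u - (1 - ρ) by linarith)
          linarith
    have h6 : psi (dilation A w * u) < psi (A * (1 / (2 * ((m : ℝ) + 1)))) :=
      lt_of_mul_lt_mul_left (hpsi.trans_lt hA') (by linarith)
    have h7 := psi_strictMono.lt_iff_lt.1 h6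
    have h8 : A * (w * u) < A * (1 / (2 * ((m : ℝ) + 1))) := by
      have := mul_le_mul_of_nonneg_right (mul_le_dilation hA0 hw0) hu
      linarith
    exact (lt_of_mul_lt_mul_left h8 hA0).le
  -- if this were the case for `ℓ + 1` coordinates, the weight would be larger than it is
  have h1 : 1 ≤ w ^ 2 * sqDist ρ V J x := by
    have h2 := inv_sqDist_le_invSqDist (ρ := ρ) (V := V) hJc x
    rw [← weight_sq] at h2
    rwa [inv_le_iff_one_le_mul₀ (hx J hJc)] at h2
  have h2 : w ^ 2 * sqDist ρ V J x ≤ ∑ j ∈ J, (Real.pi / 2) ^ 2 * (1 / (2 * ((m : ℝ) + 1))) ^ 2 := by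
    unfold sqDist
    rw [hg, mul_add, Finset.mul_sum]
    simp only [ne_eq, OfNat.ofNat_ne_zero, not_false_eq_true, zero_pow, mul_zero, add_zero]
    refine Finset.sum_le_sum fun j hj => ?_
    calc w ^ 2 * Real.sin (Real.pi / 2 * x j) ^ 2 ≤ w ^ 2 * ((Real.pi / 2) ^ 2 * ctr (x j) ^ 2) :=
          mul_le_mul_of_nonneg_left (sin_sq_le_ctr_sq _) (sq_nonneg _)
      _ = (Real.pi / 2) ^ 2 * (w * |ctr (x j)|) ^ 2 := by rw [mul_pow, sq_abs]; ring
      _ ≤ _ := by gcongr; exact hsmall j hj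
  rw [Finset.sum_const, nsmul_eq_mul] at h2
  have h3 : (J.card : ℝ) ≤ m := by exact_mod_cast (Finset.card_le_univ J).trans_eq (Fintype.card_fin m)
  have h4 : (Real.pi / 2) ^ 2 ≤ 4 := by nlinarith [Real.pi_pos, Real.pi_le_four]
  have h5 : (J.card : ℝ) * ((Real.pi / 2) ^ 2 * (1 / (2 * ((m : ℝ) + 1))) ^ 2) ≤
      m * (4 * (1 / (2 * ((m : ℝ) + 1))) ^ 2) := by gcongr
  have h6 : (m : ℝ) * (4 * (1 / (2 * ((m : ℝ) + 1))) ^ 2) < 1 := by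
    have hm : (0 : ℝ) ≤ m := Nat.cast_nonneg m
    rw [div_pow, one_pow, mul_div_assoc', mul_div_assoc', div_lt_one (by positivity)]
    nlinarith
  linarith

lemma weight_le_div_of_sqDist {x : EuclideanSpace ℝ (Fin m)} {d : ℝ} (hd : 0 < d)
    (h : ∀ J : Finset (Fin m), J.card = ℓ + 1 → d ^ 2 ≤ sqDist ρ V J x) :
    weight ρ V ℓ x ≤ √(2 ^ m) / d := by
  have h1 : invSqDist ρ V ℓ x ≤ 2 ^ m * (d ^ 2)⁻¹ := by
    have h2 : invSqDist ρ V ℓ x ≤ ∑ _J : Finset (Fin m), (d ^ 2)⁻¹ := by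
      refine Finset.sum_le_sum fun J _ => ?_
      split_ifs with hJ
      · exact inv_anti₀ (by positivity) (h J hJ)
      · positivity
    simpa using h2
  calc weight ρ V ℓ x ≤ √(2 ^ m * (d ^ 2)⁻¹) := Real.sqrt_le_sqrt h1
    _ = √(2 ^ m) / d := by
      rw [Real.sqrt_mul (by positivity), Real.sqrt_inv, Real.sqrt_sq hd.le, div_eq_mul_inv]

/-- The weight is at most a multiple of the inverse of any lower bound for the distance to the
coordinate subspaces. -/
lemma weight_le_div {x : EuclideanSpace ℝ (Fin m)} {d : ℝ} (hd : 0 < d)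
    (h : ∀ J : Finset (Fin m), J.card = ℓ + 1 → d ^ 2 ≤ ∑ j ∈ J, ctr (x j) ^ 2) :
    weight ρ V ℓ x ≤ √(2 ^ m) / d :=
  weight_le_div_of_sqDist hd fun J hJ => (h J hJ).trans <|
    le_add_of_le_of_nonneg (Finset.sum_le_sum fun _ _ => ctr_sq_le_sin_sq _) (sq_nonneg _)

end Images

/-! ### A determinant -/

section Determinant

/-- The determinant of a diagonal matrix perturbed by two matrices of rank one, the second of which
interacts neither with the first nor with itself. -/
lemma det_diagonal_add_rank_two {n : Type*} [Fintype n] [DecidableEq n] {D u s p r : n → ℝ}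
    (hD : ∀ i, D i ≠ 0) (hu : ∀ j, r j * u j = 0) (hp : ∀ j, r j * p j = 0) :
    (Matrix.of fun i j => (if i = j then D i else 0) + u i * s j + p i * r j).det =
      (∏ i, D i) * (1 + ∑ j, s j * u j / D j) := by
  set P : Matrix n (Fin 2) ℝ := Matrix.of fun i => ![u i / D i, p i / D i] with hP
  set R : Matrix (Fin 2) n ℝ := Matrix.of ![s, r] with hR
  have h : (Matrix.of fun i j => (if i = j then D i else 0) + u i * s j + p i * r j) =
      Matrix.diagonal D * (1 + P * R) := by
    ext i j
    rw [Matrix.diagonal_mul, Matrix.add_apply, Matrix.mul_apply, Fin.sum_univ_two]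
    have := hD i
    by_cases hij : i = j
    · subst hij; simp [hP, hR]; field_simp; ring
    · simp [hP, hR, hij]; field_simp
  rw [h, Matrix.det_mul, Matrix.det_diagonal, Matrix.det_one_add_mul_comm]
  have h1 : ∀ q : n → ℝ, (∀ j, r j * q j = 0) → ∑ j, r j * (q j / D j) = 0 := fun q hq =>
    Finset.sum_eq_zero fun j _ => by rw [← mul_div_assoc, hq, zero_div]
  congr 1
  rw [Matrix.det_fin_two]
  simp [Matrix.vecMul, dotProduct, hP, hR, h1 u hu, h1 p hp, mul_div_assoc]

end Determinant

section Jacobian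

variable {m : ℕ} {ρ A : ℝ} {V : Set (Fin m → ℤ)} {ℓ : ℕ} {k l ξ : ℝ}

/-! ### The partial derivatives of the displacement -/

/-- The partial derivative of `ξ + displacement ρ k l ξ` in `ξ`. -/
noncomputable def diagDeriv (ρ k l ξ : ℝ) : ℝ :=
  1 + k * (deriv (plateau (1 - 2 * ρ / 3) (1 - ρ / 3)) ξ * ((1 - 2 * ρ / 3) * psi (l * ξ) - ξ) +
    plateau (1 - 2 * ρ / 3) (1 - ρ / 3) ξ * ((1 - 2 * ρ / 3) * (psi' (l * ξ) * l) - 1))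

/-- The quotient by `ξ` of the partial derivative of `displacement ρ k l ξ` in `l`. -/
noncomputable def dilationDeriv (ρ k l ξ : ℝ) : ℝ :=
  k * plateau (1 - 2 * ρ / 3) (1 - ρ / 3) ξ * (1 - 2 * ρ / 3) * psi' (l * ξ)

/-- The partial derivative of `displacement ρ k l ξ` in `k`. -/
noncomputable def cutoffDeriv (ρ l ξ : ℝ) : ℝ :=
  plateau (1 - 2 * ρ / 3) (1 - ρ / 3) ξ * ((1 - 2 * ρ / 3) * psi (l * ξ) - ξ)

lemma hasFDerivAt_displacement {E : Type*} [NormedAddCommGroup E] [NormedSpace ℝ E]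
    {f g h : E → ℝ} {f' g' h' : E →L[ℝ] ℝ} {x : E} (hf : HasFDerivAt f f' x)
    (hg : HasFDerivAt g g' x) (hh : HasFDerivAt h h' x) (ρ : ℝ) :
    HasFDerivAt (fun y => h y + displacement ρ (f y) (g y) (h y))
      (diagDeriv ρ (f x) (g x) (h x) • h' + (dilationDeriv ρ (f x) (g x) (h x) * h x) • g' +
        cutoffDeriv ρ (g x) (h x) • f') x := by
  have h1 : HasFDerivAt (fun y => plateau (1 - 2 * ρ / 3) (1 - ρ / 3) (h y)) _ x :=
    ((((plateau_contDiff (1 - 2 * ρ / 3) (1 - ρ / 3)).differentiable (by simp)) _).hasDerivAt).comp_hasFDerivAt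
      x hh
  have h2 : HasFDerivAt (fun y => psi (g y * h y)) _ x :=
    (psi_hasDerivAt _).comp_hasFDerivAt x (hg.mul hh)
  convert! hh.add ((hf.mul h1).mul ((h2.const_mul (1 - 2 * ρ / 3)).sub hh)) using 1
  ext v
  simp [diagDeriv, dilationDeriv, cutoffDeriv]
  ring

lemma deriv_plateau_nonpos {c d y : ℝ} (hcd : c < d) (hy : -c < y) : deriv (plateau c d) y ≤ 0 := by
  have h : plateau c d =ᶠ[nhds y] fun y => Real.smoothTransition ((d - y) / (d - c)) := by
    filter_upwards [lt_mem_nhds hy] with z hz using plateau_of_neg_le hcd hz.le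
  have hanti : Antitone fun y => Real.smoothTransition ((d - y) / (d - c)) := fun a b hab =>
    Real.smoothTransition.monotone (div_le_div_of_nonneg_right (by linarith) (by linarith))
  rw [h.deriv_eq]
  exact hanti.deriv_nonpos

lemma deriv_plateau_neg {c d y : ℝ} : deriv (plateau c d) (-y) = -deriv (plateau c d) y := by
  have h : (fun y => plateau c d (-y)) = plateau c d := funext fun y => plateau_neg c d y
  have h2 := deriv_comp_neg (plateau c d) y
  rw [h] at h2
  linarith

lemma deriv_plateau_eq_zero {c d y : ℝ} (hcd : c < d) (hy : |y| < c) :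
    deriv (plateau c d) y = 0 := by
  obtain ⟨h1, h2⟩ := abs_lt.1 hy
  refine le_antisymm (deriv_plateau_nonpos hcd h1) ?_
  have := deriv_plateau_nonpos hcd (y := -y) (by linarith)
  rw [deriv_plateau_neg] at this
  linarith

/-- The derivative of the plateau pushes in the same direction as the displacement. -/
lemma deriv_plateau_mul_nonneg (hρ₀ : 0 < ρ) (hρ₁ : ρ < 1) (l ξ : ℝ) :
    0 ≤ deriv (plateau (1 - 2 * ρ / 3) (1 - ρ / 3)) ξ * ((1 - 2 * ρ / 3) * psi (l * ξ) - ξ) := by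
  have hcd : 1 - 2 * ρ / 3 < 1 - ρ / 3 := by linarith
  have ha : 0 < 1 - 2 * ρ / 3 := by linarith
  have hpsi := abs_lt.1 (abs_psi_lt_one (l * ξ))
  have h1 := mul_lt_mul_of_pos_left hpsi.1 ha
  have h2 := mul_lt_mul_of_pos_left hpsi.2 ha
  rcases lt_or_ge |ξ| (1 - 2 * ρ / 3) with h | h
  · rw [deriv_plateau_eq_zero hcd h, zero_mul]
  rcases le_total 0 ξ with h0 | h0
  · rw [abs_of_nonneg h0] at h
    exact mul_nonneg_of_nonpos_of_nonpos (deriv_plateau_nonpos hcd (by linarith)) (by linarith)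
  · rw [abs_of_nonpos h0] at h
    have h3 := deriv_plateau_nonpos hcd (y := -ξ) (by linarith)
    rw [deriv_plateau_neg] at h3
    exact mul_nonneg (by linarith) (by linarith)

lemma le_diagDeriv (hρ₀ : 0 < ρ) (hρ₁ : ρ < 1) (hk₀ : 0 ≤ k) :
    (1 - k * plateau (1 - 2 * ρ / 3) (1 - ρ / 3) ξ) + l * dilationDeriv ρ k l ξ ≤
      diagDeriv ρ k l ξ := by
  have := mul_nonneg hk₀ (deriv_plateau_mul_nonneg hρ₀ hρ₁ l ξ)
  unfold diagDeriv dilationDeriv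
  linarith

lemma dilationDeriv_nonneg (hρ₁ : ρ < 1) (hk₀ : 0 ≤ k) (l ξ : ℝ) : 0 ≤ dilationDeriv ρ k l ξ := by
  unfold dilationDeriv
  have := psi'_pos (l * ξ)
  have := plateau_nonneg (1 - 2 * ρ / 3) (1 - ρ / 3) ξ
  have : 0 < 1 - 2 * ρ / 3 := by linarith
  positivity

lemma mul_dilationDeriv_le (hρ₀ : 0 < ρ) (hρ₁ : ρ < 1) (hk₀ : 0 ≤ k) (hk₁ : k ≤ 1) :
    l * dilationDeriv ρ k l ξ ≤ diagDeriv ρ k l ξ := by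
  have := le_diagDeriv (l := l) (ξ := ξ) hρ₀ hρ₁ hk₀
  have := (convex_weight_mem (ρ := ρ) hk₀ hk₁ ξ).2
  linarith

/-- The diagonal derivative is at least a multiple of the derivative of `psi (l * ξ)`, provided that
`l` is bounded where the cutoff is not `1`. -/
lemma mul_psi'_le_diagDeriv (hρ₀ : 0 < ρ) (hρ₁ : ρ < 1) (hk₀ : 0 ≤ k) (hk₁ : k ≤ 1) (hl : 0 < l)
    {B : ℝ} (hB : 1 ≤ B) (h : k < 1 → l ≤ B) :
    (1 - 2 * ρ / 3) / B * (l * psi' (l * ξ)) ≤ diagDeriv ρ k l ξ := by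
  have ha : 0 < 1 - 2 * ρ / 3 := by linarith
  have hpsi := psi'_pos (l * ξ)
  obtain ⟨h0, h1⟩ := convex_weight_mem (ρ := ρ) hk₀ hk₁ ξ
  refine le_trans ?_ (le_diagDeriv hρ₀ hρ₁ hk₀)
  set θ := k * plateau (1 - 2 * ρ / 3) (1 - ρ / 3) ξ with hθ
  have hu : dilationDeriv ρ k l ξ = θ * (1 - 2 * ρ / 3) * psi' (l * ξ) := rfl
  rw [hu]
  set L := l * psi' (l * ξ) with hL
  have hL0 : 0 < L := mul_pos hl hpsi
  have hθL : (1 - θ) * ((1 - 2 * ρ / 3) / B * L) ≤ 1 - θ := by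
    rcases h1.eq_or_lt with h2 | h2
    · rw [h2]; simp
    refine mul_le_of_le_one_right (by linarith) ?_
    rw [div_mul_eq_mul_div, div_le_one (by linarith)]
    by_cases hk : k < 1
    · have : L ≤ B := (mul_le_of_le_one_right hl.le (psi'_le_one _)).trans (h hk)
      have := mul_le_mul_of_nonneg_left this ha.le
      nlinarith
    · have hk' : k = 1 := le_antisymm hk₁ (not_lt.1 hk)
      have hξ : 1 - 2 * ρ / 3 ≤ |ξ| := by
        by_contra hcon
        rw [hθ, hk', plateau_eq_one (by linarith) (not_le.1 hcon).le] at h2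
        linarith
      have h3 := abs_mul_psi'_le_one (l * ξ)
      rw [abs_mul, abs_of_pos hl] at h3
      have h4 : (1 - 2 * ρ / 3) * L ≤ |ξ| * L := mul_le_mul_of_nonneg_right hξ hL0.le
      have h5 : |ξ| * L = l * |ξ| * psi' (l * ξ) := by rw [hL]; ring
      linarith
  have h6 : θ * ((1 - 2 * ρ / 3) / B * L) ≤ θ * ((1 - 2 * ρ / 3) * L) := by
    refine mul_le_mul_of_nonneg_left ?_ h0
    exact mul_le_mul_of_nonneg_right (div_le_self ha.le hB) hL0.le
  have h7 : l * (θ * (1 - 2 * ρ / 3) * psi' (l * ξ)) = θ * ((1 - 2 * ρ / 3) * L) := by rw [hL]; ring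
  rw [h7]
  linarith

/-! ### The derivative of the weight along the coordinate axes -/

/-- The inequality `θ cos θ ≤ sin θ`, which shows that a dilation of one centred coordinate increases
its squared sine at most quadratically. -/
lemma ctr_mul_sin_mul_cos_le (t : ℝ) : ctr t * (Real.pi / 2 * (Real.sin (Real.pi / 2 * t) *
    Real.cos (Real.pi / 2 * t))) ≤ Real.sin (Real.pi / 2 * t) ^ 2 := by
  have h1 : Real.sin (Real.pi / 2 * t) * Real.cos (Real.pi / 2 * t) =
      Real.sin (Real.pi / 2 * ctr t) * Real.cos (Real.pi / 2 * ctr t) := by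
    have h : Real.pi / 2 * t = Real.pi / 2 * ctr t + (round (t / 2) : ℝ) * Real.pi := by
      unfold ctr; ring
    have h2 : ∀ a : ℝ, Real.sin a * Real.cos a = Real.sin (2 * a) / 2 := fun a => by
      rw [Real.sin_two_mul]; ring
    rw [h2, h2, h, mul_add, show 2 * ((round (t / 2) : ℝ) * Real.pi) =
      (round (t / 2) : ℤ) * (2 * Real.pi) by ring, Real.sin_add_int_mul_two_pi]
  have h2 : ∀ θ : ℝ, 0 ≤ θ → θ ≤ Real.pi / 2 → θ * Real.cos θ ≤ Real.sin θ := fun θ h0 h1 => by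
    rcases h1.eq_or_lt with h | h
    · rw [h]; simp
    · have := Real.le_tan h0 h
      have hc := Real.cos_pos_of_mem_Ioo (x := θ) ⟨by linarith [Real.pi_pos], h⟩
      rwa [Real.tan_eq_sin_div_cos, le_div_iff₀ hc] at this
  rw [h1, sin_sq_eq]
  have h3 := abs_ctr_le_one t
  have hpi := Real.pi_pos
  have h4 : ctr t * (Real.pi / 2 * (Real.sin (Real.pi / 2 * ctr t) *
      Real.cos (Real.pi / 2 * ctr t))) = Real.sin (Real.pi / 2 * |ctr t|) *
      (Real.pi / 2 * |ctr t| * Real.cos (Real.pi / 2 * |ctr t|)) := by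
    rcases abs_cases (ctr t) with ⟨h, _⟩ | ⟨h, _⟩ <;> rw [h]
    · ring
    · rw [mul_neg, Real.sin_neg, Real.cos_neg]; ring
  rw [h4, pow_two]
  refine mul_le_mul_of_nonneg_left (h2 _ (by positivity) ?_) ?_
  · nlinarith
  · exact Real.sin_nonneg_of_nonneg_of_le_pi (by positivity) (by nlinarith)

/-- Away from the boundary of its cells, `cubeCount` does not depend on a coordinate. -/
lemma eventually_cubeCount_add_single (hρ₀ : 0 < ρ) {x : EuclideanSpace ℝ (Fin m)} {j : Fin m}
    (hj : |ctr (x j)| < 1 - ρ / 3) : ∀ᶠ t in nhds (0 : ℝ),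
      cubeCount ρ V (x + t • EuclideanSpace.single j (1 : ℝ)) = cubeCount ρ V x := by
  have hev : ∀ᶠ t in nhds (0 : ℝ), |ctr (x j) + t| < 1 - ρ / 3 := by
    have h : ContinuousAt (fun t : ℝ => |ctr (x j) + t|) 0 := by fun_prop
    exact h.eventually (gt_mem_nhds (by simpa using hj))
  filter_upwards [hev] with t ht
  refine cubeCount_congr hρ₀ fun i => ?_
  by_cases hij : i = j
  · subst hij
    right
    have h1 : (x + t • EuclideanSpace.single i (1 : ℝ)) i = x i + t := by simp
    have h2 : round ((x i + t) / 2) = round (x i / 2) := by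
      refine (int_eq_of_two_mul_add_eq (s := ctr (x i) + t) (t := ctr (x i + t)) (by linarith)
        (abs_ctr_le_one _) ?_).symm
      rw [two_mul_round_add_ctr, ← add_assoc, two_mul_round_add_ctr]
    have h3 : ctr (x i + t) = ctr (x i) + t := by unfold ctr; rw [h2]; ring
    rw [h1, h3]
    exact ⟨h2, ht, hj⟩
  · left; simp [hij]

/-- In the direction of a coordinate which is not close to the boundary of its cell the offset is
locally constant, so only the sines contribute to the derivative. -/
lemma hasLineDerivAt_invSqDist (hρ₀ : 0 < ρ) {x : EuclideanSpace ℝ (Fin m)}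
    (hx : x ∈ regularSet ρ V ℓ) {j : Fin m} (hj : |ctr (x j)| < 1 - ρ / 3) :
    HasLineDerivAt ℝ (invSqDist ρ V ℓ)
      (∑ J : Finset (Fin m), if J.card = ℓ + 1 then (if j ∈ J then
        -(Real.pi * (Real.sin (Real.pi / 2 * x j) * Real.cos (Real.pi / 2 * x j))) /
          sqDist ρ V J x ^ 2 else 0) else 0) x (EuclideanSpace.single j 1) := by
  classical
  have hi : ∀ i : Fin m, HasDerivAt
      (fun t : ℝ => Real.sin (Real.pi / 2 * (x i + if i = j then t else 0)) ^ 2)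
      (if i = j then Real.pi * (Real.sin (Real.pi / 2 * x j) * Real.cos (Real.pi / 2 * x j)) else 0)
      0 := by
    intro i
    by_cases hij : i = j
    · subst hij
      simp only [if_true]
      have h1 : HasDerivAt (fun t : ℝ => Real.pi / 2 * (x i + t)) (Real.pi / 2) 0 := by
        simpa using ((hasDerivAt_id (0 : ℝ)).const_add (x i)).const_mul (Real.pi / 2)
      convert! (h1.sin.pow 2) using 1
      simp; ring
    · simp only [if_neg hij, add_zero]; exact hasDerivAt_const _ _
  have hJ : ∀ J : Finset (Fin m), HasDerivAt (fun t : ℝ => if J.card = ℓ + 1 then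
      (∑ i ∈ J, Real.sin (Real.pi / 2 * (x i + if i = j then t else 0)) ^ 2 + offset ρ V x ^ 2)⁻¹
        else 0) (if J.card = ℓ + 1 then (if j ∈ J then
        -(Real.pi * (Real.sin (Real.pi / 2 * x j) * Real.cos (Real.pi / 2 * x j))) /
          sqDist ρ V J x ^ 2 else 0) else 0) 0 := by
    intro J
    by_cases hc : J.card = ℓ + 1
    · simp only [if_pos hc]
      have h0 : (∑ i ∈ J, Real.sin (Real.pi / 2 * (x i + if i = j then 0 else 0)) ^ 2 +
          offset ρ V x ^ 2) = sqDist ρ V J x := by simp [sqDist]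
      have h1 := ((HasDerivAt.fun_sum fun i (_ : i ∈ J) => hi i).add_const
        (offset ρ V x ^ 2)).fun_inv (by rw [h0]; exact (hx J hc).ne')
      rw [h0] at h1
      convert! h1 using 1
      rw [Finset.sum_ite_eq']
      split_ifs <;> simp
    · simp only [if_neg hc]; exact hasDerivAt_const _ _
  have hsum := HasDerivAt.fun_sum fun J (_ : J ∈ (Finset.univ : Finset (Finset (Fin m)))) => hJ J
  refine hsum.congr_of_eventuallyEq ?_
  filter_upwards [eventually_cubeCount_add_single (V := V) hρ₀ hj] with t ht
  unfold invSqDist sqDist offset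
  rw [ht]
  refine Finset.sum_congr rfl fun J _ => ?_
  congr 3
  refine Finset.sum_congr rfl fun i _ => ?_
  by_cases hij : i = j
  · subst hij; simp
  · simp [hij]

/-- The derivative of `dilation A`. -/
noncomputable def dilation' (A w : ℝ) : ℝ := A * (2 - psi w - w * psi' w)

lemma hasDerivAt_dilation (A w : ℝ) : HasDerivAt (dilation A) (dilation' A w) w := by
  convert! ((hasDerivAt_id w).const_mul A).mul ((psi_hasDerivAt w).const_sub 2) using 1
  simp [dilation']; ring

lemma dilation'_nonneg {w : ℝ} (hA : 0 ≤ A) (hw : 0 ≤ w) : 0 ≤ dilation' A w := by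
  have h1 := psi_lt_one w
  have h2 := abs_mul_psi'_le_one w
  rw [abs_of_nonneg hw] at h2
  exact mul_nonneg hA (by linarith)

/-- The determinant is not destroyed by the dependence of the dilation rate on the point: this is
where it matters that `dilation A w / w` is decreasing. -/
lemma le_bracket (hρ₀ : 0 < ρ) (hρ₁ : ρ < 1) (hA : 1 ≤ A) (hℓ : ℓ < m)
    {x : EuclideanSpace ℝ (Fin m)} (hx : x ∈ regularSet ρ V ℓ) {s v D : Fin m → ℝ}
    (hv : ∀ j, 0 ≤ v j) (hD : ∀ j, 0 < D j)
    (hvD : ∀ j, dilation A (weight ρ V ℓ x) * v j ≤ D j)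
    (hs : ∀ j, |ctr (x j)| < 1 - ρ / 3 → HasLineDerivAt ℝ (fun y => dilation A (weight ρ V ℓ y))
      (s j) x (EuclideanSpace.single j 1))
    (hv0 : ∀ j, 1 - ρ / 3 ≤ |ctr (x j)| → v j = 0) :
    weight ρ V ℓ x * psi' (weight ρ V ℓ x) / 2 ≤ 1 + ∑ j, s j * (v j * ctr (x j)) / D j := by
  classical
  set w := weight ρ V ℓ x with hw
  have hw0 : 0 < w := weight_pos hℓ hx
  have hA0 : 0 < A := by linarith
  set L := dilation A w with hL
  have hL0 : 0 < L := (mul_pos hA0 hw0).trans_le (mul_le_dilation hA0.le hw0.le)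
  have hd := dilation'_nonneg hA0.le hw0.le
  set q : Finset (Fin m) → ℝ := fun J => sqDist ρ V J x with hq
  set S : Fin m → ℝ := fun j => Real.sin (Real.pi / 2 * x j) ^ 2 with hS
  -- the contribution of each coordinate
  have hterm : ∀ j, -(dilation' A w / (w * L) * ∑ J : Finset (Fin m), if J.card = ℓ + 1 then
      (if j ∈ J then S j / q J ^ 2 else 0) else 0) ≤ s j * (v j * ctr (x j)) / D j := by
    intro j
    have hsum0 : 0 ≤ ∑ J : Finset (Fin m), if J.card = ℓ + 1 then
        (if j ∈ J then S j / q J ^ 2 else 0) else 0 := Finset.sum_nonneg fun J _ => by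
      split_ifs <;> positivity
    rcases le_or_gt (1 - ρ / 3) |ctr (x j)| with hj | hj
    · rw [hv0 j hj]
      simp only [zero_mul, mul_zero, zero_div, Left.neg_nonpos_iff]
      positivity
    have h1 := hasLineDerivAt_invSqDist hρ₀ hx hj
    set K := ∑ J : Finset (Fin m), if J.card = ℓ + 1 then (if j ∈ J then
        -(Real.pi * (Real.sin (Real.pi / 2 * x j) * Real.cos (Real.pi / 2 * x j))) /
          sqDist ρ V J x ^ 2 else 0) else 0 with hK
    have hI : 0 < invSqDist ρ V ℓ x := invSqDist_pos hℓ hx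
    have h2 : HasLineDerivAt ℝ (fun y => dilation A (weight ρ V ℓ y))
        (dilation' A w * (K / (2 * w))) x (EuclideanSpace.single j 1) := by
      have h0 : x + (0 : ℝ) • EuclideanSpace.single j (1 : ℝ) = x := by simp
      have h3 := HasDerivAt.sqrt h1 (by rw [h0]; exact hI.ne')
      rw [h0] at h3
      have h4 : HasDerivAt (dilation A) (dilation' A w)
          (√(invSqDist ρ V ℓ (x + (0 : ℝ) • EuclideanSpace.single j (1 : ℝ)))) := by
        rw [h0]; exact hasDerivAt_dilation A w
      exact h4.comp (0 : ℝ) h3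
    rw [(hs j hj).unique h2]
    set T := ∑ J : Finset (Fin m), if J.card = ℓ + 1 then
      (if j ∈ J then S j / q J ^ 2 else 0) else 0 with hT
    have hKT : -(2 * T) ≤ K * ctr (x j) := by
      rw [hT, hK, Finset.sum_mul, Finset.mul_sum, ← Finset.sum_neg_distrib]
      refine Finset.sum_le_sum fun J _ => ?_
      split_ifs with hJ hjJ
      · have h5 := ctr_mul_sin_mul_cos_le (x j)
        have hqJ : 0 < q J := hx J hJ
        have h6 : 2 * (S j / q J ^ 2) + -(Real.pi * (Real.sin (Real.pi / 2 * x j) *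
            Real.cos (Real.pi / 2 * x j))) / sqDist ρ V J x ^ 2 * ctr (x j) =
            2 * (S j - ctr (x j) * (Real.pi / 2 * (Real.sin (Real.pi / 2 * x j) *
            Real.cos (Real.pi / 2 * x j)))) / q J ^ 2 := by
          simp only [hq]; field_simp; ring
        have h7 : 0 ≤ 2 * (S j - ctr (x j) * (Real.pi / 2 * (Real.sin (Real.pi / 2 * x j) *
            Real.cos (Real.pi / 2 * x j)))) / q J ^ 2 := by
          have : 0 ≤ S j - ctr (x j) * (Real.pi / 2 * (Real.sin (Real.pi / 2 * x j) *
            Real.cos (Real.pi / 2 * x j))) := by linarith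
          positivity
        linarith
      · simp
      · simp
    have hvL : v j / D j ≤ 1 / L := by
      rw [div_le_div_iff₀ (hD j) hL0]; linarith [hvD j]
    have hvD0 : 0 ≤ v j / D j := div_nonneg (hv j) (hD j).le
    calc -(dilation' A w / (w * L) * T) = -(dilation' A w / w * T) * (1 / L) := by
          field_simp
      _ ≤ -(dilation' A w / w * T) * (v j / D j) :=
          mul_le_mul_of_nonpos_left hvL (by rw [neg_nonpos]; positivity)
      _ = dilation' A w / (2 * w) * (v j / D j) * -(2 * T) := by field_simp
      _ ≤ dilation' A w / (2 * w) * (v j / D j) * (K * ctr (x j)) :=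
          mul_le_mul_of_nonneg_left hKT (by positivity)
      _ = _ := by ring
  -- summation over the coordinates
  have hsum : ∑ j, ∑ J : Finset (Fin m), (if J.card = ℓ + 1 then
      (if j ∈ J then S j / q J ^ 2 else 0) else 0) ≤ w ^ 2 := by
    rw [Finset.sum_comm, weight_sq]
    refine Finset.sum_le_sum fun J _ => ?_
    split_ifs with hJ
    · rw [Finset.sum_ite_mem, Finset.univ_inter, ← Finset.sum_div]
      have hqJ : 0 < q J := hx J hJ
      have h1 : ∑ j ∈ J, S j ≤ q J := le_add_of_nonneg_right (sq_nonneg _)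
      calc (∑ j ∈ J, S j) / q J ^ 2 ≤ q J / q J ^ 2 := by gcongr
        _ = (sqDist ρ V J x)⁻¹ := by simp only [hq]; field_simp
    · simp
  have hfin : 1 - dilation' A w / (w * L) * w ^ 2 = w * psi' w / (2 - psi w) := by
    have h1 : L = A * w * (2 - psi w) := rfl
    have h2 : 2 - psi w ≠ 0 := by have := psi_lt_one w; linarith
    rw [h1, dilation']
    field_simp
    ring
  have hpsi := psi'_pos w
  calc w * psi' w / 2 ≤ w * psi' w / (2 - psi w) := by
        have := psi_lt_one w
        have := psi_nonneg hw0.le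
        gcongr <;> linarith
    _ = 1 - dilation' A w / (w * L) * w ^ 2 := hfin.symm
    _ ≤ 1 - dilation' A w / (w * L) * ∑ j, ∑ J : Finset (Fin m), (if J.card = ℓ + 1 then
      (if j ∈ J then S j / q J ^ 2 else 0) else 0) := by gcongr
    _ ≤ _ := by
      rw [Finset.mul_sum, sub_eq_add_neg, ← Finset.sum_neg_distrib]
      gcongr with j _
      exact hterm j

/-! ### The lower bound for the Jacobian -/

/-- A formula for the Jacobian of the thickening map, with a factor bounded below. -/
lemma prod_mul_le_jac_thick (hρ₀ : 0 < ρ) (hρ₁ : ρ < 1) (hA : 1 ≤ A) (hℓ : ℓ < m)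
    {x : EuclideanSpace ℝ (Fin m)} (hx : x ∈ regularSet ρ V ℓ)
    (hD : ∀ i, 0 < diagDeriv ρ (cutoff ρ V x) (dilation A (weight ρ V ℓ x)) (ctr (x i))) :
    (∏ i, diagDeriv ρ (cutoff ρ V x) (dilation A (weight ρ V ℓ x)) (ctr (x i))) *
      (weight ρ V ℓ x * psi' (weight ρ V ℓ x) / 2) ≤ jac (thick ρ A V ℓ) x := by
  classical
  set k := cutoff ρ V x with hk
  set L := dilation A (weight ρ V ℓ x) with hL
  have hk₀ := cutoff_nonneg ρ V x
  have hk₁ := cutoff_le_one ρ V x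
  obtain ⟨R, hR⟩ : ∃ R, HasFDerivAt (cutoff ρ V) R x :=
    ⟨_, (((isSymbol_cutoff (m := m) hρ₀ hρ₁).contDiffAt V x (mem_univ x)).differentiableAt
      (by simp)).hasFDerivAt⟩
  obtain ⟨S, hS⟩ : ∃ S, HasFDerivAt (fun y => dilation A (weight ρ V ℓ y)) S x :=
    ⟨_, (((isSymbol_dilation (m := m) hρ₀ hρ₁ A).contDiffAt (V, ⟨ℓ, hℓ⟩) x hx).differentiableAt
      (by simp)).hasFDerivAt⟩
  have hcoord : ∀ i, HasFDerivAt (fun y : EuclideanSpace ℝ (Fin m) =>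
      y i - 2 * (round (x i / 2) : ℝ)) (EuclideanSpace.proj i : _ →L[ℝ] ℝ) x := fun i =>
    (EuclideanSpace.proj i : EuclideanSpace ℝ (Fin m) →L[ℝ] ℝ).hasFDerivAt.sub_const _
  set D : Fin m → ℝ := fun i => diagDeriv ρ k L (ctr (x i)) with hDdef
  set v : Fin m → ℝ := fun i => dilationDeriv ρ k L (ctr (x i)) with hvdef
  set p : Fin m → ℝ := fun i => cutoffDeriv ρ L (ctr (x i)) with hpdef
  have hΦ : HasFDerivAt (thick ρ A V ℓ) (fderiv ℝ (thick ρ A V ℓ) x) x :=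
    ((contDiffAt_thick hρ₀ hρ₁ hA hℓ hx).differentiableAt (by simp)).hasFDerivAt
  have hent : ∀ i j, fderiv ℝ (thick ρ A V ℓ) x (EuclideanSpace.single j 1) i =
      (if i = j then D i else 0) + v i * ctr (x i) * S (EuclideanSpace.single j 1) +
        p i * R (EuclideanSpace.single j 1) := by
    intro i j
    have h1 : HasFDerivAt (fun y => thick ρ A V ℓ y i)
        ((EuclideanSpace.proj i : _ →L[ℝ] ℝ).comp (fderiv ℝ (thick ρ A V ℓ) x)) x :=
      (EuclideanSpace.proj i : EuclideanSpace ℝ (Fin m) →L[ℝ] ℝ).hasFDerivAt.comp x hΦ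
    have h2 := (hasFDerivAt_displacement hR hS (hcoord i) ρ).add_const
      (2 * (round (x i / 2) : ℝ))
    have h3 : (fun y => thick ρ A V ℓ y i) =ᶠ[nhds x] fun y =>
        (y i - 2 * (round (x i / 2) : ℝ)) + displacement ρ (cutoff ρ V y)
          (dilation A (weight ρ V ℓ y)) (y i - 2 * (round (x i / 2) : ℝ)) +
          2 * (round (x i / 2) : ℝ) := by
      filter_upwards [thick_eventuallyEq (A := A) (V := V) (ℓ := ℓ) hρ₀ hρ₁ x] with y hy
      rw [hy]; ring
    have h4 := h1.unique (h2.congr_of_eventuallyEq h3)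
    have h5 := congrArg (fun T : EuclideanSpace ℝ (Fin m) →L[ℝ] ℝ =>
      T (EuclideanSpace.single j 1)) h4
    refine Eq.trans h5 ?_
    change _ * (EuclideanSpace.single j (1 : ℝ) : EuclideanSpace ℝ (Fin m)) i + _ + _ = _
    rw [PiLp.single_apply]
    simp only [hDdef, hvdef, hpdef, ctr, hk, hL]
    split_ifs <;> simp
  set s : Fin m → ℝ := fun j => S (EuclideanSpace.single j 1) with hs
  set r : Fin m → ℝ := fun j => R (EuclideanSpace.single j 1) with hr
  have hr0 : ∀ j, |ctr (x j)| < 1 - ρ / 3 → r j = 0 := by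
    intro j hj
    have h1 := hR.hasLineDerivAt (EuclideanSpace.single j 1)
    have h2 : HasLineDerivAt ℝ (cutoff ρ V) 0 x (EuclideanSpace.single j 1) := by
      refine (hasDerivAt_const (0 : ℝ) (cutoff ρ V x)).congr_of_eventuallyEq ?_
      filter_upwards [eventually_cubeCount_add_single (V := V) hρ₀ hj] with t ht
      unfold cutoff; rw [ht]
    exact h1.unique h2
  have hpl : ∀ j, 1 - ρ / 3 ≤ |ctr (x j)| →
      plateau (1 - 2 * ρ / 3) (1 - ρ / 3) (ctr (x j)) = 0 := fun j hj =>
    plateau_eq_zero (by linarith) (by linarith) hj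
  have hv0 : ∀ j, 1 - ρ / 3 ≤ |ctr (x j)| → v j = 0 := fun j hj => by
    simp [hvdef, dilationDeriv, hpl j hj]
  have hp0 : ∀ j, 1 - ρ / 3 ≤ |ctr (x j)| → p j = 0 := fun j hj => by
    simp [hpdef, cutoffDeriv, hpl j hj]
  have hdet : (fderiv ℝ (thick ρ A V ℓ) x).det =
      (∏ i, D i) * (1 + ∑ j, s j * (v j * ctr (x j)) / D j) := by
    rw [ContinuousLinearMap.det,
      ← LinearMap.det_toMatrix (EuclideanSpace.basisFun (Fin m) ℝ).toBasis,
      ← det_diagonal_add_rank_two (p := p) (r := r) (fun i => (hD i).ne')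
        (fun j => ?_) (fun j => ?_)]
    · congr 1
      ext i j
      rw [LinearMap.toMatrix_apply]
      simpa using hent i j
    · rcases le_or_gt (1 - ρ / 3) |ctr (x j)| with hj | hj
      · rw [hv0 j hj]; simp
      · rw [hr0 j hj, zero_mul]
    · rcases le_or_gt (1 - ρ / 3) |ctr (x j)| with hj | hj
      · rw [hp0 j hj, mul_zero]
      · rw [hr0 j hj, zero_mul]
  rw [jac, hdet]
  refine le_trans ?_ (le_abs_self _)
  refine mul_le_mul_of_nonneg_left ?_ (Finset.prod_nonneg fun i _ => (hD i).le)
  exact le_bracket hρ₀ hρ₁ hA hℓ hx (fun j => dilationDeriv_nonneg hρ₁ hk₀ _ _) hD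
    (fun j => mul_dilationDeriv_le hρ₀ hρ₁ hk₀ hk₁)
    (fun j _ => hS.hasLineDerivAt (EuclideanSpace.single j 1)) hv0

/-- One of the terms of the sum which defines the squared weight is at least `2 ^ (-m)` times the
sum: the weight is comparable with the inverse distance to a single coordinate subspace. -/
lemma exists_inv_sqDist_ge (hℓ : ℓ < m) {x : EuclideanSpace ℝ (Fin m)}
    (hx : x ∈ regularSet ρ V ℓ) : ∃ J : Finset (Fin m), J.card = ℓ + 1 ∧
      weight ρ V ℓ x ^ 2 * sqDist ρ V J x ≤ 2 ^ m := by
  have hw := pow_pos (weight_pos hℓ hx) 2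
  have hI : ∑ _J : Finset (Fin m), weight ρ V ℓ x ^ 2 / 2 ^ m ≤ ∑ J : Finset (Fin m),
      if J.card = ℓ + 1 then (sqDist ρ V J x)⁻¹ else 0 := by
    have h2 : (∑ J : Finset (Fin m), if J.card = ℓ + 1 then (sqDist ρ V J x)⁻¹ else 0) =
      weight ρ V ℓ x ^ 2 := by rw [weight_sq]; rfl
    rw [h2]
    simp
    field_simp
    exact le_rfl
  obtain ⟨J, -, hJ⟩ := Finset.exists_le_of_sum_le (Finset.univ_nonempty) hI
  have h2 : (0 : ℝ) < weight ρ V ℓ x ^ 2 / 2 ^ m := by positivity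
  by_cases hc : J.card = ℓ + 1
  · rw [if_pos hc] at hJ
    have hq := hx J hc
    refine ⟨J, hc, ?_⟩
    rw [div_le_iff₀ (by positivity), inv_mul_eq_div, le_div_iff₀ hq] at hJ
    exact hJ
  · rw [if_neg hc] at hJ
    linarith

/-- Where the cutoff is not constant the offset is bounded below, so the weight is bounded. -/
lemma weight_le_of_cutoff_lt_one {x : EuclideanSpace ℝ (Fin m)} (h : cutoff ρ V x < 1) :
    weight ρ V ℓ x ≤ √(2 ^ m) / Real.smoothTransition (1 / 2) := by
  have hs : 0 < Real.smoothTransition (1 / 2) := Real.smoothTransition.pos_of_pos (by norm_num)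
  have hN : cubeCount ρ V x < 1 / 2 := by
    by_contra hcon
    push Not at hcon
    exact h.ne (Real.smoothTransition.one_of_one_le (by linarith))
  have hg : Real.smoothTransition (1 / 2) ≤ offset ρ V x :=
    Real.smoothTransition.monotone (by linarith)
  refine weight_le_div_of_sqDist hs fun J _ => ?_
  exact le_add_of_nonneg_of_le (Finset.sum_nonneg fun j _ => sq_nonneg _) (by gcongr)

/-- The Jacobian dominates every power of the weight below the codimension of the dual skeleton. For
the `ℓ + 1` coordinates in a set `J` for which `sqDist ρ V J x` is comparable with the inverse
squared weight, the argument of `psi` is bounded, and the derivative of the new coordinate is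
comparable with the weight. For the others, the slow decay of the derivative of `psi` makes it
larger than a small negative power of the weight. -/
lemma exists_mul_rpow_weight_le_jac_thick (hρ₀ : 0 < ρ) (hρ₁ : ρ < 1) (hA : 1 ≤ A) (hℓ : ℓ < m)
    {β : ℝ} (hβ₀ : 0 ≤ β) (hβ : β < ℓ + 1) : ∃ c, 0 < c ∧ ∀ (V : Set (Fin m → ℤ)), ∀ x ∈ regularSet ρ V ℓ,
      c * weight ρ V ℓ x ^ β ≤ jac (thick ρ A V ℓ) x := by
  classical
  have hA0 : 0 < A := by linarith
  -- each of the `m` diagonal entries and the remaining factor may lose a power `δ` of the weight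
  set δ : ℝ := (ℓ + 1 - β) / (m + 1) with hδ
  have hδ0 : 0 < δ := div_pos (by linarith) (by positivity)
  obtain ⟨c₀, hc₀, hpsi⟩ := exists_le_psi' hδ0
  set K : ℝ := 4 * A * √(2 ^ m) + 1 with hK
  set t : ℝ := (√(m + 1))⁻¹ with ht
  set B : ℝ := max 1 (2 * A * (√(2 ^ m) / Real.smoothTransition (1 / 2))) with hB
  set a : ℝ := min ((1 - 2 * ρ / 3) / B) (1 / 2) with ha
  set κ : ℝ := c₀ * K ^ (-1 - δ) with hκ
  have hr : 1 ≤ √((2 : ℝ) ^ m) := Real.one_le_sqrt.2 (one_le_pow₀ one_le_two)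
  have hAr : A ≤ A * √(2 ^ m) := le_mul_of_one_le_right hA0.le hr
  have hB1 : 1 ≤ B := le_max_left _ _
  have ht0 : 0 < t := by positivity
  have hK0 : 0 < K := by positivity
  have hκ0 : 0 < κ := by positivity
  have ha0 : 0 < a := lt_min (div_pos (by linarith) (by linarith)) (by norm_num)
  refine ⟨(a * t * κ) ^ (m + 1), by positivity, fun V x hx => ?_⟩
  set w := weight ρ V ℓ x with hw
  have hw0 : 0 < w := weight_pos hℓ hx
  set W := √(m + 1) * w with hW
  have hW1 : 1 ≤ W := one_le_mul_weight hℓ hx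
  have hW0 : 0 < W := by linarith
  have hwt : w = t * W := by rw [ht, hW]; field_simp
  have hwW : w ≤ W := le_mul_of_one_le_left hw0.le (Real.one_le_sqrt.2 (by simp))
  set L := dilation A w with hL
  have hLA : A * w ≤ L := mul_le_dilation hA0.le hw0.le
  have hLw : w ≤ L := (le_mul_of_one_le_left hw0.le hA).trans hLA
  have hL2 : L ≤ 2 * A * w := dilation_le hA0.le hw0.le
  have hL0 : 0 < L := hw0.trans_le hLw
  -- the two lower bounds for the derivative of `psi`
  have hpsi1 : ∀ y : ℝ, 1 + |y| ≤ K → κ ≤ psi' y := fun y hy => by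
    refine le_trans ?_ (hpsi y)
    refine mul_le_mul_of_nonneg_left ?_ hc₀.le
    exact Real.rpow_le_rpow_of_nonpos (by positivity) hy (by linarith)
  have hpsi2 : ∀ y : ℝ, 1 + |y| ≤ K * W → κ * W ^ (-1 - δ) ≤ psi' y := fun y hy => by
    refine le_trans ?_ (hpsi y)
    rw [hκ, mul_assoc, ← Real.mul_rpow hK0.le hW0.le]
    refine mul_le_mul_of_nonneg_left ?_ hc₀.le
    exact Real.rpow_le_rpow_of_nonpos (by positivity) hy (by linarith)
  have hWe : ∀ e : ℝ, W * W ^ (e - 1) = W ^ e := fun e => by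
    nth_rw 1 [← Real.rpow_one W]
    rw [← Real.rpow_add hW0]; congr 1; ring
  obtain ⟨J, hJc, hJ⟩ := exists_inv_sqDist_ge hℓ hx
  -- the diagonal entries: better bounds for the coordinates in `J`
  have hdiag : ∀ i, a * t * κ * W ^ ((if i ∈ J then 1 else 0) - δ) ≤
      diagDeriv ρ (cutoff ρ V x) L (ctr (x i)) := by
    intro i
    have h1 := mul_psi'_le_diagDeriv (ξ := ctr (x i)) hρ₀ hρ₁ (cutoff_nonneg ρ V x)
      (cutoff_le_one ρ V x) hL0 hB1 (fun h => hL2.trans ((mul_le_mul_of_nonneg_left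
        (weight_le_of_cutoff_lt_one h) (by positivity)).trans (le_max_right _ _)))
    refine le_trans ?_ h1
    have h3 := psi'_pos (L * ctr (x i))
    suffices h : κ * W ^ (((if i ∈ J then 1 else 0) - δ) - 1) ≤ psi' (L * ctr (x i)) by
      calc a * t * κ * W ^ ((if i ∈ J then 1 else 0) - δ)
          = a * (w * (κ * W ^ (((if i ∈ J then 1 else 0) - δ) - 1))) := by
            rw [← hWe ((if i ∈ J then 1 else 0) - δ), hwt]; ring
        _ ≤ (1 - 2 * ρ / 3) / B * (L * psi' (L * ctr (x i))) := by
          refine mul_le_mul (min_le_left _ _) (mul_le_mul hLw h ?_ hL0.le) ?_ ?_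
          · positivity
          · positivity
          · exact div_nonneg (by linarith) (by linarith)
    split_ifs with hi
    · have h4 : |ctr (x i)| * w ≤ √(2 ^ m) := by
        refine Real.le_sqrt_of_sq_le ?_
        have h5 : ctr (x i) ^ 2 ≤ sqDist ρ V J x := (ctr_sq_le_sin_sq _).trans
          (le_add_of_le_of_nonneg (Finset.single_le_sum
            (f := fun j => Real.sin (Real.pi / 2 * x j) ^ 2) (fun j _ => sq_nonneg _) hi)
            (sq_nonneg _))
        rw [mul_pow, sq_abs, mul_comm]
        exact (mul_le_mul_of_nonneg_left h5 (sq_nonneg _)).trans hJ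
      have h6 : |L * ctr (x i)| ≤ 2 * A * √(2 ^ m) := by
        rw [abs_mul, abs_of_pos hL0]
        have := mul_le_mul_of_nonneg_right hL2 (abs_nonneg (ctr (x i)))
        have := mul_le_mul_of_nonneg_left h4 (show 0 ≤ 2 * A by positivity)
        linarith
      refine le_trans ?_ (hpsi1 _ (by rw [hK]; nlinarith))
      refine mul_le_of_le_one_right hκ0.le (Real.rpow_le_one_of_one_le_of_nonpos hW1 ?_)
      linarith
    · refine (le_of_eq ?_).trans (hpsi2 _ ?_)
      · congr 2; ring
      · rw [abs_mul, abs_of_pos hL0]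
        have h4 : L * |ctr (x i)| ≤ L := mul_le_of_le_one_right hL0.le (abs_ctr_le_one _)
        have h5 := mul_le_mul_of_nonneg_left hwW (show 0 ≤ 2 * A by positivity)
        have h6 := mul_le_mul_of_nonneg_right hAr hW0.le
        rw [hK]
        nlinarith
  -- the remaining factor of the determinant
  have hbracket : a * t * κ * W ^ (-δ) ≤ w * psi' w / 2 := by
    have h1 := hpsi2 w (by
      rw [abs_of_pos hw0, hK]
      have := mul_le_mul_of_nonneg_right (hA.trans hAr) hW0.le
      nlinarith)
    have h2 : a ≤ 1 / 2 := min_le_right _ _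
    calc a * t * κ * W ^ (-δ) = a * (w * (κ * W ^ (-1 - δ))) := by
          rw [← hWe (-δ), hwt, show -δ - 1 = -1 - δ by ring]; ring
      _ ≤ 1 / 2 * (w * psi' w) := by gcongr
      _ = w * psi' w / 2 := by ring
  have hDpos : ∀ i, 0 < diagDeriv ρ (cutoff ρ V x) L (ctr (x i)) := fun i =>
    lt_of_lt_of_le (by positivity) (hdiag i)
  refine le_trans ?_ (prod_mul_le_jac_thick hρ₀ hρ₁ hA hℓ hx hDpos)
  have hexp : β = ∑ i : Fin m, ((if i ∈ J then 1 else 0) - δ) + -δ := by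
    rw [Finset.sum_sub_distrib, Finset.sum_ite_mem, Finset.univ_inter]
    simp only [Finset.sum_const, Finset.card_univ, Fintype.card_fin, nsmul_eq_mul, hJc, mul_one]
    push_cast
    rw [hδ]; field_simp; ring
  calc (a * t * κ) ^ (m + 1) * w ^ β ≤ (a * t * κ) ^ (m + 1) * W ^ β := by
        gcongr
    _ = (∏ i : Fin m, (a * t * κ * W ^ ((if i ∈ J then 1 else 0) - δ))) *
        (a * t * κ * W ^ (-δ)) := by
      rw [Finset.prod_mul_distrib, Finset.prod_const, ← Real.rpow_sum_of_pos hW0]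
      nth_rw 1 [hexp]
      rw [Real.rpow_add hW0, Finset.card_univ, Fintype.card_fin]
      ring
    _ ≤ _ := by
      refine mul_le_mul (Finset.prod_le_prod (fun i _ => by positivity) fun i _ => hdiag i) hbracket
        (by positivity) (Finset.prod_nonneg fun i _ => (hDpos i).le)

end Jacobian

/-! ### Cutoffs near the singular set -/

section SingularCutoffs

variable {m : ℕ} {ρ : ℝ} {V : Set (Fin m → ℤ)} {ℓ : ℕ}

open scoped Classical in
/-- A smooth function which vanishes near the singular set, where the weight is at least
`2 (n + 1)`, and is `1` where the weight is at most `n + 1`. -/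
noncomputable def singularCutoff (ρ : ℝ) (V : Set (Fin m → ℤ)) (ℓ n : ℕ)
    (x : EuclideanSpace ℝ (Fin m)) : ℝ :=
  if x ∈ regularSet ρ V ℓ then Real.smoothTransition (2 - weight ρ V ℓ x / (n + 1)) else 0

lemma singularCutoff_mem_Icc (ρ : ℝ) (V : Set (Fin m → ℤ)) (ℓ n : ℕ)
    (x : EuclideanSpace ℝ (Fin m)) : singularCutoff ρ V ℓ n x ∈ Icc (0 : ℝ) 1 := by
  unfold singularCutoff
  split_ifs
  · exact ⟨Real.smoothTransition.nonneg _, Real.smoothTransition.le_one _⟩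
  · simp

lemma continuousAt_weight (hρ₀ : 0 < ρ) (hρ₁ : ρ < 1) (hℓ : ℓ < m) {x : EuclideanSpace ℝ (Fin m)}
    (hx : x ∈ regularSet ρ V ℓ) : ContinuousAt (weight ρ V ℓ) x :=
  ((isSymbol_weight (m := m) hρ₀ hρ₁).contDiffAt (V, ⟨ℓ, hℓ⟩) x hx).continuousAt

lemma eventually_mem_regularSet (hρ₀ : 0 < ρ) (hρ₁ : ρ < 1) {x : EuclideanSpace ℝ (Fin m)}
    (hx : x ∈ regularSet ρ V ℓ) : ∀ᶠ y in nhds x, y ∈ regularSet ρ V ℓ :=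
  (isOpen_regularSet hρ₀ hρ₁).mem_nhds hx

lemma singularCutoff_eventuallyEq_one (hρ₀ : 0 < ρ) (hρ₁ : ρ < 1) (hℓ : ℓ < m)
    {x : EuclideanSpace ℝ (Fin m)} (hx : x ∈ regularSet ρ V ℓ) :
    ∀ᶠ n : ℕ in Filter.atTop, singularCutoff ρ V ℓ n =ᶠ[nhds x] fun _ => 1 := by
  filter_upwards [Filter.eventually_ge_atTop ⌈weight ρ V ℓ x⌉₊] with n hn
  have hw : weight ρ V ℓ x < n + 1 := by
    have h1 := Nat.le_ceil (weight ρ V ℓ x)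
    have h2 : (⌈weight ρ V ℓ x⌉₊ : ℝ) ≤ n := by exact_mod_cast hn
    linarith
  filter_upwards [eventually_mem_regularSet hρ₀ hρ₁ hx,
    (continuousAt_weight hρ₀ hρ₁ hℓ hx).eventually (gt_mem_nhds hw)] with y hy hyw
  rw [singularCutoff, if_pos hy]
  refine Real.smoothTransition.one_of_one_le ?_
  have : weight ρ V ℓ y / (n + 1) ≤ 1 := (div_le_one (by positivity)).2 hyw.le
  linarith

lemma singularCutoff_eq_zero {n : ℕ} {x : EuclideanSpace ℝ (Fin m)}
    (h : 2 * ((n : ℝ) + 1) ≤ weight ρ V ℓ x) : singularCutoff ρ V ℓ n x = 0 := by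
  unfold singularCutoff
  split_ifs
  · refine Real.smoothTransition.zero_of_nonpos ?_
    have : 2 ≤ weight ρ V ℓ x / (n + 1) := (le_div_iff₀ (by positivity)).2 h
    linarith
  · rfl

lemma continuous_sqDist (hρ₀ : 0 < ρ) (hρ₁ : ρ < 1) (V : Set (Fin m → ℤ)) (J : Finset (Fin m)) :
    Continuous (sqDist ρ V J) := by
  have h : Continuous (offset ρ V) := continuous_iff_continuousAt.2 fun x =>
    ((isSymbol_offset (m := m) hρ₀ hρ₁).contDiffAt V x (mem_univ x)).continuousAt
  unfold sqDist
  fun_prop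

lemma singularCutoff_eventuallyEq_zero (hρ₀ : 0 < ρ) (hρ₁ : ρ < 1)
    {x : EuclideanSpace ℝ (Fin m)} (hx : x ∉ regularSet ρ V ℓ) (n : ℕ) :
    singularCutoff ρ V ℓ n =ᶠ[nhds x] fun _ => 0 := by
  simp only [regularSet, mem_ofPred_eq, not_forall, not_lt] at hx
  obtain ⟨J, hJ, hx⟩ := hx
  have hlt : sqDist ρ V J x < ((2 * ((n : ℝ) + 1)) ^ 2)⁻¹ := hx.trans_lt (by positivity)
  filter_upwards [(continuous_sqDist hρ₀ hρ₁ V J).continuousAt.eventually (gt_mem_nhds hlt)]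
    with y hy
  by_cases hyr : y ∈ regularSet ρ V ℓ
  · refine singularCutoff_eq_zero (Real.le_sqrt_of_sq_le ?_)
    refine le_trans ?_ (inv_sqDist_le_invSqDist hJ y)
    rw [le_inv_comm₀ (by positivity) (hyr J hJ)]
    exact hy.le
  · rw [singularCutoff, if_neg hyr]

/-- The derivatives of the cutoffs near the singular set are bounded by powers of the weight,
uniformly with respect to `n`. -/
lemma isSymbol_singularCutoff (hρ₀ : 0 < ρ) (hρ₁ : ρ < 1) (hℓ : ℓ < m) :
    IsSymbol (fun n : ℕ => {x : EuclideanSpace ℝ (Fin m) | x ∈ regularSet ρ V ℓ ∧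
        weight ρ V ℓ x ≤ 2 * ((n : ℝ) + 1)})
      (fun n => singularCutoff ρ V ℓ n) (fun _ _ => 1) (fun _ => weight ρ V ℓ) := by
  have h0 := (isSymbol_weight (m := m) hρ₀ hρ₁).comap (fun _ : ℕ => ((V, ⟨ℓ, hℓ⟩) : _ × Fin m))
    (B := fun n : ℕ => {x : EuclideanSpace ℝ (Fin m) | x ∈ regularSet ρ V ℓ ∧
        weight ρ V ℓ x ≤ 2 * ((n : ℝ) + 1)}) (fun n x hx => hx.1)
  have hW : ∀ n : ℕ, ∀ x ∈ {x : EuclideanSpace ℝ (Fin m) | x ∈ regularSet ρ V ℓ ∧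
        weight ρ V ℓ x ≤ 2 * ((n : ℝ) + 1)}, 0 ≤ weight ρ V ℓ x :=
    fun n x _ => weight_nonneg _ _ _ _
  have h1 := (isSymbol_const (A := fun n : ℕ => {x : EuclideanSpace ℝ (Fin m) |
    x ∈ regularSet ρ V ℓ ∧ weight ρ V ℓ x ≤ 2 * ((n : ℝ) + 1)}) (W := fun _ => weight ρ V ℓ)
    (M := fun n _ => ((n : ℝ) + 1)⁻¹) (fun n : ℕ => -((n : ℝ) + 1)⁻¹) hW
    (fun n x _ => by rw [abs_neg, abs_of_pos (by positivity)])).mul h0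
  have h2 := h1.mono_size (M' := fun _ _ => 1) (C := 2) (by norm_num) hW (fun n x hx => by
    rw [inv_mul_eq_div, mul_one]
    exact (div_le_iff₀ (by positivity)).2 hx.2)
  have h3 := (isSymbol_const (A := fun n : ℕ => {x : EuclideanSpace ℝ (Fin m) |
    x ∈ regularSet ρ V ℓ ∧ weight ρ V ℓ x ≤ 2 * ((n : ℝ) + 1)}) (W := fun _ => weight ρ V ℓ)
    (M := fun _ _ => 2) (fun n : ℕ => 2) hW (fun n x _ => by simp)).mono_size
    (M' := fun _ _ => 1) (C := 2) (by norm_num) hW (by simp)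
  refine (isSymbol_smoothTransition_comp (h3.add h2).hasSymbolDeriv hW).congr fun n x hx => ?_
  filter_upwards [eventually_mem_regularSet hρ₀ hρ₁ hx.1] with y hy
  rw [singularCutoff, if_pos hy]
  congr 1
  ring

lemma singularCutoff_eventuallyEq_zero_of_lt (hρ₀ : 0 < ρ) (hρ₁ : ρ < 1) (hℓ : ℓ < m) {n : ℕ}
    {x : EuclideanSpace ℝ (Fin m)} (hx : x ∈ regularSet ρ V ℓ)
    (h : 2 * ((n : ℝ) + 1) < weight ρ V ℓ x) : singularCutoff ρ V ℓ n =ᶠ[nhds x] fun _ => 0 := by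
  filter_upwards [(continuousAt_weight hρ₀ hρ₁ hℓ hx).eventually (lt_mem_nhds h)] with y hyw
  exact singularCutoff_eq_zero hyw.le

lemma contDiff_singularCutoff (hρ₀ : 0 < ρ) (hρ₁ : ρ < 1) (hℓ : ℓ < m) (n : ℕ) :
    ContDiff ℝ ∞ (singularCutoff ρ V ℓ n) := by
  refine contDiff_iff_contDiffAt.2 fun x => ?_
  by_cases hx : x ∈ regularSet ρ V ℓ
  · rcases le_or_gt (weight ρ V ℓ x) (2 * ((n : ℝ) + 1)) with h | h
    · exact (isSymbol_singularCutoff hρ₀ hρ₁ hℓ).contDiffAt n x ⟨hx, h⟩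
    · exact contDiffAt_const.congr_of_eventuallyEq
        (singularCutoff_eventuallyEq_zero_of_lt hρ₀ hρ₁ hℓ hx h)
  · exact contDiffAt_const.congr_of_eventuallyEq (singularCutoff_eventuallyEq_zero hρ₀ hρ₁ hx n)

lemma exists_bound_iteratedFDeriv_singularCutoff (hρ₀ : 0 < ρ) (hρ₁ : ρ < 1) (hℓ : ℓ < m)
    (V : Set (Fin m → ℤ)) (i : ℕ) :
    ∃ C, 0 ≤ C ∧ ∀ n : ℕ, ∀ x ∈ regularSet ρ V ℓ,
      ‖iteratedFDeriv ℝ i (singularCutoff ρ V ℓ n) x‖ ≤ C * weight ρ V ℓ x ^ i := by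
  obtain ⟨C, hC, hb⟩ := (isSymbol_singularCutoff (V := V) hρ₀ hρ₁ hℓ).bound i
  refine ⟨C, hC, fun n x hx => ?_⟩
  rcases le_or_gt (weight ρ V ℓ x) (2 * ((n : ℝ) + 1)) with h | h
  · simpa using hb n x ⟨hx, h⟩
  · rw [((singularCutoff_eventuallyEq_zero_of_lt hρ₀ hρ₁ hℓ hx h).iteratedFDeriv ℝ i).eq_of_nhds]
    have h0 : iteratedFDeriv ℝ i (fun _ : EuclideanSpace ℝ (Fin m) => (0 : ℝ)) x = 0 := by simp
    rw [h0, norm_zero]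
    have := weight_nonneg ρ V ℓ x
    positivity

end SingularCutoffs

/-! ### Integration by parts for derivatives of higher order -/

section Parts

variable {E F : Type*} [NormedAddCommGroup E] [NormedSpace ℝ E] [NormedAddCommGroup F]
  [NormedSpace ℝ F]

lemma ContDiffAt.iteratedFDeriv_apply {g : E → F} {x : E} (hg : ContDiffAt ℝ ∞ g x) {i : ℕ}
    (v : Fin i → E) : ContDiffAt ℝ ∞ (fun y => iteratedFDeriv ℝ i g y v) x :=
  (ContinuousMultilinearMap.apply ℝ (fun _ : Fin i => E) F v).contDiff.contDiffAt.comp x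
    (hg.iteratedFDeriv_right (by exact_mod_cast le_top))

lemma ContDiff.iteratedFDeriv_apply {g : E → F} (hg : ContDiff ℝ ∞ g) {i : ℕ}
    (v : Fin i → E) : ContDiff ℝ ∞ (fun y => iteratedFDeriv ℝ i g y v) :=
  contDiff_iff_contDiffAt.2 fun _ => ContDiffAt.iteratedFDeriv_apply hg.contDiffAt v

lemma ContDiff.fderiv_apply_const {g : E → F} (hg : ContDiff ℝ ∞ g) (a : E) :
    ContDiff ℝ ∞ (fun y => fderiv ℝ g y a) :=
  (hg.fderiv_right (m := ∞) (by exact_mod_cast le_top)).clm_apply contDiff_const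

lemma iteratedFDeriv_succ_apply_eq_fderiv {g : E → F} {x : E} (hg : ContDiffAt ℝ ∞ g x) {i : ℕ}
    (v : Fin (i + 1) → E) : iteratedFDeriv ℝ (i + 1) g x v =
      fderiv ℝ (fun y => iteratedFDeriv ℝ i g y (Fin.tail v)) x (v 0) := by
  rw [iteratedFDeriv_succ_apply_left, fderiv_continuousMultilinear_apply_const_apply]
  exact ((hg.iteratedFDeriv_right (m := 1) (by exact_mod_cast le_top))).differentiableAt (by simp)

lemma fderiv_fderiv_apply_comm {g : E → F} (hg : ContDiff ℝ ∞ g) (a b x : E) :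
    fderiv ℝ (fun y => fderiv ℝ g y a) x b = fderiv ℝ (fun y => fderiv ℝ g y b) x a := by
  have hd : DifferentiableAt ℝ (fderiv ℝ g) x :=
    (hg.fderiv_right (m := ∞) (by exact_mod_cast le_top)).differentiable (by simp) x
  have h : ∀ c d : E, fderiv ℝ (fun y => fderiv ℝ g y c) x d = fderiv ℝ (fderiv ℝ g) x d c := by
    intro c d
    rw [fderiv_clm_apply hd (differentiableAt_const c)]
    simp
  rw [h, h]
  exact (hg.contDiffAt.isSymmSndFDerivAt (by simpa using WithTop.coe_le_coe.2 (le_top : (2 : ℕ∞) ≤ ⊤))) b a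

/-- A derivative in a fixed direction commutes with derivatives of higher order. -/
lemma fderiv_iteratedFDeriv_apply_comm {g : E → F} (hg : ContDiff ℝ ∞ g) (i : ℕ) (v : Fin i → E)
    (a x : E) : fderiv ℝ (fun y => iteratedFDeriv ℝ i g y v) x a =
      iteratedFDeriv ℝ i (fun y => fderiv ℝ g y a) x v := by
  induction i generalizing x with
  | zero => simp
  | succ i ih =>
    have h1 : (fun y => iteratedFDeriv ℝ (i + 1) g y v) = fun y =>
        fderiv ℝ (fun z => iteratedFDeriv ℝ i g z (Fin.tail v)) y (v 0) := funext fun y =>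
      iteratedFDeriv_succ_apply_eq_fderiv hg.contDiffAt v
    rw [h1, fderiv_fderiv_apply_comm (ContDiff.iteratedFDeriv_apply hg _),
      iteratedFDeriv_succ_apply_eq_fderiv (ContDiff.fderiv_apply_const hg a).contDiffAt]
    congr 2
    funext y
    exact ih (Fin.tail v) y

lemma tsupport_iteratedFDeriv_apply_subset (f : E → F) {i : ℕ} (v : Fin i → E) :
    tsupport (fun y => iteratedFDeriv ℝ i f y v) ⊆ tsupport f := by
  refine (closure_mono fun y hy => ?_).trans (tsupport_iteratedFDeriv_subset (𝕜 := ℝ) (f := f) i)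
  rw [Function.mem_support] at hy ⊢
  intro h0
  rw [h0] at hy
  exact hy rfl

lemma HasCompactSupport.iteratedFDeriv_apply {f : E → F} (hf : HasCompactSupport f) {i : ℕ}
    (v : Fin i → E) : HasCompactSupport (fun y => iteratedFDeriv ℝ i f y v) :=
  hf.of_isClosed_subset (isClosed_tsupport _) (tsupport_iteratedFDeriv_apply_subset f v)

lemma continuous_smul_of_continuousAt {X : Type*} [TopologicalSpace X] {f : X → ℝ} {g : X → F} (hf : Continuous f)
    (hg : ∀ x ∈ tsupport f, ContinuousAt g x) : Continuous fun x => f x • g x :=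
  continuous_of_tsupport fun x hx => hf.continuousAt.smul (hg x (tsupport_smul_subset_left f g hx))

lemma contDiff_mul_of_contDiffAt {f : E → ℝ} {g : E → ℝ} (hf : ContDiff ℝ ∞ f)
    (hg : ∀ x ∈ tsupport f, ContDiffAt ℝ ∞ g x) : ContDiff ℝ ∞ fun x => f x * g x := by
  refine contDiff_iff_contDiffAt.2 fun x => ?_
  by_cases hx : x ∈ tsupport f
  · exact hf.contDiffAt.mul (hg x hx)
  · refine contDiffAt_const (c := (0 : ℝ)).congr_of_eventuallyEq ?_
    filter_upwards [notMem_tsupport_iff_eventuallyEq.1 hx] with y hy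
    rw [hy]; simp

variable [MeasurableSpace E] [BorelSpace E] [FiniteDimensional ℝ E] {μ : Measure E}
  [μ.IsAddHaarMeasure]

/-- Integration by parts against a test function on whose support the other function is smooth. -/
lemma integral_smul_iteratedFDeriv {f : E → ℝ} {g : E → F} (hf : ContDiff ℝ ∞ f)
    (hfc : HasCompactSupport f) (hg : ∀ x ∈ tsupport f, ContDiffAt ℝ ∞ g x) (i : ℕ)
    (v : Fin i → E) : ∫ x, f x • iteratedFDeriv ℝ i g x v ∂μ =
      (-1 : ℝ) ^ i • ∫ x, iteratedFDeriv ℝ i f x v • g x ∂μ := by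
  induction i generalizing f with
  | zero => simp
  | succ i ih =>
    have hint : ∀ (h : E → ℝ) (k : E → F), Continuous h → tsupport h ⊆ tsupport f →
        (∀ x ∈ tsupport f, ContinuousAt k x) → Integrable (fun x => h x • k x) μ :=
      fun h k hh hs hk => (continuous_smul_of_continuousAt hh fun x hx => hk x (hs hx)).integrable_of_hasCompactSupport
        (HasCompactSupport.smul_right (hfc.of_isClosed_subset (isClosed_tsupport _) hs))
    have hf1 := ContDiff.fderiv_apply_const hf (v 0)
    have hs1 : tsupport (fun y => fderiv ℝ f y (v 0)) ⊆ tsupport f := by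
      have h := tsupport_iteratedFDeriv_apply_subset f (fun _ : Fin 1 => v 0)
      simpa using h
    set k : E → F := fun y => iteratedFDeriv ℝ i g y (Fin.tail v) with hk
    have hkc : ∀ x ∈ tsupport f, ContDiffAt ℝ ∞ k x := fun x hx =>
      ContDiffAt.iteratedFDeriv_apply (hg x hx) _
    have h1 : ∀ x, f x • iteratedFDeriv ℝ (i + 1) g x v = f x • fderiv ℝ k x (v 0) := fun x => by
      by_cases hx : x ∈ tsupport f
      · rw [iteratedFDeriv_succ_apply_eq_fderiv (hg x hx)]
      · rw [image_eq_zero_of_notMem_tsupport hx, zero_smul, zero_smul]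
    simp_rw [h1]
    rw [integral_smul_fderiv_eq_neg_fderiv_smul_of_integrable
      (hint _ _ hf1.continuous hs1 fun x hx => (hkc x hx).continuousAt)
      (hint _ _ hf.continuous subset_rfl fun x hx => ?_)
      (hint _ _ hf.continuous subset_rfl fun x hx => (hkc x hx).continuousAt)
      (fun x _ => hf.differentiable (by simp) x)
      (fun x hx => (hkc x hx).differentiableAt (by simp)),
      ih hf1 (hfc.of_isClosed_subset (isClosed_tsupport _) hs1) (fun x hx => hg x (hs1 hx)),
      pow_succ, mul_neg_one, neg_smul]
    · congr 3
      funext x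
      rw [iteratedFDeriv_succ_apply_eq_fderiv hf.contDiffAt, fderiv_iteratedFDeriv_apply_comm hf]
    · exact (((hkc x hx).fderiv_right (m := 0) (by simp)).continuousAt).clm_apply
        continuousAt_const

end Parts

/-! ### Weak derivatives -/

section Weak

variable {m ν : ℕ} {Ω : Set (EuclideanSpace ℝ (Fin m))}

lemma integrableOn_smul_of_tsupport_subset {F : Type*} [NormedAddCommGroup F] [NormedSpace ℝ F]
    {f : EuclideanSpace ℝ (Fin m) → ℝ} {u : EuclideanSpace ℝ (Fin m) → F} (hf : Continuous f)
    (hfc : HasCompactSupport f) (hfu : IntegrableOn u (tsupport f)) :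
    Integrable (fun x => f x • u x) := by
  have h := hfu.continuousOn_smul hf.continuousOn hfc
  rw [← integrableOn_iff_integrable_of_support_subset (s := tsupport f)]
  · exact h
  · exact (Function.support_smul_subset_left f u).trans (subset_tsupport f)

lemma isWeakDeriv_of_contDiff {u : EuclideanSpace ℝ (Fin m) → EuclideanSpace ℝ (Fin ν)}
    (hu : ContDiff ℝ ∞ u) (i : ℕ) : IsWeakDeriv i u (iteratedFDeriv ℝ i u) Ω := by
  refine ⟨(hu.continuous.locallyIntegrable).locallyIntegrableOn _,
    ((hu.continuous_iteratedFDeriv (m := i) (by exact_mod_cast le_top)).locallyIntegrable).locallyIntegrableOn _,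
    fun φ hφ hφc hφs v => ?_⟩
  rw [setIntegral_eq_integral_of_forall_compl_eq_zero, setIntegral_eq_integral_of_forall_compl_eq_zero,
    integral_smul_iteratedFDeriv hφ hφc (fun x _ => hu.contDiffAt)]
  · intro x hx
    have h := image_eq_zero_of_notMem_tsupport
      (fun h => hx (hφs (tsupport_iteratedFDeriv_apply_subset φ v h)))
    exact (congrArg (· • u x) h).trans (zero_smul ℝ (u x))
  · intro x hx
    rw [image_eq_zero_of_notMem_tsupport (fun h => hx (hφs h)), zero_smul]

/-- Weak derivatives are unique. -/
lemma IsWeakDeriv.ae_eq {i : ℕ} {u : EuclideanSpace ℝ (Fin m) → EuclideanSpace ℝ (Fin ν)}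
    {g g' : EuclideanSpace ℝ (Fin m) →
      (EuclideanSpace ℝ (Fin m) [×i]→L[ℝ] EuclideanSpace ℝ (Fin ν))} (hΩ : IsOpen Ω)
    (hg : IsWeakDeriv i u g Ω) (hg' : IsWeakDeriv i u g' Ω) : g =ᵐ[volume.restrict Ω] g' := by
  have key : ∀ v : Fin i → Fin m, ∀ᵐ x ∂(volume.restrict Ω),
      g x (fun r => EuclideanSpace.single (v r) 1) = g' x fun r => EuclideanSpace.single (v r) 1 := by
    intro v
    set w : Fin i → EuclideanSpace ℝ (Fin m) := fun r => EuclideanSpace.single (v r) 1 with hw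
    have hL : ∀ h : EuclideanSpace ℝ (Fin m) →
        (EuclideanSpace ℝ (Fin m) [×i]→L[ℝ] EuclideanSpace ℝ (Fin ν)),
        LocallyIntegrableOn h Ω → LocallyIntegrableOn (fun x => h x w) Ω := fun h hh x hx => by
      obtain ⟨s, hs, hi⟩ := hh x hx
      exact ⟨s, hs, (ContinuousMultilinearMap.apply ℝ (fun _ : Fin i => EuclideanSpace ℝ (Fin m))
        (EuclideanSpace ℝ (Fin ν)) w).integrable_comp hi⟩
    have h1 := hL g hg.locallyIntegrableOn_deriv
    have h2 := hL g' hg'.locallyIntegrableOn_deriv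
    have h3 := hΩ.ae_eq_zero_of_integral_contDiff_smul_eq_zero (h1.sub h2) fun φ hφ hφc hφs => by
      have hI : ∀ h : EuclideanSpace ℝ (Fin m) →
          (EuclideanSpace ℝ (Fin m) [×i]→L[ℝ] EuclideanSpace ℝ (Fin ν)),
          LocallyIntegrableOn h Ω → Integrable fun x => φ x • h x w := fun h hh =>
        integrableOn_smul_of_tsupport_subset hφ.continuous hφc
          ((hL h hh).integrableOn_compact_subset hφs hφc)
      have h0 : ∀ h : EuclideanSpace ℝ (Fin m) →
          (EuclideanSpace ℝ (Fin m) [×i]→L[ℝ] EuclideanSpace ℝ (Fin ν)),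
          ∫ x in Ω, φ x • h x w = ∫ x, φ x • h x w := fun h =>
        setIntegral_eq_integral_of_forall_compl_eq_zero fun x hx => by
          rw [image_eq_zero_of_notMem_tsupport (fun h => hx (hφs h)), zero_smul]
      simp only [Pi.sub_apply, smul_sub]
      rw [integral_sub (hI g hg.locallyIntegrableOn_deriv) (hI g' hg'.locallyIntegrableOn_deriv),
        ← h0, ← h0, hg.integral_eq φ hφ hφc hφs, hg'.integral_eq φ hφ hφc hφs, sub_self]
    rw [ae_restrict_iff' hΩ.measurableSet]
    filter_upwards [h3] with x hx hxΩ
    exact sub_eq_zero.1 (hx hxΩ)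
  filter_upwards [ae_all_iff.2 key] with x hx
  refine ContinuousMultilinearMap.toMultilinearMap_injective ?_
  refine Module.Basis.ext_multilinear (fun _ => (EuclideanSpace.basisFun (Fin m) ℝ).toBasis) fun v => ?_
  simpa using hx v

end Weak

/-! ### Change of variables -/

section ChangeOfVariables

variable {m : ℕ} {Z Ω : Set (EuclideanSpace ℝ (Fin m))}
  {Φ : EuclideanSpace ℝ (Fin m) → EuclideanSpace ℝ (Fin m)}
  {F : Type*} [NormedAddCommGroup F] [NormedSpace ℝ F]

/-- The map `Φ` is an injective local diffeomorphism off the closed null set `Z`, with Jacobian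
bounded below, and it maps compact subsets of the open set `Ω`, up to `Z`, into compact subsets of
`Ω`. -/
structure IsSingularDiffeo (Z Ω : Set (EuclideanSpace ℝ (Fin m)))
    (Φ : EuclideanSpace ℝ (Fin m) → EuclideanSpace ℝ (Fin m)) : Prop where
  isOpen : IsOpen Ω
  isClosed : IsClosed Z
  measure_eq_zero : volume Z = 0
  contDiffAt : ∀ x ∉ Z, ContDiffAt ℝ ∞ Φ x
  injOn : InjOn Φ Zᶜ
  exists_isCompact : ∀ K ⊆ Ω, IsCompact K → ∃ K' ⊆ Ω, IsCompact K' ∧ Φ '' (K \ Z) ⊆ K'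
  exists_le_jac : ∃ c, 0 < c ∧ ∀ x ∉ Z, c ≤ jac Φ x

namespace IsSingularDiffeo

variable (h : IsSingularDiffeo Z Ω Φ)

include h

lemma mem {x : EuclideanSpace ℝ (Fin m)} (hx : x ∈ Ω \ Z) : Φ x ∈ Ω := by
  obtain ⟨K, hK, -, hΦ⟩ := h.exists_isCompact {x} (singleton_subset_iff.2 hx.1) isCompact_singleton
  exact hK (hΦ ⟨x, ⟨rfl, hx.2⟩, rfl⟩)

lemma hasFDerivAt {x : EuclideanSpace ℝ (Fin m)} (hx : x ∉ Z) :
    HasFDerivAt Φ (fderiv ℝ Φ x) x :=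
  ((h.contDiffAt x hx).differentiableAt (by simp)).hasFDerivAt

lemma jac_pos {x : EuclideanSpace ℝ (Fin m)} (hx : x ∉ Z) : 0 < jac Φ x := by
  obtain ⟨c, hc, hj⟩ := h.exists_le_jac
  exact hc.trans_le (hj x hx)

lemma ae_notMem : ∀ᵐ x, x ∉ Z := measure_eq_zero_iff_ae_notMem.1 h.measure_eq_zero

lemma restrict_diff (s : Set (EuclideanSpace ℝ (Fin m))) :
    volume.restrict (s \ Z) = volume.restrict s :=
  Measure.restrict_congr_set (sdiff_null_ae_eq_self h.measure_eq_zero)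

lemma continuousOn : ContinuousOn Φ Zᶜ := fun x hx =>
  (h.contDiffAt x hx).continuousAt.continuousWithinAt

lemma lintegral_image {s : Set (EuclideanSpace ℝ (Fin m))} (hs : MeasurableSet s)
    (f : EuclideanSpace ℝ (Fin m) → ENNReal) :
    ∫⁻ y in Φ '' (s \ Z), f y = ∫⁻ x in s, ENNReal.ofReal (jac Φ x) * f (Φ x) := by
  rw [← h.restrict_diff s]
  exact lintegral_image_eq_lintegral_abs_det_fderiv_mul volume (hs.diff h.isClosed.measurableSet)
    (fun x hx => (h.hasFDerivAt hx.2).hasFDerivWithinAt) (h.injOn.mono fun x hx => hx.2) f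

lemma integral_image {s : Set (EuclideanSpace ℝ (Fin m))} (hs : MeasurableSet s)
    (f : EuclideanSpace ℝ (Fin m) → F) :
    ∫ y in Φ '' (s \ Z), f y = ∫ x in s, jac Φ x • f (Φ x) := by
  rw [← h.restrict_diff s]
  exact integral_image_eq_integral_abs_det_fderiv_smul volume (hs.diff h.isClosed.measurableSet)
    (fun x hx => (h.hasFDerivAt hx.2).hasFDerivWithinAt) (h.injOn.mono fun x hx => hx.2) f

lemma integrableOn_image {s : Set (EuclideanSpace ℝ (Fin m))} (hs : MeasurableSet s)
    (f : EuclideanSpace ℝ (Fin m) → F) :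
    IntegrableOn f (Φ '' (s \ Z)) ↔ IntegrableOn (fun x => jac Φ x • f (Φ x)) s := by
  have h1 : IntegrableOn (fun x => jac Φ x • f (Φ x)) s ↔
      IntegrableOn (fun x => jac Φ x • f (Φ x)) (s \ Z) := by
    rw [IntegrableOn, IntegrableOn, h.restrict_diff]
  rw [h1]
  exact integrableOn_image_iff_integrableOn_abs_det_fderiv_smul volume
    (hs.diff h.isClosed.measurableSet)
    (fun x hx => (h.hasFDerivAt hx.2).hasFDerivWithinAt) (h.injOn.mono fun x hx => hx.2) f

lemma aemeasurable : AEMeasurable Φ (volume.restrict Ω) := by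
  rw [← h.restrict_diff]
  exact (h.continuousOn.mono fun x hx => hx.2).aemeasurable
    (h.isOpen.measurableSet.diff h.isClosed.measurableSet)

/-- Preimages of null sets are null sets, because the Jacobian does not vanish. -/
lemma map_absolutelyContinuous :
    (volume.restrict Ω).map Φ ≪ volume.restrict Ω := by
  refine Measure.AbsolutelyContinuous.mk fun s hs h0 => ?_
  rw [Measure.map_apply_of_aemeasurable h.aemeasurable hs]
  have h1 : ∫⁻ x in Ω, ENNReal.ofReal (jac Φ x) * s.indicator 1 (Φ x) = 0 := by
    rw [← h.lintegral_image h.isOpen.measurableSet]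
    refine le_antisymm ?_ bot_le
    calc ∫⁻ y in Φ '' (Ω \ Z), s.indicator 1 y ≤ ∫⁻ y in Ω, s.indicator 1 y :=
          lintegral_mono_set (image_subset_iff.2 fun x hx => h.mem hx)
      _ = 0 := by rw [lintegral_indicator_one hs]; exact h0
  have hae : AEMeasurable (fun x => ENNReal.ofReal (jac Φ x) * s.indicator (1 : EuclideanSpace ℝ (Fin m) → ENNReal) (Φ x))
      (volume.restrict Ω) := by
    refine AEMeasurable.mul ?_ ?_
    · rw [← h.restrict_diff]
      refine (ContinuousOn.aemeasurable ?_ (h.isOpen.measurableSet.diff h.isClosed.measurableSet))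
      intro x hx
      have h2 : ContinuousAt (fderiv ℝ Φ) x :=
        ((h.contDiffAt x hx.2).fderiv_right (m := 0) (by simp)).continuousAt
      exact (ENNReal.continuous_ofReal.continuousAt.comp
        ((ContinuousLinearMap.continuous_det.continuousAt.comp h2).abs)).continuousWithinAt
    · exact (measurable_one.indicator hs).comp_aemeasurable h.aemeasurable
  have h2 := (lintegral_eq_zero_iff' hae).1 h1
  rw [← h.restrict_diff, Measure.restrict_apply₀']
  · rw [← h.restrict_diff] at h2
    have h3 := (ae_restrict_iff' (h.isOpen.measurableSet.diff h.isClosed.measurableSet)).1 h2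
    refine measure_mono_null ?_ h3
    rintro x ⟨hx1, hx2⟩ hx3
    have h4 := hx3 hx2
    rw [Pi.zero_apply, mul_eq_zero] at h4
    rcases h4 with h4 | h4
    · exact absurd h4 (ENNReal.ofReal_pos.2 (h.jac_pos hx2.2)).ne'
    · rw [indicator_of_mem (show Φ x ∈ s from hx1)] at h4
      simp at h4
  · exact (h.isOpen.measurableSet.diff h.isClosed.measurableSet).nullMeasurableSet

lemma aestronglyMeasurable_comp {G : Type*} [TopologicalSpace G]
    {f : EuclideanSpace ℝ (Fin m) → G}
    (hf : AEStronglyMeasurable f (volume.restrict Ω)) :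
    AEStronglyMeasurable (fun x => f (Φ x)) (volume.restrict Ω) :=
  (hf.mono_ac h.map_absolutelyContinuous).comp_aemeasurable h.aemeasurable

lemma integrableOn_jac_smul_comp {f : EuclideanSpace ℝ (Fin m) → F}
    (hf : LocallyIntegrableOn f Ω) {K : Set (EuclideanSpace ℝ (Fin m))} (hK : IsCompact K)
    (hKΩ : K ⊆ Ω) : IntegrableOn (fun x => jac Φ x • f (Φ x)) K := by
  obtain ⟨K', hK', hKc', hΦ⟩ := h.exists_isCompact K hKΩ hK
  rw [← h.integrableOn_image hK.measurableSet]
  exact (hf.integrableOn_compact_subset hK' hKc').mono_set hΦ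

/-- A function on `Ω` is locally integrable if it is dominated by the product of the Jacobian and of
a locally integrable function composed with `Φ`. -/
lemma locallyIntegrableOn_of_le {G : Type*} [NormedAddCommGroup G] {f : EuclideanSpace ℝ (Fin m) → F}
    (hf : LocallyIntegrableOn f Ω) {g : EuclideanSpace ℝ (Fin m) → G}
    (hg : AEStronglyMeasurable g (volume.restrict Ω)) {C : ℝ}
    (hgf : ∀ x ∈ Ω \ Z, ‖g x‖ ≤ C * (jac Φ x * ‖f (Φ x)‖)) : LocallyIntegrableOn g Ω := by
  rw [locallyIntegrableOn_iff h.isOpen.isLocallyClosed]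
  intro K hKΩ hK
  have h1 := (h.integrableOn_jac_smul_comp hf hK hKΩ).norm.const_mul C
  refine Integrable.mono' h1 (hg.mono_measure (Measure.restrict_mono hKΩ le_rfl)) ?_
  filter_upwards [ae_restrict_of_ae h.ae_notMem, ae_restrict_mem hK.measurableSet] with x hx hxK
  refine (hgf x ⟨hKΩ hxK, hx⟩).trans_eq ?_
  rw [norm_smul, Real.norm_of_nonneg (h.jac_pos hx).le]

lemma locallyIntegrableOn_comp {f : EuclideanSpace ℝ (Fin m) → F}
    (hf : LocallyIntegrableOn f Ω) : LocallyIntegrableOn (fun x => f (Φ x)) Ω := by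
  obtain ⟨c, hc, hj⟩ := h.exists_le_jac
  refine h.locallyIntegrableOn_of_le hf
    (h.aestronglyMeasurable_comp hf.aestronglyMeasurable) (C := c⁻¹) ?_
  intro x hx
  rw [← mul_assoc]
  refine le_mul_of_one_le_left (norm_nonneg _) ?_
  rw [inv_mul_eq_div, one_le_div hc]
  exact hj x hx.2

/-- Test functions supported off the singular set can be pushed forward by `Φ`: the composition with
the inverse of `Φ` is smooth by the inverse function theorem, and is a test function on `Ω`. -/
lemma exists_pushforward {τ : EuclideanSpace ℝ (Fin m) → ℝ} (hτ : ContDiff ℝ ∞ τ)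
    (hτc : HasCompactSupport τ) (hτs : tsupport τ ⊆ Ω \ Z) :
    ∃ T : EuclideanSpace ℝ (Fin m) → ℝ, ContDiff ℝ ∞ T ∧ HasCompactSupport T ∧ tsupport T ⊆ Ω ∧
      ∀ (ν : ℕ) (f : EuclideanSpace ℝ (Fin m) → EuclideanSpace ℝ (Fin ν)),
        ∫ y in Ω, T y • f y = ∫ x in Ω, (jac Φ x * τ x) • f (Φ x) := by
  classical
  set T : EuclideanSpace ℝ (Fin m) → ℝ := fun y =>
    if hy : ∃ x, x ∉ Z ∧ Φ x = y then τ hy.choose else 0 with hT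
  have hTΦ : ∀ x ∉ Z, T (Φ x) = τ x := by
    intro x hx
    have hy : ∃ x', x' ∉ Z ∧ Φ x' = Φ x := ⟨x, hx, rfl⟩
    simp only [hT, dif_pos hy]
    rw [h.injOn hy.choose_spec.1 hx hy.choose_spec.2]
  have hcomp : IsCompact (Φ '' tsupport τ) := by
    refine IsCompact.image_of_continuousOn hτc (h.continuousOn.mono fun x hx => (hτs hx).2)
  have hsupp : Function.support T ⊆ Φ '' tsupport τ := by
    intro y hy
    by_cases hyx : ∃ x, x ∉ Z ∧ Φ x = y
    · obtain ⟨x, hx, rfl⟩ := hyx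
      rw [Function.mem_support, hTΦ x hx] at hy
      exact ⟨x, subset_tsupport _ hy, rfl⟩
    · simp [hT, hyx] at hy
  have hts : tsupport T ⊆ Φ '' tsupport τ := closure_minimal hsupp hcomp.isClosed
  have hΦΩ : Φ '' tsupport τ ⊆ Ω := image_subset_iff.2 fun x hx => h.mem (hτs hx)
  refine ⟨T, contDiff_iff_contDiffAt.2 fun y => ?_, hcomp.of_isClosed_subset (isClosed_tsupport _) hts,
    hts.trans hΦΩ, fun ν f => ?_⟩
  · by_cases hy : y ∈ Φ '' tsupport τ
    -- near a point of the image of the support, `T` is `τ` composed with the local inverse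
    · obtain ⟨x, hx, rfl⟩ := hy
      have hxZ := (hτs hx).2
      have hdet : (fderiv ℝ Φ x).det ≠ 0 := abs_pos.1 (h.jac_pos hxZ)
      set e := (fderiv ℝ Φ x).toContinuousLinearEquivOfDetNeZero hdet with he
      have hfe : HasFDerivAt Φ (e : _ →L[ℝ] _) x := by
        rw [he, ContinuousLinearMap.coe_toContinuousLinearEquivOfDetNeZero]
        exact h.hasFDerivAt hxZ
      have hn : (∞ : WithTop ℕ∞) ≠ 0 := by simp
      have hinv := (h.contDiffAt x hxZ).to_localInverse hfe hn
      have hl0 : (h.contDiffAt x hxZ).localInverse hfe hn (Φ x) = x :=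
        (h.contDiffAt x hxZ).localInverse_apply_image hfe hn
      have hev : ∀ᶠ z in nhds (Φ x), Φ ((h.contDiffAt x hxZ).localInverse hfe hn z) = z :=
        ((h.contDiffAt x hxZ).hasStrictFDerivAt' hfe hn).eventually_right_inverse
      have hev2 : ∀ᶠ z in nhds (Φ x), (h.contDiffAt x hxZ).localInverse hfe hn z ∉ Z :=
        hinv.continuousAt.eventually (by rw [hl0]; exact h.isClosed.isOpen_compl.mem_nhds hxZ)
      have h3 : ContDiffAt ℝ ∞ (fun z => τ ((h.contDiffAt x hxZ).localInverse hfe hn z)) (Φ x) :=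
        hτ.contDiffAt.comp _ hinv
      refine h3.congr_of_eventuallyEq ?_
      filter_upwards [hev, hev2] with z hz hz2
      nth_rw 1 [← hz]
      exact hTΦ _ hz2
    · refine contDiffAt_const (c := (0 : ℝ)).congr_of_eventuallyEq ?_
      exact notMem_tsupport_iff_eventuallyEq.1 fun hcon => hy (hts hcon)
  · have h1 : ∫ y in Ω, T y • f y = ∫ y in Φ '' (Ω \ Z), T y • f y := by
      refine setIntegral_eq_of_subset_of_forall_sdiff_eq_zero h.isOpen.measurableSet
        (image_subset_iff.2 fun x hx => h.mem hx) fun y hy => ?_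
      have : T y = 0 := by
        by_contra hcon
        exact hy.2 (image_mono hτs (hsupp hcon))
      rw [this, zero_smul]
    rw [h1, h.integral_image h.isOpen.measurableSet]
    refine setIntegral_congr_ae h.isOpen.measurableSet ?_
    filter_upwards [h.ae_notMem] with x hx _
    rw [hTΦ x hx, smul_smul]

end IsSingularDiffeo

end ChangeOfVariables

/-! ### The chain rule for weak derivatives -/

section ChainRule

variable {m : ℕ} {Z Ω : Set (EuclideanSpace ℝ (Fin m))}
  {Φ : EuclideanSpace ℝ (Fin m) → EuclideanSpace ℝ (Fin m)}

/-- The derivative of order `j` of `u ∘ Φ` given by the formula of Faà di Bruno, when `D i` is the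
derivative of order `i` of `u`. -/
noncomputable def pullDeriv {F : Type*} [NormedAddCommGroup F] [NormedSpace ℝ F]
    (Φ : EuclideanSpace ℝ (Fin m) → EuclideanSpace ℝ (Fin m))
    (D : (i : ℕ) → EuclideanSpace ℝ (Fin m) → (EuclideanSpace ℝ (Fin m) [×i]→L[ℝ] F)) (j : ℕ)
    (x : EuclideanSpace ℝ (Fin m)) : EuclideanSpace ℝ (Fin m) [×j]→L[ℝ] F :=
  FormalMultilinearSeries.taylorComp (𝕜 := ℝ) (fun i => D i (Φ x)) (ftaylorSeries ℝ Φ x) j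

variable {F : Type*} [NormedAddCommGroup F] [NormedSpace ℝ F]
  {D : (i : ℕ) → EuclideanSpace ℝ (Fin m) → (EuclideanSpace ℝ (Fin m) [×i]→L[ℝ] F)}

lemma pullDeriv_eq_sum (j : ℕ) (x : EuclideanSpace ℝ (Fin m)) : pullDeriv Φ D j x =
    ∑ c : OrderedFinpartition j, c.compAlongOrderedFinpartition (D c.length (Φ x))
      fun r => iteratedFDeriv ℝ (c.partSize r) Φ x := rfl

lemma pullDeriv_eq_iteratedFDeriv {w : EuclideanSpace ℝ (Fin m) → F} (hw : ContDiff ℝ ∞ w)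
    {x : EuclideanSpace ℝ (Fin m)} (hΦ : ContDiffAt ℝ ∞ Φ x) (j : ℕ) :
    pullDeriv Φ (fun i => iteratedFDeriv ℝ i w) j x = iteratedFDeriv ℝ j (w ∘ Φ) x :=
  (iteratedFDeriv_comp (hw.contDiffAt) hΦ (by exact_mod_cast le_top)).symm

lemma OrderedFinpartition_sum_partSize {n : ℕ} (c : OrderedFinpartition n) :
    ∑ r, c.partSize r = n := by
  have h := OrderedFinpartition_prod_pow c 2
  rw [Finset.prod_pow_eq_pow_sum] at h
  exact Nat.pow_right_injective le_rfl (by exact_mod_cast h)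

/-- The weak derivative of order `j` of the composition is controlled by the Jacobian as soon as the
derivatives of `Φ` are. -/
lemma norm_pullDeriv_le {η M J r : ℝ} (hη : 0 < η) (hM : 1 ≤ M) (hJ : 0 < J)
    {j : ℕ} (hj : 1 ≤ j) {x : EuclideanSpace ℝ (Fin m)}
    (hΦ : ∀ i ∈ Finset.Icc 1 j, η ^ (i - 1) * ‖iteratedFDeriv ℝ i Φ x‖ ≤ M * J ^ ((i : ℝ) / r)) :
    η ^ j * ‖pullDeriv Φ D j x‖ ≤ (Fintype.card (OrderedFinpartition j) * M ^ j) *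
      (J ^ ((j : ℝ) / r) * ∑ i ∈ Finset.Icc 1 j, η ^ i * ‖D i (Φ x)‖) := by
  have hterm : ∀ c : OrderedFinpartition j, η ^ j * (‖D c.length (Φ x)‖ *
      ∏ s, ‖iteratedFDeriv ℝ (c.partSize s) Φ x‖) ≤
      M ^ j * (J ^ ((j : ℝ) / r) * ∑ i ∈ Finset.Icc 1 j, η ^ i * ‖D i (Φ x)‖) := by
    intro c
    have hsum := OrderedFinpartition_sum_partSize c
    have hlen : c.length ≤ j := c.length_le
    have hlen1 : 1 ≤ c.length := c.length_pos (by omega)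
    have hexp : ∑ s, (c.partSize s - 1) + c.length = j := by
      have h1 : ∑ s, (c.partSize s - 1 + 1) = j :=
        (Finset.sum_congr rfl fun s _ => Nat.sub_add_cancel (c.partSize_pos s)).trans hsum
      rw [Finset.sum_add_distrib] at h1
      simpa using h1
    have hprod : (∏ s, η ^ (c.partSize s - 1)) * ∏ s, ‖iteratedFDeriv ℝ (c.partSize s) Φ x‖ ≤
        M ^ j * J ^ ((j : ℝ) / r) := by
      rw [← Finset.prod_mul_distrib]
      calc ∏ s, η ^ (c.partSize s - 1) * ‖iteratedFDeriv ℝ (c.partSize s) Φ x‖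
          ≤ ∏ s, M * J ^ ((c.partSize s : ℝ) / r) := by
            refine Finset.prod_le_prod (fun s _ => by positivity) fun s _ => hΦ _ ?_
            exact Finset.mem_Icc.2 ⟨c.partSize_pos s, c.partSize_le s⟩
        _ = M ^ c.length * J ^ ((j : ℝ) / r) := by
            rw [Finset.prod_mul_distrib, ← Real.rpow_sum_of_pos hJ, ← Finset.sum_div]
            simp only [Finset.prod_const, Finset.card_univ, Fintype.card_fin]
            congr 3
            exact_mod_cast hsum
        _ ≤ M ^ j * J ^ ((j : ℝ) / r) := by gcongr
    have hD : η ^ c.length * ‖D c.length (Φ x)‖ ≤ ∑ i ∈ Finset.Icc 1 j, η ^ i * ‖D i (Φ x)‖ :=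
      Finset.single_le_sum (f := fun i => η ^ i * ‖D i (Φ x)‖) (fun i _ => by positivity)
        (Finset.mem_Icc.2 ⟨hlen1, hlen⟩)
    calc η ^ j * (‖D c.length (Φ x)‖ * ∏ s, ‖iteratedFDeriv ℝ (c.partSize s) Φ x‖)
        = (η ^ c.length * ‖D c.length (Φ x)‖) * ((∏ s, η ^ (c.partSize s - 1)) *
            ∏ s, ‖iteratedFDeriv ℝ (c.partSize s) Φ x‖) := by
          rw [Finset.prod_pow_eq_pow_sum]
          nth_rw 1 [← hexp]
          rw [pow_add]; ring
      _ ≤ (∑ i ∈ Finset.Icc 1 j, η ^ i * ‖D i (Φ x)‖) * (M ^ j * J ^ ((j : ℝ) / r)) := by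
          gcongr
      _ = _ := by ring
  have h1 := norm_taylorComp_le (fun i => D i (Φ x)) (ftaylorSeries ℝ Φ x) j
  calc η ^ j * ‖pullDeriv Φ D j x‖ ≤ η ^ j * ∑ c : OrderedFinpartition j,
        ‖D c.length (Φ x)‖ * ∏ s, ‖iteratedFDeriv ℝ (c.partSize s) Φ x‖ := by
        gcongr; exact h1
    _ ≤ ∑ _c : OrderedFinpartition j,
        M ^ j * (J ^ ((j : ℝ) / r) * ∑ i ∈ Finset.Icc 1 j, η ^ i * ‖D i (Φ x)‖) := by
        rw [Finset.mul_sum]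
        exact Finset.sum_le_sum fun c _ => hterm c
    _ = _ := by rw [Finset.sum_const, nsmul_eq_mul, Finset.card_univ]; ring

lemma continuous_compAlongOrderedFinpartition {j : ℕ} (c : OrderedFinpartition j) :
    Continuous fun p : (EuclideanSpace ℝ (Fin m) [×c.length]→L[ℝ] F) ×
      ((r : Fin c.length) → (EuclideanSpace ℝ (Fin m) [×c.partSize r]→L[ℝ] EuclideanSpace ℝ (Fin m))) =>
      c.compAlongOrderedFinpartition p.1 p.2 := by
  have h : (fun p : (EuclideanSpace ℝ (Fin m) [×c.length]→L[ℝ] F) ×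
      ((r : Fin c.length) → (EuclideanSpace ℝ (Fin m) [×c.partSize r]→L[ℝ] EuclideanSpace ℝ (Fin m))) =>
      c.compAlongOrderedFinpartition p.1 p.2) = fun p =>
      c.compAlongOrderedFinpartitionL ℝ (EuclideanSpace ℝ (Fin m)) (EuclideanSpace ℝ (Fin m)) F
        p.1 p.2 := rfl
  rw [h]
  fun_prop

lemma IsSingularDiffeo.aestronglyMeasurable_pullDeriv (h : IsSingularDiffeo Z Ω Φ) {j : ℕ}
    (hj : 1 ≤ j)
    (hD : ∀ i ∈ Finset.Icc 1 j, AEStronglyMeasurable (D i) (volume.restrict Ω)) :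
    AEStronglyMeasurable (pullDeriv Φ D j) (volume.restrict Ω) := by
  have h0 : pullDeriv Φ D j = fun x => ∑ c : OrderedFinpartition j,
      c.compAlongOrderedFinpartition (D c.length (Φ x))
        fun r => iteratedFDeriv ℝ (c.partSize r) Φ x := funext fun x => pullDeriv_eq_sum j x
  rw [h0]
  refine Finset.aestronglyMeasurable_fun_sum _ fun c _ => ?_
  refine (continuous_compAlongOrderedFinpartition c).comp_aestronglyMeasurable
    (AEStronglyMeasurable.prodMk (h.aestronglyMeasurable_comp (hD c.length ?_)) ?_)
  · exact Finset.mem_Icc.2 ⟨c.length_pos (by omega), c.length_le⟩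
  · rw [← h.restrict_diff]
    have : SecondCountableTopologyEither (EuclideanSpace ℝ (Fin m)) ((r : Fin c.length) →
      (EuclideanSpace ℝ (Fin m) [×c.partSize r]→L[ℝ] EuclideanSpace ℝ (Fin m))) :=
      ⟨Or.inl inferInstance⟩
    refine ContinuousOn.aestronglyMeasurable ?_
      (h.isOpen.measurableSet.diff h.isClosed.measurableSet)
    refine continuousOn_pi.2 fun r x hx => ?_
    exact ((h.contDiffAt x hx.2).iteratedFDeriv_right (m := 0)
      (by rw [zero_add]; exact_mod_cast le_top)).continuousAt.continuousWithinAt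

/-- The coefficients of the formula of Faà di Bruno in the canonical basis. -/
noncomputable def pullCoeff (Φ : EuclideanSpace ℝ (Fin m) → EuclideanSpace ℝ (Fin m)) {j : ℕ}
    (v : Fin j → EuclideanSpace ℝ (Fin m)) (c : OrderedFinpartition j) (α : Fin c.length → Fin m)
    (x : EuclideanSpace ℝ (Fin m)) : ℝ :=
  ∏ r, iteratedFDeriv ℝ (c.partSize r) Φ x (v ∘ c.emb r) (α r)

lemma pullDeriv_apply {j : ℕ} (v : Fin j → EuclideanSpace ℝ (Fin m))
    (x : EuclideanSpace ℝ (Fin m)) : pullDeriv Φ D j x v =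
      ∑ c : OrderedFinpartition j, ∑ α : Fin c.length → Fin m,
        pullCoeff Φ v c α x • D c.length (Φ x) (fun r => EuclideanSpace.single (α r) 1) := by
  rw [pullDeriv_eq_sum, sum_apply]
  refine Finset.sum_congr rfl fun c _ => ?_
  rw [OrderedFinpartition.compAlongOrderFinpartition_apply,
    OrderedFinpartition.applyOrderedFinpartition_apply]
  have h1 : (fun r => iteratedFDeriv ℝ (c.partSize r) Φ x (v ∘ c.emb r)) = fun r =>
      ∑ i, iteratedFDeriv ℝ (c.partSize r) Φ x (v ∘ c.emb r) i • EuclideanSpace.single i (1 : ℝ) :=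
    funext fun r => euclidean_eq_sum _
  rw [h1, ContinuousMultilinearMap.map_sum]
  refine Finset.sum_congr rfl fun α _ => ?_
  rw [ContinuousMultilinearMap.map_smul_univ]
  rfl

lemma contDiffAt_pullCoeff {j : ℕ} (v : Fin j → EuclideanSpace ℝ (Fin m))
    (c : OrderedFinpartition j) (α : Fin c.length → Fin m) {x : EuclideanSpace ℝ (Fin m)}
    (hΦ : ContDiffAt ℝ ∞ Φ x) : ContDiffAt ℝ ∞ (pullCoeff Φ v c α) x := by
  refine contDiffAt_prod fun r _ => ?_
  have h := ContDiffAt.iteratedFDeriv_apply hΦ (v ∘ c.emb r)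
  exact contDiffAt_euclidean.1 h (α r)

lemma IsSingularDiffeo.contDiffAt_inv_jac (h : IsSingularDiffeo Z Ω Φ)
    {x : EuclideanSpace ℝ (Fin m)} (hx : x ∉ Z) : ContDiffAt ℝ ∞ (fun y => (jac Φ y)⁻¹) x := by
  have h1 : ContDiffAt ℝ ∞ (fun y => (fderiv ℝ Φ y).det) x := by
    have h2 : ContDiffAt ℝ ∞ (fderiv ℝ Φ) x :=
      (h.contDiffAt x hx).fderiv_right (by exact_mod_cast le_top)
    have h3 : (fun y => (fderiv ℝ Φ y).det) = fun y => (Matrix.of fun i j : Fin m =>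
        (fderiv ℝ Φ y (EuclideanSpace.single j 1)) i).det := by
      funext y
      rw [ContinuousLinearMap.det,
        ← LinearMap.det_toMatrix (EuclideanSpace.basisFun (Fin m) ℝ).toBasis]
      congr 1
    rw [h3]
    simp_rw [Matrix.det_apply]
    refine ContDiffAt.sum fun σ _ => ContDiffAt.const_smul _ (contDiffAt_prod fun i _ => ?_)
    exact contDiffAt_euclidean.1 (h2.clm_apply contDiffAt_const) _
  have hd : (fderiv ℝ Φ x).det ≠ 0 := abs_pos.1 (h.jac_pos hx)
  exact ((contDiffAt_abs hd).comp x h1).inv (h.jac_pos hx).ne'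

end ChainRule

/-! ### The weak chain rule off the singular set -/

section WeakChainRule

variable {m : ℕ} {Z Ω : Set (EuclideanSpace ℝ (Fin m))}
  {Φ : EuclideanSpace ℝ (Fin m) → EuclideanSpace ℝ (Fin m)}

lemma locallyIntegrableOn_apply {F : Type*} [NormedAddCommGroup F] [NormedSpace ℝ F] {i : ℕ}
    {g : EuclideanSpace ℝ (Fin m) → (EuclideanSpace ℝ (Fin m) [×i]→L[ℝ] F)}
    (hg : LocallyIntegrableOn g Ω) (v : Fin i → EuclideanSpace ℝ (Fin m)) :
    LocallyIntegrableOn (fun x => g x v) Ω := fun x hx => by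
  obtain ⟨s, hs, hi⟩ := hg x hx
  exact ⟨s, hs, (ContinuousMultilinearMap.apply ℝ (fun _ : Fin i => EuclideanSpace ℝ (Fin m))
    F v).integrable_comp hi⟩

lemma tsupport_mul_subset_tsupport {X : Type*} [TopologicalSpace X] (f g : X → ℝ) :
    tsupport (fun x => f x * g x) ⊆ tsupport f :=
  closure_mono fun _ hx => left_ne_zero_of_mul hx

/-- Integration against a test function supported off the singular set is transported by `Φ` to
integration against test functions which depend on neither `u` nor its weak derivatives. -/
lemma IsSingularDiffeo.exists_transport (h : IsSingularDiffeo Z Ω Φ) {j : ℕ} (hj : 1 ≤ j)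
    {ψ : EuclideanSpace ℝ (Fin m) → ℝ} (hψ : ContDiff ℝ ∞ ψ) (hψc : HasCompactSupport ψ)
    (hψs : tsupport ψ ⊆ Ω \ Z) (v : Fin j → EuclideanSpace ℝ (Fin m)) :
    ∃ G : EuclideanSpace ℝ (Fin m) → ℝ, Continuous G ∧ HasCompactSupport G ∧ tsupport G ⊆ Ω ∧
      ∀ (ν : ℕ) (u : EuclideanSpace ℝ (Fin m) → EuclideanSpace ℝ (Fin ν))
        (D : (i : ℕ) → EuclideanSpace ℝ (Fin m) →
          (EuclideanSpace ℝ (Fin m) [×i]→L[ℝ] EuclideanSpace ℝ (Fin ν))),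
        (∀ i ∈ Finset.Icc 1 j, IsWeakDeriv i u (D i) Ω) →
        ∫ x in Ω, ψ x • pullDeriv Φ D j x v = ∫ y in Ω, G y • u y := by
  classical
  have hτ : ∀ (c : OrderedFinpartition j) (α : Fin c.length → Fin m),
      ∃ T : EuclideanSpace ℝ (Fin m) → ℝ, ContDiff ℝ ∞ T ∧ HasCompactSupport T ∧ tsupport T ⊆ Ω ∧
      ∀ (ν : ℕ) (f : EuclideanSpace ℝ (Fin m) → EuclideanSpace ℝ (Fin ν)),
        ∫ y in Ω, T y • f y =
          ∫ x in Ω, (jac Φ x * (ψ x * (pullCoeff Φ v c α x * (jac Φ x)⁻¹))) • f (Φ x) := by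
    intro c α
    have hs := tsupport_mul_subset_tsupport ψ fun x => pullCoeff Φ v c α x * (jac Φ x)⁻¹
    refine h.exists_pushforward (contDiff_mul_of_contDiffAt hψ fun x hx => ?_)
      (hψc.of_isClosed_subset (isClosed_tsupport _) hs) (hs.trans hψs)
    exact (contDiffAt_pullCoeff v c α (h.contDiffAt x (hψs hx).2)).mul
      (h.contDiffAt_inv_jac (hψs hx).2)
  -- `T c α` is the push-forward of the coefficient, divided by the Jacobian, of one of the partial
  -- derivatives of `u` in the formula of Faà di Bruno
  choose T hT hTc hTs hTi using hτ
  set E : (c : OrderedFinpartition j) → (Fin c.length → Fin m) → Fin c.length →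
    EuclideanSpace ℝ (Fin m) := fun c α r => EuclideanSpace.single (α r) 1 with hE
  set G : EuclideanSpace ℝ (Fin m) → ℝ := fun y => ∑ c : OrderedFinpartition j,
    ∑ α : Fin c.length → Fin m, (-1 : ℝ) ^ c.length * iteratedFDeriv ℝ c.length (T c α) y (E c α)
    with hG
  have hGd : Continuous G := by
    refine continuous_finsetSum _ fun c _ => continuous_finsetSum _ fun α _ => ?_
    exact continuous_const.mul (ContDiff.iteratedFDeriv_apply (hT c α) _).continuous
  have hGs : Function.support G ⊆ ⋃ c : OrderedFinpartition j, ⋃ α : Fin c.length → Fin m,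
      tsupport (T c α) := by
    intro y hy
    by_contra hcon
    simp only [mem_iUnion, not_exists] at hcon
    refine hy (Finset.sum_eq_zero fun c _ => Finset.sum_eq_zero fun α _ => ?_)
    rw [show iteratedFDeriv ℝ c.length (T c α) y (E c α) = 0 from
      image_eq_zero_of_notMem_tsupport (f := fun y => iteratedFDeriv ℝ c.length (T c α) y (E c α))
        fun hh => hcon c α (tsupport_iteratedFDeriv_apply_subset _ _ hh), mul_zero]
  have hKc : IsCompact (⋃ c : OrderedFinpartition j, ⋃ α : Fin c.length → Fin m,
      tsupport (T c α)) := isCompact_iUnion fun c => isCompact_iUnion fun α => hTc c α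
  have hGt := closure_minimal hGs hKc.isClosed
  refine ⟨G, hGd, hKc.of_isClosed_subset (isClosed_tsupport _) hGt,
    hGt.trans (iUnion_subset fun c => iUnion_subset fun α => hTs c α), fun ν u D hD => ?_⟩
  have hmem : ∀ c : OrderedFinpartition j, c.length ∈ Finset.Icc 1 j := fun c =>
    Finset.mem_Icc.2 ⟨c.length_pos (by omega), c.length_le⟩
  have hjj : 1 ∈ Finset.Icc 1 j := Finset.mem_Icc.2 ⟨le_rfl, hj⟩
  have hu := (hD 1 hjj).locallyIntegrableOn
  -- the integrand in terms of the coefficients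
  have h1 : ∀ᵐ x ∂(volume.restrict Ω), ψ x • pullDeriv Φ D j x v =
      ∑ c : OrderedFinpartition j, ∑ α : Fin c.length → Fin m,
        (jac Φ x * (ψ x * (pullCoeff Φ v c α x * (jac Φ x)⁻¹))) •
          D c.length (Φ x) (E c α) := by
    filter_upwards [ae_restrict_of_ae h.ae_notMem] with x hx
    have hjx := (h.jac_pos hx).ne'
    rw [pullDeriv_apply, Finset.smul_sum]
    refine Finset.sum_congr rfl fun c _ => ?_
    rw [Finset.smul_sum]
    refine Finset.sum_congr rfl fun α _ => ?_
    rw [smul_smul]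
    congr 1
    field_simp
  have h2 : ∀ (c : OrderedFinpartition j) (α : Fin c.length → Fin m), Integrable (fun x =>
      (jac Φ x * (ψ x * (pullCoeff Φ v c α x * (jac Φ x)⁻¹))) • D c.length (Φ x) (E c α))
      (volume.restrict Ω) := by
    intro c α
    have hs := tsupport_mul_subset_tsupport ψ fun x => pullCoeff Φ v c α x * (jac Φ x)⁻¹
    have h3 := h.integrableOn_jac_smul_comp (locallyIntegrableOn_apply
      (hD _ (hmem c)).locallyIntegrableOn_deriv (E c α)) hψc (hψs.trans sdiff_subset)
    have h4 := integrableOn_smul_of_tsupport_subset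
      (contDiff_mul_of_contDiffAt hψ (g := fun x => pullCoeff Φ v c α x * (jac Φ x)⁻¹)
        fun x hx => (contDiffAt_pullCoeff v c α (h.contDiffAt x (hψs hx).2)).mul
          (h.contDiffAt_inv_jac (hψs hx).2)).continuous
      (hψc.of_isClosed_subset (isClosed_tsupport _) hs) (h3.mono_set hs)
    refine (h4.mono_measure Measure.restrict_le_self).congr (Filter.Eventually.of_forall fun x => ?_)
    simp only [smul_smul]
    congr 1
    ring
  have h5 : ∀ (c : OrderedFinpartition j) (α : Fin c.length → Fin m), Integrable (fun y =>
      ((-1 : ℝ) ^ c.length * iteratedFDeriv ℝ c.length (T c α) y (E c α)) • u y)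
      (volume.restrict Ω) := by
    intro c α
    have h6 := integrableOn_smul_of_tsupport_subset
      (ContDiff.iteratedFDeriv_apply (hT c α) (E c α)).continuous
      (HasCompactSupport.iteratedFDeriv_apply (hTc c α) (E c α))
      (hu.integrableOn_compact_subset ((tsupport_iteratedFDeriv_apply_subset _ _).trans (hTs c α))
        (HasCompactSupport.iteratedFDeriv_apply (hTc c α) (E c α)))
    simp_rw [mul_smul]
    exact (h6.mono_measure Measure.restrict_le_self).smul ((-1 : ℝ) ^ c.length)
  rw [integral_congr_ae h1, integral_finsetSum _ fun c _ => integrable_finsetSum _ fun α _ => h2 c α]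
  simp only [hG, Finset.sum_smul]
  rw [integral_finsetSum _ fun c _ => integrable_finsetSum _ fun α _ => h5 c α]
  refine Finset.sum_congr rfl fun c _ => ?_
  rw [integral_finsetSum _ fun α _ => h2 c α, integral_finsetSum _ fun α _ => h5 c α]
  refine Finset.sum_congr rfl fun α _ => ?_
  rw [← hTi c α ν fun y => D c.length y (E c α),
    (hD _ (hmem c)).integral_eq (T c α) (hT c α) (hTc c α) (hTs c α) (E c α), ← integral_smul]
  simp_rw [smul_smul]

/-- The weak chain rule against test functions supported off the singular set. It holds for smooth
functions, and both sides only involve `u` through integrals against test functions. -/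
lemma IsSingularDiffeo.integral_pullDeriv_of_tsupport_subset (h : IsSingularDiffeo Z Ω Φ) {j : ℕ}
    (hj : 1 ≤ j) {ψ : EuclideanSpace ℝ (Fin m) → ℝ} (hψ : ContDiff ℝ ∞ ψ)
    (hψc : HasCompactSupport ψ) (hψs : tsupport ψ ⊆ Ω \ Z)
    (v : Fin j → EuclideanSpace ℝ (Fin m)) {ν : ℕ}
    {u : EuclideanSpace ℝ (Fin m) → EuclideanSpace ℝ (Fin ν)}
    {D : (i : ℕ) → EuclideanSpace ℝ (Fin m) →
          (EuclideanSpace ℝ (Fin m) [×i]→L[ℝ] EuclideanSpace ℝ (Fin ν))}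
    (hD : ∀ i ∈ Finset.Icc 1 j, IsWeakDeriv i u (D i) Ω) :
    ∫ x in Ω, ψ x • pullDeriv Φ D j x v =
      (-1 : ℝ) ^ j • ∫ x in Ω, iteratedFDeriv ℝ j ψ x v • u (Φ x) := by
  obtain ⟨G, hG, hGc, hGs, hGi⟩ := h.exists_transport hj hψ hψc hψs v
  have hs := tsupport_mul_subset_tsupport (fun x => iteratedFDeriv ℝ j ψ x v)
    fun x => (jac Φ x)⁻¹
  have hs' := tsupport_iteratedFDeriv_apply_subset ψ v
  have hcI := HasCompactSupport.iteratedFDeriv_apply hψc v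
  obtain ⟨T, hT, hTc, hTs, hTi⟩ := h.exists_pushforward
    (contDiff_mul_of_contDiffAt (ContDiff.iteratedFDeriv_apply hψ v) fun x hx =>
      h.contDiffAt_inv_jac (hψs (hs' hx)).2)
    (hcI.of_isClosed_subset (isClosed_tsupport _) hs) (hs.trans (hs'.trans hψs))
  have hT' : ∀ (ν : ℕ) (u : EuclideanSpace ℝ (Fin m) → EuclideanSpace ℝ (Fin ν)),
      ∫ x in Ω, iteratedFDeriv ℝ j ψ x v • u (Φ x) = ∫ y in Ω, T y • u y := by
    intro ν u
    rw [hTi]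
    refine integral_congr_ae ?_
    filter_upwards [ae_restrict_of_ae h.ae_notMem] with x hx
    have hjx := (h.jac_pos hx).ne'
    congr 1
    field_simp
  have hzero : ∀ f : EuclideanSpace ℝ (Fin m) → ℝ, tsupport f ⊆ Ω → ∀ (ν : ℕ)
      (w : EuclideanSpace ℝ (Fin m) → EuclideanSpace ℝ (Fin ν)),
      ∫ y in Ω, f y • w y = ∫ y, f y • w y := fun f hf ν w =>
    setIntegral_eq_integral_of_forall_compl_eq_zero fun y hy => by
      rw [image_eq_zero_of_notMem_tsupport fun hh => hy (hf hh), zero_smul]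
  -- the identity holds for smooth scalar functions, so the two test functions agree
  have hGT : ∀ᵐ y, G y = (-1 : ℝ) ^ j * T y := by
    have hGint : LocallyIntegrable G := hG.locallyIntegrable
    have hTint : LocallyIntegrable fun y => (-1 : ℝ) ^ j * T y :=
      (continuous_const.mul hT.continuous).locallyIntegrable
    refine ae_eq_of_integral_contDiff_smul_eq hGint hTint fun w hw hwc => ?_
    set e : EuclideanSpace ℝ (Fin 1) := EuclideanSpace.single 0 1 with he
    have hwe : ContDiff ℝ ∞ fun y => w y • e := hw.smul contDiff_const
    have h1 := hGi 1 (fun y => w y • e) (fun i => iteratedFDeriv ℝ i fun y => w y • e)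
      fun i _ => isWeakDeriv_of_contDiff hwe i
    have h2 : ∫ x in Ω, ψ x • pullDeriv Φ (fun i => iteratedFDeriv ℝ i fun y => w y • e) j x v =
        (-1 : ℝ) ^ j • ∫ x in Ω, iteratedFDeriv ℝ j ψ x v • (w (Φ x) • e) := by
      have h3 := integral_smul_iteratedFDeriv (μ := volume) hψ hψc
        (g := (fun y => w y • e) ∘ Φ)
        (fun x hx => hwe.contDiffAt.comp x (h.contDiffAt x (hψs hx).2)) j v
      rw [hzero ψ (hψs.trans sdiff_subset), hzero _ ((hs'.trans hψs).trans sdiff_subset)]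
      refine Eq.trans (integral_congr_ae ?_) h3
      filter_upwards [h.ae_notMem] with x hx
      rw [pullDeriv_eq_iteratedFDeriv hwe (h.contDiffAt x hx)]
    rw [h2, hT' 1 fun y => w y • e, hzero T hTs, hzero G hGs] at h1
    have h4 : ∀ f : EuclideanSpace ℝ (Fin m) → ℝ,
        ∫ y, f y • (w y • e) = (∫ y, f y * w y) • e := fun f => by
      rw [← integral_smul_const]
      simp_rw [smul_smul]
    rw [h4, h4, smul_smul] at h1
    have h5 := congrArg (fun z : EuclideanSpace ℝ (Fin 1) => z 0) h1
    simp [he] at h5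
    simp_rw [smul_eq_mul]
    calc ∫ y, w y * G y = ∫ y, G y * w y := by simp_rw [mul_comm]
      _ = (-1 : ℝ) ^ j * ∫ y, T y * w y := h5.symm
      _ = ∫ y, w y * ((-1 : ℝ) ^ j * T y) := by
        rw [← integral_const_mul]
        exact integral_congr_ae (Filter.Eventually.of_forall fun y => by ring)
  rw [hGi ν u D hD, hT', ← integral_smul]
  refine integral_congr_ae ?_
  filter_upwards [ae_restrict_of_ae hGT] with y hy
  rw [hy, smul_smul]

end WeakChainRule

/-! ### The weak chain rule across the singular set -/

section WeakChainRule

variable {m : ℕ} {Z Ω : Set (EuclideanSpace ℝ (Fin m))}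
  {Φ : EuclideanSpace ℝ (Fin m) → EuclideanSpace ℝ (Fin m)}

/-- Smooth functions which vanish near the closed set `Z`, converge to `1` off `Z`, and have
derivatives of order at most `k` dominated by the Jacobian of `Φ`: they allow test functions to be cut
off near `Z`. -/
structure IsSingularCutoff (Z : Set (EuclideanSpace ℝ (Fin m)))
    (Φ : EuclideanSpace ℝ (Fin m) → EuclideanSpace ℝ (Fin m)) (k : ℕ)
    (ζ : ℕ → EuclideanSpace ℝ (Fin m) → ℝ) : Prop where
  contDiff : ∀ n, ContDiff ℝ ∞ (ζ n)
  eventuallyEq_zero : ∀ n, ∀ x ∈ Z, ζ n =ᶠ[nhds x] fun _ => 0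
  eventuallyEq_one : ∀ x ∉ Z, ∀ᶠ n in Filter.atTop, ζ n =ᶠ[nhds x] fun _ => 1
  abs_le_one : ∀ n x, |ζ n x| ≤ 1
  norm_iteratedFDeriv_le : ∀ i ≤ k, ∃ C, 0 ≤ C ∧ ∀ n, ∀ x ∉ Z,
    ‖iteratedFDeriv ℝ i (ζ n) x‖ ≤ C * jac Φ x

lemma IsSingularCutoff.mono {k j : ℕ} (hjk : j ≤ k) {ζ : ℕ → EuclideanSpace ℝ (Fin m) → ℝ}
    (hζ : IsSingularCutoff Z Φ k ζ) : IsSingularCutoff Z Φ j ζ :=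
  ⟨hζ.contDiff, hζ.eventuallyEq_zero, hζ.eventuallyEq_one, hζ.abs_le_one, fun i hi =>
    hζ.norm_iteratedFDeriv_le i (hi.trans hjk)⟩

lemma IsSingularCutoff.exists_bound_mul {j : ℕ} {ζ : ℕ → EuclideanSpace ℝ (Fin m) → ℝ}
    (hζ : IsSingularCutoff Z Φ j ζ) {φ : EuclideanSpace ℝ (Fin m) → ℝ} (hφ : ContDiff ℝ ∞ φ)
    (hφc : HasCompactSupport φ) : ∃ C, 0 ≤ C ∧ ∀ n, ∀ x ∉ Z,
      ‖iteratedFDeriv ℝ j (fun y => φ y * ζ n y) x‖ ≤ C * jac Φ x := by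
  have h1 : ∀ i, ∃ C, 0 ≤ C ∧ ∀ x, ‖iteratedFDeriv ℝ i φ x‖ ≤ C :=
    exists_bound_iteratedFDeriv_of_hasCompactSupport hφ hφc
  choose A hA hAb using h1
  have h2 : ∀ i, ∃ C, 0 ≤ C ∧ ∀ n, ∀ x ∉ Z, ‖iteratedFDeriv ℝ (j - i) (ζ n) x‖ ≤ C * jac Φ x :=
    fun i => hζ.norm_iteratedFDeriv_le _ (Nat.sub_le j i)
  choose B hB hBb using h2
  refine ⟨∑ i ∈ Finset.range (j + 1), (j.choose i : ℝ) * A i * B i,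
    Finset.sum_nonneg fun i _ => by have := hA i; have := hB i; positivity, fun n x hx => ?_⟩
  refine (norm_iteratedFDeriv_smul_le_of_contDiffAt hφ.contDiffAt (hζ.contDiff n).contDiffAt j).trans ?_
  rw [Finset.sum_mul]
  refine Finset.sum_le_sum fun i _ => ?_
  rw [mul_assoc _ (B i)]
  exact mul_le_mul (mul_le_mul_of_nonneg_left (hAb i x) (Nat.cast_nonneg _)) (hBb i n x hx)
    (norm_nonneg _) (mul_nonneg (Nat.cast_nonneg _) (hA i))

lemma IsSingularDiffeo.locallyIntegrableOn_pullDeriv (h : IsSingularDiffeo Z Ω Φ) {j : ℕ}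
    (hj : 1 ≤ j) (hb : ∃ M : ℝ, ∀ i ∈ Finset.Icc 1 j, ∀ x ∉ Z,
      ‖iteratedFDeriv ℝ i Φ x‖ ≤ M * jac Φ x ^ ((i : ℝ) / j)) {F : Type*} [NormedAddCommGroup F]
    [NormedSpace ℝ F]
    {D : (i : ℕ) → EuclideanSpace ℝ (Fin m) → (EuclideanSpace ℝ (Fin m) [×i]→L[ℝ] F)}
    (hD : ∀ i ∈ Finset.Icc 1 j, LocallyIntegrableOn (D i) Ω) :
    LocallyIntegrableOn (pullDeriv Φ D j) Ω := by
  obtain ⟨M, hM⟩ := hb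
  set M' := max M 1
  have hf : LocallyIntegrableOn (fun y => ∑ i ∈ Finset.Icc 1 j, ‖D i y‖) Ω := by
    rw [locallyIntegrableOn_iff h.isOpen.isLocallyClosed]
    intro K hKΩ hK
    exact integrable_finsetSum _ fun i hi => ((hD i hi).integrableOn_compact_subset hKΩ hK).norm
  refine h.locallyIntegrableOn_of_le hf (h.aestronglyMeasurable_pullDeriv hj fun i hi =>
    (hD i hi).aestronglyMeasurable) (C := Fintype.card (OrderedFinpartition j) * M' ^ j) ?_
  intro x hx
  have hJ := h.jac_pos hx.2
  have h1 := norm_pullDeriv_le (D := D) (Φ := Φ) (η := 1) (M := M') (J := jac Φ x) (r := j) one_pos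
    (le_max_right _ _) hJ hj (x := x) fun i hi => by
      rw [one_pow, one_mul]
      refine (hM i hi x hx.2).trans ?_
      have : 0 ≤ jac Φ x ^ ((i : ℝ) / j) := by positivity
      exact mul_le_mul_of_nonneg_right (le_max_left _ _) this
  simp only [one_pow, one_mul] at h1
  rw [div_self (by positivity), Real.rpow_one] at h1
  rwa [Real.norm_of_nonneg (Finset.sum_nonneg fun i _ => norm_nonneg _)]

/-- The weak chain rule: test functions are cut off near the singular set, and the Jacobian gives a
majorant for the derivatives of the cutoffs. -/
lemma IsSingularDiffeo.isWeakDeriv_pullDeriv (h : IsSingularDiffeo Z Ω Φ) {j : ℕ}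
    (hj : 1 ≤ j) (hb : ∃ M : ℝ, ∀ i ∈ Finset.Icc 1 j, ∀ x ∉ Z,
      ‖iteratedFDeriv ℝ i Φ x‖ ≤ M * jac Φ x ^ ((i : ℝ) / j))
    {ζ : ℕ → EuclideanSpace ℝ (Fin m) → ℝ} (hζ : IsSingularCutoff Z Φ j ζ) {ν : ℕ}
    {u : EuclideanSpace ℝ (Fin m) → EuclideanSpace ℝ (Fin ν)}
    {D : (i : ℕ) → EuclideanSpace ℝ (Fin m) →
          (EuclideanSpace ℝ (Fin m) [×i]→L[ℝ] EuclideanSpace ℝ (Fin ν))}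
    (hD : ∀ i ∈ Finset.Icc 1 j, IsWeakDeriv i u (D i) Ω) :
    IsWeakDeriv j (u ∘ Φ) (pullDeriv Φ D j) Ω := by
  have hu := (hD 1 (Finset.mem_Icc.2 ⟨le_rfl, hj⟩)).locallyIntegrableOn
  have hg := h.locallyIntegrableOn_pullDeriv hj hb (D := D)
    fun i hi => (hD i hi).locallyIntegrableOn_deriv
  refine ⟨h.locallyIntegrableOn_comp hu, hg, fun φ hφ hφc hφs v => ?_⟩
  have hsub : ∀ n, tsupport (fun y => φ y * ζ n y) ⊆ tsupport φ := fun n =>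
    tsupport_mul_subset_tsupport φ (ζ n)
  have hc : ∀ n, HasCompactSupport (fun y => φ y * ζ n y) := fun n =>
    hφc.of_isClosed_subset (isClosed_tsupport _) (hsub n)
  have hd : ∀ n, ContDiff ℝ ∞ (fun y => φ y * ζ n y) := fun n => hφ.mul (hζ.contDiff n)
  have hs : ∀ n, tsupport (fun y => φ y * ζ n y) ⊆ Ω \ Z := fun n x hx => by
    refine ⟨hφs (hsub n hx), fun hxZ => ?_⟩
    refine notMem_tsupport_iff_eventuallyEq.2 ?_ hx
    filter_upwards [hζ.eventuallyEq_zero n x hxZ] with y hy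
    rw [hy]; simp
  have key := fun n => h.integral_pullDeriv_of_tsupport_subset hj (hd n) (hc n) (hs n) v hD
  -- the limit of the left-hand side
  have hgφ : Integrable (fun x => φ x • pullDeriv Φ D j x v) (volume.restrict Ω) :=
    (integrableOn_smul_of_tsupport_subset hφ.continuous hφc
      ((locallyIntegrableOn_apply hg v).integrableOn_compact_subset hφs hφc)).mono_measure
      Measure.restrict_le_self
  have hlim1 : Filter.Tendsto (fun n => ∫ x in Ω, (φ x * ζ n x) • pullDeriv Φ D j x v) Filter.atTop
      (nhds (∫ x in Ω, φ x • pullDeriv Φ D j x v)) := by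
    refine tendsto_integral_of_dominated_convergence (fun x => ‖φ x • pullDeriv Φ D j x v‖)
      (fun n => ?_) hgφ.norm (fun n => Filter.Eventually.of_forall fun x => ?_) ?_
    · have h1 := hgφ.aestronglyMeasurable
      refine ((hζ.contDiff n).continuous.aestronglyMeasurable.smul h1).congr
        (Filter.Eventually.of_forall fun x => ?_)
      simp only [smul_smul, mul_comm, Pi.smul_apply']
    · rw [mul_comm, mul_smul, norm_smul]
      exact mul_le_of_le_one_left (norm_nonneg _) (hζ.abs_le_one n x)
    · filter_upwards [ae_restrict_of_ae h.ae_notMem] with x hx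
      refine tendsto_const_nhds.congr' ?_
      filter_upwards [hζ.eventuallyEq_one x hx] with n hn
      rw [hn.eq_of_nhds, mul_one]
  -- the limit of the right-hand side
  obtain ⟨C, hC, hCb⟩ := hζ.exists_bound_mul hφ hφc
  have hdom : Integrable (fun x => (tsupport φ).indicator
      (fun x => C * (∏ r, ‖v r‖) * ‖jac Φ x • u (Φ x)‖) x) (volume.restrict Ω) := by
    refine Integrable.mono_measure ?_ Measure.restrict_le_self
    rw [integrable_indicator_iff (isClosed_tsupport φ).measurableSet]
    exact (h.integrableOn_jac_smul_comp hu hφc hφs).norm.const_mul _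
  have hlim2 : Filter.Tendsto (fun n => ∫ x in Ω,
      iteratedFDeriv ℝ j (fun y => φ y * ζ n y) x v • u (Φ x)) Filter.atTop
      (nhds (∫ x in Ω, iteratedFDeriv ℝ j φ x v • u (Φ x))) := by
    refine tendsto_integral_of_dominated_convergence _ (fun n => ?_) hdom (fun n => ?_) ?_
    · exact (ContDiff.iteratedFDeriv_apply (hd n) v).continuous.aestronglyMeasurable.smul
        (h.aestronglyMeasurable_comp hu.aestronglyMeasurable)
    · filter_upwards [ae_restrict_of_ae h.ae_notMem] with x hx
      by_cases hxs : x ∈ tsupport φ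
      · rw [indicator_of_mem hxs, norm_smul, norm_smul, Real.norm_of_nonneg (h.jac_pos hx).le]
        have h1 := (iteratedFDeriv ℝ j (fun y => φ y * ζ n y) x).le_opNorm v
        have h2 := mul_le_mul_of_nonneg_right (hCb n x hx)
          (Finset.prod_nonneg fun r (_ : r ∈ Finset.univ) => norm_nonneg (v r))
        calc _ ≤ (C * jac Φ x * ∏ r, ‖v r‖) * ‖u (Φ x)‖ :=
              mul_le_mul_of_nonneg_right (h1.trans h2) (norm_nonneg _)
          _ = _ := by ring
      · rw [indicator_of_notMem hxs]
        have h1 : iteratedFDeriv ℝ j (fun y => φ y * ζ n y) x v = 0 :=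
          image_eq_zero_of_notMem_tsupport
            (f := fun z => iteratedFDeriv ℝ j (fun y => φ y * ζ n y) z v)
            fun hh => hxs (hsub n (tsupport_iteratedFDeriv_apply_subset _ v hh))
        rw [h1, zero_smul, norm_zero]
    · filter_upwards [ae_restrict_of_ae h.ae_notMem] with x hx
      refine tendsto_const_nhds.congr' ?_
      filter_upwards [hζ.eventuallyEq_one x hx] with n hn
      have h1 : (fun y => φ y * ζ n y) =ᶠ[nhds x] φ := by
        filter_upwards [hn] with y hy
        rw [hy, mul_one]
      rw [(h1.iteratedFDeriv ℝ j).eq_of_nhds]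
  exact tendsto_nhds_unique (hlim1.congr fun n => key n) (hlim2.const_smul _)

/-! ### Estimates in Lebesgue spaces -/

/-- The change of variables in Lebesgue norms. -/
lemma IsSingularDiffeo.eLpNorm_jac_rpow_le (h : IsSingularDiffeo Z Ω Φ) {F : Type*}
    [NormedAddCommGroup F] [NormedSpace ℝ F] (f : EuclideanSpace ℝ (Fin m) → F) {p : ℝ}
    (hp : 1 ≤ p) :
    eLpNorm (fun x => jac Φ x ^ (1 / p) * ‖f (Φ x)‖) (ENNReal.ofReal p) (volume.restrict Ω) ≤
      eLpNorm f (ENNReal.ofReal p) (volume.restrict Ω) := by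
  have hp0 : 0 < p := by linarith
  have hp1 : ENNReal.ofReal p ≠ 0 := (ENNReal.ofReal_pos.2 hp0).ne'
  rw [eLpNorm_eq_lintegral_rpow_enorm_toReal hp1 ENNReal.ofReal_ne_top,
    eLpNorm_eq_lintegral_rpow_enorm_toReal hp1 ENNReal.ofReal_ne_top, ENNReal.toReal_ofReal hp0.le]
  refine ENNReal.rpow_le_rpow ?_ (by positivity)
  calc ∫⁻ x in Ω, ‖jac Φ x ^ (1 / p) * ‖f (Φ x)‖‖ₑ ^ p
      = ∫⁻ x in Ω, ENNReal.ofReal (jac Φ x) * ‖f (Φ x)‖ₑ ^ p := by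
        refine lintegral_congr_ae ?_
        filter_upwards [ae_restrict_of_ae h.ae_notMem] with x hx
        have hJ := (h.jac_pos hx).le
        rw [enorm_mul, ENNReal.mul_rpow_of_nonneg _ _ hp0.le, enorm_norm,
          Real.enorm_of_nonneg (by positivity), ENNReal.ofReal_rpow_of_nonneg (by positivity) hp0.le,
          ← Real.rpow_mul hJ, one_div_mul_cancel hp0.ne', Real.rpow_one]
    _ = ∫⁻ y in Φ '' (Ω \ Z), ‖f y‖ₑ ^ p :=
        (h.lintegral_image h.isOpen.measurableSet fun y => ‖f y‖ₑ ^ p).symm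
    _ ≤ ∫⁻ y in Ω, ‖f y‖ₑ ^ p := lintegral_mono_set (image_subset_iff.2 fun x hx => h.mem hx)

lemma IsSingularDiffeo.aestronglyMeasurable_jac (h : IsSingularDiffeo Z Ω Φ) :
    AEStronglyMeasurable (jac Φ) (volume.restrict Ω) := by
  rw [← h.restrict_diff]
  refine ContinuousOn.aestronglyMeasurable (fun x hx => ?_)
    (h.isOpen.measurableSet.diff h.isClosed.measurableSet)
  have h1 := (h.contDiffAt_inv_jac hx.2).continuousAt.inv₀ (inv_ne_zero (h.jac_pos hx.2).ne')
  exact (h1.congr (Filter.Eventually.of_forall fun y => inv_inv (jac Φ y))).continuousWithinAt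

lemma IsSingularDiffeo.memLp_comp (h : IsSingularDiffeo Z Ω Φ) {F : Type*}
    [NormedAddCommGroup F] [NormedSpace ℝ F] {f : EuclideanSpace ℝ (Fin m) → F} {p : ℝ}
    (hp : 1 ≤ p) (hf : MemLp f (ENNReal.ofReal p) (volume.restrict Ω)) :
    MemLp (fun x => f (Φ x)) (ENNReal.ofReal p) (volume.restrict Ω) := by
  obtain ⟨c, hc, hj⟩ := h.exists_le_jac
  have hm := h.aestronglyMeasurable_comp hf.aestronglyMeasurable
  have h1 : MemLp (fun x => jac Φ x ^ (1 / p) * ‖f (Φ x)‖) (ENNReal.ofReal p)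
      (volume.restrict Ω) :=
    ⟨((h.aestronglyMeasurable_jac.aemeasurable.pow_const _).aestronglyMeasurable).mul hm.norm,
      (h.eLpNorm_jac_rpow_le f hp).trans_lt hf.eLpNorm_lt_top⟩
  refine (h1.const_mul ((c ^ (1 / p))⁻¹)).mono hm ?_
  filter_upwards [ae_restrict_of_ae h.ae_notMem] with x hx
  have hc' : 0 < c ^ (1 / p) := by positivity
  have hcj : c ^ (1 / p) ≤ jac Φ x ^ (1 / p) :=
    Real.rpow_le_rpow hc.le (hj x hx) (by positivity)
  have hJ := h.jac_pos hx
  rw [← mul_assoc, norm_mul, norm_norm,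
    Real.norm_of_nonneg (by positivity : 0 ≤ (c ^ (1 / p))⁻¹ * jac Φ x ^ (1 / p))]
  refine le_mul_of_one_le_left (norm_nonneg _) ?_
  rw [inv_mul_eq_div, one_le_div hc']
  exact hcj

/-- The estimate for the weak derivatives of the composition. -/
lemma IsSingularDiffeo.eLpNorm_pullDeriv_le (h : IsSingularDiffeo Z Ω Φ) {j : ℕ} (hj : 1 ≤ j)
    {p : ℝ} (hp : 1 ≤ p) {η M : ℝ} (hη : 0 < η) (hM : 1 ≤ M)
    (hΦ : ∀ i ∈ Finset.Icc 1 j, ∀ x ∉ Z, η ^ (i - 1) * ‖iteratedFDeriv ℝ i Φ x‖ ≤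
      M * jac Φ x ^ ((i : ℝ) / (j * p))) {F : Type*} [NormedAddCommGroup F] [NormedSpace ℝ F]
    {D : (i : ℕ) → EuclideanSpace ℝ (Fin m) → (EuclideanSpace ℝ (Fin m) [×i]→L[ℝ] F)}
    (hD : ∀ i ∈ Finset.Icc 1 j, AEStronglyMeasurable (D i) (volume.restrict Ω)) :
    ENNReal.ofReal (η ^ j) * eLpNorm (pullDeriv Φ D j) (ENNReal.ofReal p) (volume.restrict Ω) ≤
      ENNReal.ofReal (Fintype.card (OrderedFinpartition j) * M ^ j) *
        ∑ i ∈ Finset.Icc 1 j, ENNReal.ofReal (η ^ i) *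
          eLpNorm (D i) (ENNReal.ofReal p) (volume.restrict Ω) := by
  have hη' : ∀ i : ℕ, ENNReal.ofReal (η ^ i) = ‖η ^ i‖ₑ := fun i =>
    (Real.enorm_of_nonneg (by positivity)).symm
  set B : ℝ := Fintype.card (OrderedFinpartition j) * M ^ j with hB
  have hB0 : 0 ≤ B := by positivity
  have hmeas : ∀ i ∈ Finset.Icc 1 j, AEStronglyMeasurable
      (fun x => η ^ i * (jac Φ x ^ (1 / p) * ‖D i (Φ x)‖)) (volume.restrict Ω) := fun i hi =>
    (((h.aestronglyMeasurable_jac.aemeasurable.pow_const _).aestronglyMeasurable).mul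
      (h.aestronglyMeasurable_comp (hD i hi)).norm).const_mul _
  calc ENNReal.ofReal (η ^ j) * eLpNorm (pullDeriv Φ D j) (ENNReal.ofReal p) (volume.restrict Ω)
      = eLpNorm (fun x => η ^ j • pullDeriv Φ D j x) (ENNReal.ofReal p) (volume.restrict Ω) := by
        rw [hη', ← eLpNorm_const_smul]; rfl
    _ ≤ eLpNorm (fun x => B • ∑ i ∈ Finset.Icc 1 j, η ^ i * (jac Φ x ^ (1 / p) * ‖D i (Φ x)‖))
          (ENNReal.ofReal p) (volume.restrict Ω) := by
        refine eLpNorm_mono_ae ?_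
        filter_upwards [ae_restrict_of_ae h.ae_notMem] with x hx
        have hJ := h.jac_pos hx
        have h1 := norm_pullDeriv_le (D := D) hη hM hJ hj (r := j * p) fun i hi => hΦ i hi x hx
        rw [norm_smul, Real.norm_of_nonneg (by positivity : 0 ≤ η ^ j), smul_eq_mul, norm_mul,
          Real.norm_of_nonneg hB0, Real.norm_of_nonneg (Finset.sum_nonneg fun i _ => by positivity)]
        refine h1.trans_eq ?_
        have hj0 : (j : ℝ) ≠ 0 := by positivity
        rw [show (j : ℝ) / (j * p) = 1 / p by field_simp, Finset.mul_sum]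
        congr 1
        exact Finset.sum_congr rfl fun i _ => by ring
    _ = ENNReal.ofReal B * eLpNorm (fun x => ∑ i ∈ Finset.Icc 1 j,
          η ^ i * (jac Φ x ^ (1 / p) * ‖D i (Φ x)‖)) (ENNReal.ofReal p) (volume.restrict Ω) := by
        rw [← Real.enorm_of_nonneg hB0, ← eLpNorm_const_smul]; rfl
    _ ≤ ENNReal.ofReal B * ∑ i ∈ Finset.Icc 1 j, eLpNorm (fun x =>
          η ^ i * (jac Φ x ^ (1 / p) * ‖D i (Φ x)‖)) (ENNReal.ofReal p) (volume.restrict Ω) := by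
        gcongr
        have h2 := eLpNorm_sum_le (p := ENNReal.ofReal p) hmeas
          (ENNReal.one_le_ofReal.2 hp)
        refine le_trans (le_of_eq ?_) h2
        congr 1
        funext x
        rw [Finset.sum_apply]
    _ ≤ _ := by
        gcongr with i hi
        rw [hη']
        calc eLpNorm (fun x => η ^ i * (jac Φ x ^ (1 / p) * ‖D i (Φ x)‖)) (ENNReal.ofReal p)
              (volume.restrict Ω)
            = ‖η ^ i‖ₑ * eLpNorm (fun x => jac Φ x ^ (1 / p) * ‖D i (Φ x)‖) (ENNReal.ofReal p)
              (volume.restrict Ω) := by rw [← eLpNorm_const_smul]; rfl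
          _ ≤ _ := by gcongr; exact h.eLpNorm_jac_rpow_le (D i) hp

end WeakChainRule

/-! ### Composition and Sobolev spaces -/

section SobolevComposition

variable {m : ℕ} {Z Ω : Set (EuclideanSpace ℝ (Fin m))}
  {Φ : EuclideanSpace ℝ (Fin m) → EuclideanSpace ℝ (Fin m)}

/-- The constants `M β j` control the derivatives of order `j` of `Φ`, measured at scale `η`, by
powers of the Jacobian. -/
def DerivLEJac (Z : Set (EuclideanSpace ℝ (Fin m)))
    (Φ : EuclideanSpace ℝ (Fin m) → EuclideanSpace ℝ (Fin m)) (η s : ℝ) (M : ℝ → ℕ → ℝ) : Prop :=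
  ∀ β : ℝ, 0 < β → β < s → ∀ j : ℕ, 1 ≤ j → ∀ x ∉ Z,
    η ^ (j - 1) * ‖iteratedFDeriv ℝ j Φ x‖ ≤ M β j * jac Φ x ^ ((j : ℝ) / β)

/-- The constant in the Sobolev estimate for the composition which results from the constants `M`
in the pointwise estimates of the derivatives. -/
noncomputable def sobolevConst (M : ℝ → ℕ → ℝ) (k : ℕ) (p : ℝ) : ℝ :=
  1 + ∑ j ∈ Finset.Icc 1 k, (Fintype.card (OrderedFinpartition j) : ℝ) *
    (1 + ∑ i ∈ Finset.Icc 1 j, |M (j * p) i|) ^ j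

lemma sobolevConst_pos (M : ℝ → ℕ → ℝ) (k : ℕ) (p : ℝ) : 0 < sobolevConst M k p := by
  unfold sobolevConst
  have : ∀ j : ℕ, 0 ≤ 1 + ∑ i ∈ Finset.Icc 1 j, |M (j * p) i| := fun j => by positivity
  have h : 0 ≤ ∑ j ∈ Finset.Icc 1 k, (Fintype.card (OrderedFinpartition j) : ℝ) *
    (1 + ∑ i ∈ Finset.Icc 1 j, |M (j * p) i|) ^ j :=
    Finset.sum_nonneg fun j _ => mul_nonneg (Nat.cast_nonneg _) (pow_nonneg (this j) _)
  linarith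

lemma DerivLEJac.exists_bound (h : IsSingularDiffeo Z Ω Φ) {η s : ℝ} (hη : 0 < η)
    {M : ℝ → ℕ → ℝ} (hM : DerivLEJac Z Φ η s M) {j : ℕ} (hj : 1 ≤ j) (hjs : (j : ℝ) < s) :
    ∃ M' : ℝ, ∀ i ∈ Finset.Icc 1 j, ∀ x ∉ Z,
      ‖iteratedFDeriv ℝ i Φ x‖ ≤ M' * jac Φ x ^ ((i : ℝ) / j) := by
  refine ⟨∑ i ∈ Finset.Icc 1 j, |M j i| / η ^ (i - 1), fun i hi x hx => ?_⟩
  have hJ := h.jac_pos hx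
  have h1 := hM j (by positivity) hjs i (Finset.mem_Icc.1 hi).1 x hx
  have h2 : ‖iteratedFDeriv ℝ i Φ x‖ ≤ |M j i| / η ^ (i - 1) * jac Φ x ^ ((i : ℝ) / j) := by
    rw [div_mul_eq_mul_div, le_div_iff₀ (by positivity), mul_comm]
    exact h1.trans (mul_le_mul_of_nonneg_right (le_abs_self _) (by positivity))
  refine h2.trans (mul_le_mul_of_nonneg_right ?_ (by positivity))
  exact Finset.single_le_sum (f := fun i => |M j i| / η ^ (i - 1)) (fun i _ => by positivity) hi

/-- Composition with a singular diffeomorphism preserves Sobolev spaces. -/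
theorem IsSingularDiffeo.memSobolev_comp (h : IsSingularDiffeo Z Ω Φ) {η s : ℝ} (hη : 0 < η)
    {M : ℝ → ℕ → ℝ} (hM : DerivLEJac Z Φ η s M) {k : ℕ} {p : ℝ} (hp : 1 ≤ p)
    (hks : (k : ℝ) * p < s) {ζ : ℕ → EuclideanSpace ℝ (Fin m) → ℝ} (hζ : IsSingularCutoff Z Φ k ζ)
    {ν : ℕ} {u : EuclideanSpace ℝ (Fin m) → EuclideanSpace ℝ (Fin ν)} (hu : MemSobolev k p u Ω) :
    MemSobolev k p (u ∘ Φ) Ω ∧ ∀ j ∈ Finset.Icc 1 k,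
      ∀ (D : (i : ℕ) → EuclideanSpace ℝ (Fin m) →
          (EuclideanSpace ℝ (Fin m) [×i]→L[ℝ] EuclideanSpace ℝ (Fin ν)))
        (D' : EuclideanSpace ℝ (Fin m) →
          (EuclideanSpace ℝ (Fin m) [×j]→L[ℝ] EuclideanSpace ℝ (Fin ν))),
        (∀ i ∈ Finset.Icc 1 j, IsWeakDeriv i u (D i) Ω) → IsWeakDeriv j (u ∘ Φ) D' Ω →
        ENNReal.ofReal (η ^ j) * eLpNorm D' (ENNReal.ofReal p) (volume.restrict Ω) ≤
          ENNReal.ofReal (sobolevConst M k p) * ∑ i ∈ Finset.Icc 1 j, ENNReal.ofReal (η ^ i) *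
            eLpNorm (D i) (ENNReal.ofReal p) (volume.restrict Ω) := by
  have hp0 : 0 < p := by linarith
  have hjs : ∀ j ∈ Finset.Icc 1 k, (j : ℝ) * p < s ∧ (j : ℝ) < s := by
    intro j hj
    have h1 : (j : ℝ) ≤ k := by exact_mod_cast (Finset.mem_Icc.1 hj).2
    have h2 : (j : ℝ) * p ≤ k * p := mul_le_mul_of_nonneg_right h1 hp0.le
    have h3 : (j : ℝ) * 1 ≤ j * p := mul_le_mul_of_nonneg_left hp (Nat.cast_nonneg _)
    constructor <;> linarith
  have hweak : ∀ j ∈ Finset.Icc 1 k, ∀ D : (i : ℕ) → EuclideanSpace ℝ (Fin m) →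
      (EuclideanSpace ℝ (Fin m) [×i]→L[ℝ] EuclideanSpace ℝ (Fin ν)),
      (∀ i ∈ Finset.Icc 1 j, IsWeakDeriv i u (D i) Ω) →
      IsWeakDeriv j (u ∘ Φ) (pullDeriv Φ D j) Ω := fun j hj D hD =>
    h.isWeakDeriv_pullDeriv (Finset.mem_Icc.1 hj).1
      (hM.exists_bound h hη (Finset.mem_Icc.1 hj).1 (hjs j hj).2)
      (hζ.mono (Finset.mem_Icc.1 hj).2) hD
  have hnorm : ∀ j ∈ Finset.Icc 1 k, ∀ D : (i : ℕ) → EuclideanSpace ℝ (Fin m) →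
      (EuclideanSpace ℝ (Fin m) [×i]→L[ℝ] EuclideanSpace ℝ (Fin ν)),
      (∀ i ∈ Finset.Icc 1 j, AEStronglyMeasurable (D i) (volume.restrict Ω)) →
      ENNReal.ofReal (η ^ j) *
          eLpNorm (pullDeriv Φ D j) (ENNReal.ofReal p) (volume.restrict Ω) ≤
        ENNReal.ofReal (sobolevConst M k p) * ∑ i ∈ Finset.Icc 1 j, ENNReal.ofReal (η ^ i) *
          eLpNorm (D i) (ENNReal.ofReal p) (volume.restrict Ω) := by
    intro j hj D hD
    have hj1 := (Finset.mem_Icc.1 hj).1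
    set M' := 1 + ∑ i ∈ Finset.Icc 1 j, |M (j * p) i| with hM'
    have hM'1 : 1 ≤ M' := le_add_of_nonneg_right (Finset.sum_nonneg fun i _ => abs_nonneg _)
    refine (h.eLpNorm_pullDeriv_le hj1 hp hη hM'1 (fun i hi x hx => ?_) hD).trans ?_
    · have hJ := h.jac_pos hx
      refine (hM (j * p) (by positivity) (hjs j hj).1 i (Finset.mem_Icc.1 hi).1 x hx).trans
        (mul_le_mul_of_nonneg_right ?_ (by positivity))
      have h1 := Finset.single_le_sum (f := fun i => |M (j * p) i|) (fun i _ => abs_nonneg _) hi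
      have h2 := le_abs_self (M (j * p) i)
      linarith
    · gcongr
      have h1 := Finset.single_le_sum (f := fun j : ℕ => (Fintype.card (OrderedFinpartition j) : ℝ) *
        (1 + ∑ i ∈ Finset.Icc 1 j, |M (j * p) i|) ^ j) (fun j _ => by positivity) hj
      unfold sobolevConst
      linarith
  refine ⟨⟨h.memLp_comp hp hu.memLp, fun j hj => ?_⟩, fun j hj D D' hD hD' => ?_⟩
  · have hex : ∀ i, ∃ g : EuclideanSpace ℝ (Fin m) →
        (EuclideanSpace ℝ (Fin m) [×i]→L[ℝ] EuclideanSpace ℝ (Fin ν)), i ∈ Finset.Icc 1 k →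
        IsWeakDeriv i u g Ω ∧ MemLp g (ENNReal.ofReal p) (volume.restrict Ω) := by
      intro i
      by_cases hi : i ∈ Finset.Icc 1 k
      · obtain ⟨g, hg⟩ := hu.exists_weakDeriv i hi
        exact ⟨g, fun _ => hg⟩
      · exact ⟨0, fun hh => absurd hh hi⟩
    choose D hD using hex
    have hsub : ∀ i ∈ Finset.Icc 1 j, i ∈ Finset.Icc 1 k := fun i hi =>
      Finset.Icc_subset_Icc_right (Finset.mem_Icc.1 hj).2 hi
    have hw := hweak j hj D fun i hi => (hD i (hsub i hi)).1
    refine ⟨pullDeriv Φ D j, hw, ?_, ?_⟩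
    · exact hw.locallyIntegrableOn_deriv.aestronglyMeasurable
    · have h1 := hnorm j hj D fun i hi => (hD i (hsub i hi)).2.aestronglyMeasurable
      have h2 : ENNReal.ofReal (η ^ j) *
          eLpNorm (pullDeriv Φ D j) (ENNReal.ofReal p) (volume.restrict Ω) < ⊤ := by
        refine h1.trans_lt (ENNReal.mul_lt_top ENNReal.ofReal_lt_top ?_)
        exact ENNReal.sum_lt_top.2 fun i hi =>
          ENNReal.mul_lt_top ENNReal.ofReal_lt_top (hD i (hsub i hi)).2.eLpNorm_lt_top
      have h3 : ENNReal.ofReal (η ^ j) ≠ 0 := (ENNReal.ofReal_pos.2 (by positivity)).ne'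
      by_contra hcon
      rw [not_lt, top_le_iff] at hcon
      rw [hcon, ENNReal.mul_top h3] at h2
      exact lt_irrefl _ h2
  · have h1 := hweak j hj D hD
    rw [eLpNorm_congr_ae (hD'.ae_eq h.isOpen h1)]
    exact hnorm j hj D fun i hi => (hD i hi).locallyIntegrableOn_deriv.aestronglyMeasurable

end SobolevComposition

/-! ### Cubications are lattices of cubes -/

section Grid

variable {m : ℕ} {e : OrthonormalBasis (Fin m) ℝ (EuclideanSpace ℝ (Fin m))} {η : ℝ}

/-- The point whose coordinates in the basis `e`, in the units `η` and with respect to the origin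
`b`, are those of `y`. -/
noncomputable def scale (e : OrthonormalBasis (Fin m) ℝ (EuclideanSpace ℝ (Fin m)))
    (b : EuclideanSpace ℝ (Fin m)) (η : ℝ) (y : EuclideanSpace ℝ (Fin m)) :
    EuclideanSpace ℝ (Fin m) :=
  b + η • e.repr.symm y

/-- The coordinates, in the basis `e`, in the units `η` and with respect to the origin `b`, of a
point. -/
noncomputable def unscale (e : OrthonormalBasis (Fin m) ℝ (EuclideanSpace ℝ (Fin m)))
    (b : EuclideanSpace ℝ (Fin m)) (η : ℝ) (x : EuclideanSpace ℝ (Fin m)) :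
    EuclideanSpace ℝ (Fin m) :=
  η⁻¹ • e.repr (x - b)

lemma scale_unscale (hη : 0 < η) (b x : EuclideanSpace ℝ (Fin m)) :
    scale e b η (unscale e b η x) = x := by
  unfold scale unscale
  rw [map_smul, smul_smul, mul_inv_cancel₀ hη.ne', one_smul, e.repr.symm_apply_apply]
  abel

lemma unscale_scale (hη : 0 < η) (b y : EuclideanSpace ℝ (Fin m)) :
    unscale e b η (scale e b η y) = y := by
  unfold scale unscale
  rw [add_sub_cancel_left, map_smul, smul_smul, inv_mul_cancel₀ hη.ne', one_smul,
    e.repr.apply_symm_apply]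

lemma repr_scale (b y : EuclideanSpace ℝ (Fin m)) (i : Fin m) :
    e.repr (scale e b η y) i = e.repr b i + η * y i := by
  simp [scale]

/-- The center of a cell of the lattice. -/
noncomputable def latticePoint (z : Fin m → ℤ) : EuclideanSpace ℝ (Fin m) :=
  WithLp.toLp 2 fun i => 2 * (z i : ℝ)

/-- The cell of the lattice of cubes of radius `η`, one of which is centered at `b`. -/
noncomputable def cell (e : OrthonormalBasis (Fin m) ℝ (EuclideanSpace ℝ (Fin m)))
    (b : EuclideanSpace ℝ (Fin m)) (η : ℝ) (z : Fin m → ℤ) : Set (EuclideanSpace ℝ (Fin m)) :=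
  closedCube e (scale e b η (latticePoint z)) η

lemma scale_mem_closedCube (hη : 0 < η) {b c y : EuclideanSpace ℝ (Fin m)} :
    scale e b η y ∈ closedCube e (scale e b η c) η ↔ ∀ i, |y i - c i| ≤ 1 := by
  refine forall_congr' fun i => ?_
  rw [repr_scale, repr_scale, add_sub_add_left_eq_sub, ← mul_sub, abs_mul, abs_of_pos hη,
    mul_le_iff_le_one_right hη]

lemma scale_mem_cell (hη : 0 < η) {b y : EuclideanSpace ℝ (Fin m)} {z : Fin m → ℤ} :
    scale e b η y ∈ cell e b η z ↔ ∀ i, |y i - 2 * (z i : ℝ)| ≤ 1 :=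
  scale_mem_closedCube hη

lemma scale_mem_cubeFace (hη : 0 < η) {b c y : EuclideanSpace ℝ (Fin m)} {s : Fin m → SignType} :
    scale e b η y ∈ cubeFace e (scale e b η c) η s ↔
      ∀ i, (s i = 0 → |y i - c i| ≤ 1) ∧ (s i ≠ 0 → y i = c i + (s i : ℝ)) := by
  refine forall_congr' fun i => and_congr ?_ ?_
  · rw [repr_scale, repr_scale, add_sub_add_left_eq_sub, ← mul_sub, abs_mul, abs_of_pos hη,
      mul_le_iff_le_one_right hη]
  · rw [repr_scale, repr_scale, add_assoc, add_right_inj, mul_comm (s i : ℝ), ← mul_add,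
      mul_right_inj' hη.ne']

lemma closedCube_injective (hη : 0 ≤ η) {a a' : EuclideanSpace ℝ (Fin m)}
    (h : closedCube e a η = closedCube e a' η) : a = a' := by
  refine e.repr.injective (PiLp.ext fun i => ?_)
  -- the corners of either cube belong to the other one
  have hmem : ∀ t : ℝ, |t| ≤ η → |e.repr a i + t - e.repr a' i| ≤ η := by
    intro t ht
    have h1 : e.repr.symm (WithLp.toLp 2 fun j => e.repr a j + t) ∈ closedCube e a η := by
      intro j; simpa using ht
    rw [h] at h1
    simpa using h1 i
  have h1 := abs_le.1 (hmem η (abs_of_nonneg hη).le)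
  have h2 := abs_le.1 (hmem (-η) (by rw [abs_neg, abs_of_nonneg hη]))
  linarith [h1.2, h2.1]

/-- Two cubes of a cubication which meet have centers which differ by a vector of the lattice. -/
lemma IsCubication.repr_sub {S : Set (Set (EuclideanSpace ℝ (Fin m)))} (hη : 0 < η)
    {B : Set (EuclideanSpace ℝ (Fin m))}
    (hS : IsCubication e η S B) {a a' : EuclideanSpace ℝ (Fin m)} (ha : closedCube e a η ∈ S)
    (ha' : closedCube e a' η ∈ S) (h : (closedCube e a η ∩ closedCube e a' η).Nonempty) (i : Fin m) :
    e.repr a' i - e.repr a i = 0 ∨ e.repr a' i - e.repr a i = 2 * η ∨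
      e.repr a' i - e.repr a i = -(2 * η) := by
  obtain ⟨d, ⟨c, s, hc, hs, -⟩, ⟨c', s', hc', hs', -⟩⟩ := hS.inter_isFace _ ha _ ha' h
  obtain rfl := closedCube_injective hη.le hc
  obtain rfl := closedCube_injective hη.le hc'
  obtain ⟨x, hx⟩ := h
  -- a free coordinate of the common face is common to the two cubes
  have key : ∀ (c c' : EuclideanSpace ℝ (Fin m)) (s : Fin m → SignType),
      x ∈ cubeFace e c η s → cubeFace e c η s ⊆ closedCube e c' η → s i = 0 →
      e.repr c' i = e.repr c i := by
    intro c c' s hxs hsub hsi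
    have h1 : ∀ t : ℝ, |t| ≤ η → |e.repr c i + t - e.repr c' i| ≤ η := by
      intro t ht
      have h2 : e.repr.symm (WithLp.toLp 2 (Function.update (e.repr x) i (e.repr c i + t))) ∈
          cubeFace e c η s := by
        intro j
        rcases eq_or_ne j i with rfl | hj
        · exact ⟨fun _ => by simpa using ht, fun hh => absurd hsi hh⟩
        · simpa [Function.update_of_ne hj] using hxs j
      simpa using hsub h2 i
    have h2 := abs_le.1 (h1 η (abs_of_pos hη).le)
    have h3 := abs_le.1 (h1 (-η) (by rw [abs_neg, abs_of_pos hη]))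
    linarith [h2.2, h3.1]
  have hxs : x ∈ cubeFace e a η s := hs ▸ hx
  have hxs' : x ∈ cubeFace e a' η s' := hs' ▸ hx
  by_cases h0 : s i = 0
  · left
    rw [key a a' s hxs (hs ▸ inter_subset_right) h0, sub_self]
  by_cases h0' : s' i = 0
  · left
    rw [key a' a s' hxs' (hs' ▸ inter_subset_left) h0', sub_self]
  have h1 := (hxs i).2 h0
  have h2 := (hxs' i).2 h0'
  rcases hsi : s i with _ | _ | _
  · exact absurd hsi h0
  all_goals
    rcases hsi' : s' i with _ | _ | _
    · exact absurd hsi' h0'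
    all_goals
      rw [hsi] at h1
      rw [hsi'] at h2
      simp at h1 h2
      first
        | (left; linarith)
        | (right; left; linarith)
        | (right; right; linarith)

lemma mem_closedCube_self (hη : 0 ≤ η) (a : EuclideanSpace ℝ (Fin m)) : a ∈ closedCube e a η :=
  fun i => by simpa using hη

/-- The neighbour of a cube of a cubication of the space, in the direction of a coordinate, belongs
to the cubication. -/
lemma IsCubication.neighbour_mem {S : Set (Set (EuclideanSpace ℝ (Fin m)))} (hη : 0 < η)
    (hS : IsCubication e η S univ) {a : EuclideanSpace ℝ (Fin m)} (ha : closedCube e a η ∈ S)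
    (i : Fin m) {ε : ℝ} (hε : ε = 1 ∨ ε = -1) : closedCube e (a + (2 * η * ε) • e i) η ∈ S := by
  have hε2 : ε * ε = 1 := by rcases hε with rfl | rfl <;> norm_num
  have hεa : |ε| = 1 := by rcases hε with rfl | rfl <;> norm_num
  have hrepr : ∀ (t : ℝ) (j : Fin m), e.repr (a + t • e i) j =
      e.repr a j + if j = i then t else 0 := by
    intro t j
    simp
  -- the cubes which contain a point beyond the face
  have hcov : ∀ t : ℝ, ∃ c, closedCube e c η ∈ S ∧
      a + ((η + t) * ε) • e i ∈ closedCube e c η := by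
    intro t
    have h1 : a + ((η + t) * ε) • e i ∈ ⋃₀ S := hS.sUnion_eq ▸ mem_univ _
    obtain ⟨σ, hσ, hx⟩ := h1
    obtain ⟨c, rfl⟩ := hS.isCube σ hσ
    exact ⟨c, hσ, hx⟩
  have hbound : ∀ {c : EuclideanSpace ℝ (Fin m)} {t : ℝ},
      a + ((η + t) * ε) • e i ∈ closedCube e c η →
      |(η + t) - (e.repr c i - e.repr a i) * ε| ≤ η := by
    intro c t hx
    have hxi := hx i
    rw [hrepr, if_pos rfl] at hxi
    calc |(η + t) - (e.repr c i - e.repr a i) * ε|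
        = |ε * (e.repr a i + (η + t) * ε - e.repr c i)| := by
          congr 1; linear_combination (-(η + t)) * hε2
      _ ≤ η := by rw [abs_mul, hεa, one_mul]; exact hxi
  have hmeet : ∀ {c : EuclideanSpace ℝ (Fin m)} {t : ℝ}, 0 < t → t < η →
      closedCube e c η ∈ S → a + ((η + t) * ε) • e i ∈ closedCube e c η →
      (e.repr c i - e.repr a i) * ε ≤ 2 * η → closedCube e (a + (2 * η * ε) • e i) η ∈ S := by
    intro c t ht htη hc hx hle
    have hb := abs_le.1 (hbound hx)
    have hxj : ∀ j ≠ i, |e.repr a j - e.repr c j| ≤ η := by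
      intro j hj
      have := hx j
      rwa [hrepr, if_neg hj, add_zero] at this
    have hne : (closedCube e a η ∩ closedCube e c η).Nonempty := by
      refine ⟨a + (η * ε) • e i, fun j => ?_, fun j => ?_⟩
      · rw [hrepr]
        split_ifs
        · rw [add_sub_cancel_left, abs_mul, hεa, abs_of_pos hη, mul_one]
        · simpa using hη.le
      · rw [hrepr]
        split_ifs with hj
        · subst hj
          have : |ε * (e.repr a j + η * ε - e.repr c j)| ≤ η := by
            rw [show ε * (e.repr a j + η * ε - e.repr c j) =
              η - (e.repr c j - e.repr a j) * ε by linear_combination η * hε2, abs_le]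
            constructor <;> linarith [hb.1, hb.2]
          rwa [abs_mul, hεa, one_mul] at this
        · rw [add_zero]; exact hxj j hj
    have hgrid := hS.repr_sub hη ha hc hne
    have hca : c = a + (2 * η * ε) • e i := by
      refine e.repr.injective (PiLp.ext fun j => ?_)
      rw [hrepr]
      split_ifs with hj
      · subst hj
        have h3 : (e.repr c j - e.repr a j) * ε = 2 * η := by
          rcases hgrid j with h | h | h <;> rcases hε with rfl | rfl <;> rw [h] at hb ⊢ <;>
            linarith [hb.1, hb.2]
        linear_combination ε * h3 - (e.repr c j - e.repr a j) * hε2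
      · have h3 := abs_le.1 (hxj j hj)
        rcases hgrid j with h | h | h <;> linarith [h3.1, h3.2]
    exact hca ▸ hc
  obtain ⟨c, hc, hx⟩ := hcov (η / 2)
  by_cases hle : (e.repr c i - e.repr a i) * ε ≤ 2 * η
  · exact hmeet (by linarith) (by linarith) hc hx hle
  -- otherwise there is a gap before this cube, and a cube which meets the gap starts closer
  push Not at hle
  set g := (e.repr c i - e.repr a i) * ε - 2 * η with hg
  have hb := abs_le.1 (hbound hx)
  obtain ⟨c', hc', hx'⟩ := hcov (g / 2)
  have hb' := abs_le.1 (hbound hx')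
  refine hmeet (by linarith) (by linarith [hb.1]) hc' hx' ?_
  by_contra hcon
  push Not at hcon
  have hne : (closedCube e c η ∩ closedCube e c' η).Nonempty := by
    refine ⟨a + ((η + η / 2) * ε) • e i, hx, fun j => ?_⟩
    rw [hrepr]
    split_ifs with hj
    · subst hj
      have : |ε * (e.repr a j + (η + η / 2) * ε - e.repr c' j)| ≤ η := by
        rw [show ε * (e.repr a j + (η + η / 2) * ε - e.repr c' j) =
          (η + η / 2) - (e.repr c' j - e.repr a j) * ε by linear_combination (η + η / 2) * hε2,
          abs_le]
        constructor <;> linarith [hb.1, hb.2, hb'.1, hb'.2]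
      rwa [abs_mul, hεa, one_mul] at this
    · have := hx' j
      rwa [hrepr, if_neg hj] at this
  have h5 : (e.repr c' i - e.repr c i) * ε = (e.repr c' i - e.repr a i) * ε - 2 * η - g := by
    rw [hg]; ring
  have h6 := hb.1
  have h7 := hb'.1
  rcases hS.repr_sub hη hc hc' hne i with h | h | h <;> rcases hε with rfl | rfl <;>
    rw [h] at h5 <;> linarith

end Grid

/-! ### Skeletons in coordinates -/

section Skeletons

variable {m : ℕ} {e : OrthonormalBasis (Fin m) ℝ (EuclideanSpace ℝ (Fin m))} {η : ℝ}
  {b : EuclideanSpace ℝ (Fin m)}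

lemma scale_add_smul (y : EuclideanSpace ℝ (Fin m)) (t : ℝ) (i : Fin m) :
    scale e b η y + (η * t) • e i = scale e b η (y + t • EuclideanSpace.single i 1) := by
  refine e.repr.injective (PiLp.ext fun j => ?_)
  rw [repr_scale]
  simp only [scale, map_add, map_smul, PiLp.add_apply, PiLp.smul_apply, smul_eq_mul,
    LinearIsometryEquiv.apply_symm_apply, e.repr_self]
  ring

lemma scale_latticePoint_update (z : Fin m → ℤ) (i : Fin m) (k : ℤ) :
    scale e b η (latticePoint (Function.update z i k)) +
      (2 * η * 1) • e i = scale e b η (latticePoint (Function.update z i (k + 1))) := by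
  rw [show 2 * η * 1 = η * 2 by ring, scale_add_smul]
  congr 1
  refine PiLp.ext fun j => ?_
  rcases eq_or_ne j i with rfl | hj
  · simp [latticePoint]; ring
  · simp [latticePoint, hj]

/-- A cubication of the space consists of all cells of a lattice. -/
theorem IsCubication.exists_eq_range_cell {S : Set (Set (EuclideanSpace ℝ (Fin m)))} (hη : 0 < η)
    (hS : IsCubication e η S univ) : ∃ b, S = range (cell e b η) := by
  classical
  obtain ⟨σ, hσ, -⟩ : (0 : EuclideanSpace ℝ (Fin m)) ∈ ⋃₀ S := hS.sUnion_eq ▸ mem_univ _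
  obtain ⟨b, rfl⟩ := hS.isCube σ hσ
  have hupd : ∀ (z : Fin m → ℤ) (i : Fin m) (k : ℤ), cell e b η z ∈ S →
      cell e b η (Function.update z i k) ∈ S := by
    intro z i k hz
    induction k using Int.inductionOn' (b := z i) with
    | zero => rwa [Function.update_eq_self]
    | succ k _ ih =>
      have := hS.neighbour_mem hη ih i (ε := 1) (Or.inl rfl)
      rwa [scale_latticePoint_update] at this
    | pred k _ ih =>
      have := hS.neighbour_mem hη ih i (ε := -1) (Or.inr rfl)
      have h2 := scale_latticePoint_update (e := e) (b := b) (η := η) z i (k - 1)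
      rw [sub_add_cancel] at h2
      rw [← h2, add_assoc, ← add_smul, show 2 * η * 1 + 2 * η * -1 = 0 by ring, zero_smul,
        add_zero] at this
      exact this
  have h0 : cell e b η 0 ∈ S := by
    have : scale e b η (latticePoint 0) = b := by
      refine e.repr.injective (PiLp.ext fun j => ?_)
      rw [repr_scale]; simp [latticePoint]
    unfold cell
    rwa [this]
  have hall : ∀ z, cell e b η z ∈ S := by
    intro z
    have h1 : ∀ J : Finset (Fin m), cell e b η (J.piecewise z 0) ∈ S := by
      intro J
      induction J using Finset.induction_on with
      | empty => simpa using h0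
      | insert j J _ ih => rw [Finset.piecewise_insert]; exact hupd _ _ _ ih
    simpa using h1 Finset.univ
  refine ⟨b, Subset.antisymm (fun σ hσ => ?_) (range_subset_iff.2 hall)⟩
  obtain ⟨c, rfl⟩ := hS.isCube σ hσ
  set y := unscale e b η c with hy
  have hcy : scale e b η y = c := scale_unscale hη b c
  set z : Fin m → ℤ := fun i => round (y i / 2) with hz
  have hyz : ∀ i, |y i - 2 * (z i : ℝ)| ≤ 1 := fun i => abs_ctr_le_one (y i)
  have hne : (cell e b η z ∩ closedCube e c η).Nonempty := by
    refine ⟨c, ?_, mem_closedCube_self hη.le c⟩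
    rw [← hcy]
    exact (scale_mem_cell hη).2 hyz
  refine ⟨z, ?_⟩
  have hc : c = scale e b η (latticePoint z) := by
    refine e.repr.injective (PiLp.ext fun i => ?_)
    have h1 := hS.repr_sub hη (hall z) hσ hne i
    have h2 : e.repr c i - e.repr (scale e b η (latticePoint z)) i = η * (y i - 2 * (z i : ℝ)) := by
      rw [← hcy, repr_scale, repr_scale]; simp only [latticePoint]; ring
    have h3 : |e.repr c i - e.repr (scale e b η (latticePoint z)) i| ≤ η := by
      rw [h2, abs_mul, abs_of_pos hη]
      exact mul_le_of_le_one_right hη.le (hyz i)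
    have h4 := abs_le.1 h3
    rcases h1 with h | h | h <;> linarith [h4.1, h4.2]
  rw [hc, cell]

/-- The indices of the cells which belong to the family `U`. -/
def cellIndices (e : OrthonormalBasis (Fin m) ℝ (EuclideanSpace ℝ (Fin m)))
    (b : EuclideanSpace ℝ (Fin m)) (η : ℝ) (U : Set (Set (EuclideanSpace ℝ (Fin m)))) :
    Set (Fin m → ℤ) := {z | cell e b η z ∈ U}

variable {U : Set (Set (EuclideanSpace ℝ (Fin m)))}

lemma exists_cell_of_mem (hη : 0 < η) (hU : U ⊆ range (cell e b η)) {c : EuclideanSpace ℝ (Fin m)}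
    (hc : closedCube e c η ∈ U) :
    ∃ z ∈ cellIndices e b η U, c = scale e b η (latticePoint z) := by
  obtain ⟨z, hz⟩ := hU hc
  refine ⟨z, ?_, closedCube_injective hη.le hz.symm⟩
  rwa [cellIndices, mem_ofPred_eq, hz]

lemma scale_mem_sUnion (hη : 0 < η) (hU : U ⊆ range (cell e b η)) {y : EuclideanSpace ℝ (Fin m)} :
    scale e b η y ∈ ⋃₀ U ↔ ∃ z ∈ cellIndices e b η U, ∀ i, |y i - 2 * (z i : ℝ)| ≤ 1 := by
  constructor
  · rintro ⟨σ, hσ, hy⟩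
    obtain ⟨z, rfl⟩ := hU hσ
    exact ⟨z, hσ, (scale_mem_cell hη).1 hy⟩
  · rintro ⟨z, hz, hy⟩
    exact ⟨_, hz, (scale_mem_cell hη).2 hy⟩

/-- A point whose coordinates are within `r` of those of a point of a set belongs to its sum with
the cube of radius `r`. -/
lemma scale_mem_add_openCube (hη : 0 < η) {r : ℝ} {A : Set (EuclideanSpace ℝ (Fin m))}
    {y w : EuclideanSpace ℝ (Fin m)} (hw : scale e b η w ∈ A) (h : ∀ i, |y i - w i| < r) :
    scale e b η y ∈ A + openCube e 0 (r * η) := by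
  refine ⟨scale e b η w, hw, scale e b η y - scale e b η w, fun i => ?_, add_sub_cancel _ _⟩
  rw [map_zero, map_sub, PiLp.sub_apply, repr_scale, repr_scale, add_sub_add_left_eq_sub, ← mul_sub,
    PiLp.zero_apply, sub_zero, abs_mul, abs_of_pos hη, mul_comm]
  exact mul_lt_mul_of_pos_right (h i) hη

lemma scale_mem_nhd (hη : 0 < η) (hU : U ⊆ range (cell e b η)) {r : ℝ} (hr : 0 < r)
    {y : EuclideanSpace ℝ (Fin m)} :
    scale e b η y ∈ ⋃₀ U + openCube e 0 (r * η) ↔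
      ∃ z ∈ cellIndices e b η U, ∀ i, |y i - 2 * (z i : ℝ)| < 1 + r := by
  constructor
  · rintro ⟨x, hx, q, hq, hxq⟩
    obtain ⟨w, rfl⟩ : ∃ w, scale e b η w = x := ⟨_, scale_unscale hη b x⟩
    obtain ⟨z, hz, hw⟩ := (scale_mem_sUnion hη hU).1 hx
    refine ⟨z, hz, fun i => ?_⟩
    have h1 : η * |y i - w i| = |e.repr q i| := by
      have h2 := congr_arg (fun x => e.repr x i) hxq
      simp only [map_add, PiLp.add_apply, repr_scale] at h2
      nth_rw 1 [← abs_of_pos hη]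
      rw [← abs_mul]
      congr 1
      linarith
    have h2 : |e.repr q i| < r * η := by simpa using hq i
    have h3 : |y i - w i| < r := by
      rw [← h1, mul_comm] at h2
      exact lt_of_mul_lt_mul_right h2 hη.le
    calc |y i - 2 * (z i : ℝ)| ≤ |y i - w i| + |w i - 2 * (z i : ℝ)| := abs_sub_le _ _ _
      _ < 1 + r := by linarith [hw i]
  · rintro ⟨z, hz, hy⟩
    -- project the point on the cube
    set w : EuclideanSpace ℝ (Fin m) := WithLp.toLp 2 fun i =>
      2 * (z i : ℝ) + max (-1) (min 1 (y i - 2 * (z i : ℝ))) with hw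
    refine scale_mem_add_openCube hη (w := w) ((scale_mem_sUnion hη hU).2 ⟨z, hz, fun i => ?_⟩)
      fun i => ?_
    · simp only [hw, add_sub_cancel_left, abs_le]
      exact ⟨le_max_left _ _, max_le (by norm_num) (min_le_left _ _)⟩
    · have h1 := abs_lt.1 (hy i)
      simp only [hw]
      rw [abs_lt]
      rcases le_total (y i - 2 * (z i : ℝ)) 1 with h | h
      · rw [min_eq_right h]
        rcases le_total (-1) (y i - 2 * (z i : ℝ)) with h' | h'
        · rw [max_eq_right h']; constructor <;> linarith
        · rw [max_eq_left h']; constructor <;> linarith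
      · rw [min_eq_left h, max_eq_right (by norm_num)]; constructor <;> linarith

lemma ctr_two_mul_int (n : ℤ) : ctr (2 * (n : ℝ)) = 0 := by
  unfold ctr
  rw [mul_div_cancel_left₀ _ two_ne_zero, round_intCast, sub_self]

lemma mem_evenSet_iff {ℓ : ℕ} {y : EuclideanSpace ℝ (Fin m)} :
    y ∈ evenSet m ℓ ↔ ∃ J : Finset (Fin m), J.card = ℓ + 1 ∧ ∀ j ∈ J, ∃ n : ℤ, y j = 2 * n := by
  refine exists_congr fun J => and_congr_right fun _ => forall₂_congr fun j _ => ?_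
  rw [sin_eq_zero_iff]
  constructor
  · intro h
    refine ⟨round (y j / 2), ?_⟩
    have := two_mul_round_add_ctr (y j)
    rw [h, add_zero] at this
    exact this.symm
  · rintro ⟨n, hn⟩
    rw [hn, ctr_two_mul_int]

lemma signType_cast_eq {s : SignType} (h : s ≠ 0) : (s : ℝ) = 1 ∨ (s : ℝ) = -1 := by
  rcases s with _ | _ | _
  · exact absurd rfl h
  · right; simp
  · left; simp

/-- The points of the dual skeleton have more than `ℓ` even coordinates. -/
lemma mem_evenSet_of_mem_dualSkeleton (hη : 0 < η) (hU : U ⊆ range (cell e b η)) {ℓ : ℕ}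
    (hℓ : ℓ < m) {y : EuclideanSpace ℝ (Fin m)} (hy : scale e b η y ∈ ⋃₀ dualSkeleton e η U ℓ) :
    y ∈ evenSet m ℓ := by
  classical
  obtain ⟨κ, ⟨τ, ⟨σ, hσ, c, s, rfl, rfl, hs⟩, a, x, ha, ⟨a', s', haa', hx, hs'⟩, rfl⟩,
    v, hv, hvy⟩ := hy
  obtain rfl := closedCube_injective hη.le haa'
  obtain ⟨z, -, rfl⟩ := exists_cell_of_mem hη hU hσ
  have hx' : x ∈ cubeFace e a η s' := hx ▸ mem_singleton x
  rw [mem_evenSet_iff]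
  refine ⟨Finset.univ.filter fun i => s i ≠ 0, ?_, fun j hj => ?_⟩
  · have h1 := Finset.card_filter_add_card_filter_not (s := (Finset.univ : Finset (Fin m)))
      (fun i => s i = 0)
    rw [hs, Finset.card_univ, Fintype.card_fin] at h1
    simp only [ne_eq]
    omega
  · have hj1 := (hv j).2 (Finset.mem_filter.1 hj).2
    have hj0 : s' j ≠ 0 := fun h0 => by
      rw [Finset.card_eq_zero] at hs'
      exact Finset.notMem_empty j (hs' ▸ Finset.mem_filter.2 ⟨Finset.mem_univ j, h0⟩)
    have hj2 := (hx' j).2 hj0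
    have hj3 := congr_arg (fun x => e.repr x j) hvy
    simp only [map_add, map_sub, PiLp.add_apply, PiLp.sub_apply] at hj3
    rw [hj1, hj2, repr_scale, repr_scale] at hj3
    have hj4 : η * y j = η * (2 * (z j : ℝ) + s j + s' j) := by
      simp only [latticePoint] at hj3
      linarith
    have hj5 := mul_left_cancel₀ hη.ne' hj4
    rcases signType_cast_eq (Finset.mem_filter.1 hj).2 with h | h <;>
      rcases signType_cast_eq hj0 with h' | h' <;> rw [h, h'] at hj5
    · exact ⟨z j + 1, by push_cast; linarith⟩
    · exact ⟨z j, by linarith⟩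
    · exact ⟨z j, by linarith⟩
    · exact ⟨z j - 1, by push_cast; linarith⟩

/-- The points near a cube of the family which have more than `ℓ` even coordinates belong to the
dual skeleton. -/
lemma mem_dualSkeleton_of_mem_evenSet (hη : 0 < η) {ℓ : ℕ}
    {y : EuclideanSpace ℝ (Fin m)} (hy : y ∈ evenSet m ℓ) {z : Fin m → ℤ}
    (hz : z ∈ cellIndices e b η U) (hyz : ∀ i, |y i - 2 * (z i : ℝ)| ≤ 2) :
    scale e b η y ∈ ⋃₀ dualSkeleton e η U ℓ := by
  classical
  obtain ⟨J, hJ, hJe⟩ := mem_evenSet_iff.1 hy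
  -- the vertex which lies on the side of `y`
  set v : Fin m → SignType := fun i => if 0 ≤ y i - 2 * (z i : ℝ) then 1 else -1 with hv
  set c := scale e b η (latticePoint z) with hc
  set x := scale e b η (WithLp.toLp 2 fun i => 2 * (z i : ℝ) + v i) with hx
  set w : EuclideanSpace ℝ (Fin m) := WithLp.toLp 2 fun i => y i - v i with hw
  set s : Fin m → SignType := fun i => if i ∈ J then
    (if 1 ≤ w i - 2 * (z i : ℝ) then 1 else -1) else 0 with hs
  have hv0 : ∀ i, v i ≠ 0 := fun i => by
    simp only [hv]; split_ifs <;> decide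
  have hw1 : ∀ i, |w i - 2 * (z i : ℝ)| ≤ 1 := fun i => by
    have h1 := abs_le.1 (hyz i)
    simp only [hw, hv]
    rw [abs_le]
    split_ifs with h <;> simp <;> constructor <;> linarith
  refine ⟨_, ⟨cubeFace e c η s, ⟨closedCube e c η, hz, c, s, rfl, rfl, ?_⟩, c, x, hz,
    ⟨c, v, rfl, ?_, ?_⟩, rfl⟩, scale e b η w, ?_, ?_⟩
  · have : (Finset.univ.filter fun i => s i = 0) = Jᶜ := by
      ext i
      simp only [hs, Finset.mem_filter, Finset.mem_univ, true_and, Finset.mem_compl]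
      split_ifs <;> simp_all
    rw [this, Finset.card_compl, Fintype.card_fin, hJ]
    omega
  · ext x'
    obtain ⟨y', rfl⟩ : ∃ y', scale e b η y' = x' := ⟨_, scale_unscale hη b x'⟩
    rw [hc, scale_mem_cubeFace hη, mem_singleton_iff]
    constructor
    · intro h
      have := congr_arg (unscale e b η) h
      rw [hx, unscale_scale hη, unscale_scale hη] at this
      intro i
      exact ⟨fun h0 => absurd h0 (hv0 i), fun _ => by rw [this]; rfl⟩
    · intro h
      rw [hx]
      congr 1
      exact PiLp.ext fun i => (h i).2 (hv0 i)
  · rw [Finset.card_eq_zero, Finset.filter_eq_empty_iff]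
    exact fun i _ => hv0 i
  · rw [hc, scale_mem_cubeFace hη]
    refine fun i => ⟨fun _ => hw1 i, fun h0 => ?_⟩
    have hi : i ∈ J := by
      by_contra hcon
      exact h0 (by simp [hs, hcon])
    obtain ⟨n, hn⟩ := hJe i hi
    have h1 := abs_le.1 (hw1 i)
    simp only [hs, if_pos hi, latticePoint]
    -- the distance to the center is an odd integer
    have hodd : ∃ k : ℤ, w i - 2 * (z i : ℝ) = 2 * k + 1 := by
      simp only [hw]
      rcases signType_cast_eq (hv0 i) with h | h
      · exact ⟨n - z i - 1, by rw [h, hn]; push_cast; ring⟩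
      · exact ⟨n - z i, by rw [h, hn]; push_cast; ring⟩
    obtain ⟨k, hk⟩ := hodd
    split_ifs with h
    · have : w i - 2 * (z i : ℝ) = 1 := le_antisymm h1.2 h
      simp; linarith
    · rw [hk] at h h1
      push Not at h
      have h3 : k < 0 := by
        have : (k : ℝ) < 0 := by linarith
        exact_mod_cast this
      have h4 : (k : ℝ) ≤ -1 := by exact_mod_cast Int.le_sub_one_of_lt h3
      simp; linarith
  · refine e.repr.injective (PiLp.ext fun i => ?_)
    simp only [map_add, map_sub, PiLp.add_apply, PiLp.sub_apply, hx, hc, repr_scale, hw,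
      latticePoint]
    ring

/-- A point of a cube all but `ℓ` of whose coordinates are within `r` of the boundary is within `r`
of the `ℓ`-dimensional skeleton. -/
lemma scale_mem_skeleton_add (hη : 0 < η) {ℓ : ℕ} (hℓ : ℓ < m) {r : ℝ} (hr : 0 < r) (hr1 : r < 1)
    {y : EuclideanSpace ℝ (Fin m)} {z : Fin m → ℤ} (hz : z ∈ cellIndices e b η U)
    (hyz : ∀ i, |y i - 2 * (z i : ℝ)| ≤ 1) {I : Finset (Fin m)} (hI : I.card = m - ℓ)
    (h : ∀ i ∈ I, 1 - r < |y i - 2 * (z i : ℝ)|) :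
    scale e b η y ∈ ⋃₀ skeleton e η U ℓ + openCube e 0 (r * η) := by
  classical
  set c := scale e b η (latticePoint z) with hc
  set s : Fin m → SignType := fun i => if i ∈ I then SignType.sign (y i - 2 * (z i : ℝ)) else 0
    with hs
  set w : EuclideanSpace ℝ (Fin m) := WithLp.toLp 2 fun i =>
    if i ∈ I then 2 * (z i : ℝ) + s i else y i with hw
  have hs0 : ∀ i, s i = 0 ↔ i ∉ I := fun i => by
    simp only [hs]
    split_ifs with hi
    · simp only [hi, not_true_eq_false, iff_false, sign_eq_zero_iff]
      intro h0
      have := h i hi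
      rw [h0, abs_zero] at this
      linarith
    · simp [hi]
  refine scale_mem_add_openCube hη (w := w) ⟨cubeFace e c η s, ⟨closedCube e c η, hz, c, s, rfl,
    rfl, ?_⟩, ?_⟩ fun i => ?_
  · have : (Finset.univ.filter fun i => s i = 0) = Iᶜ := by
      ext i
      simp [hs0]
    rw [this, Finset.card_compl, Fintype.card_fin, hI]
    omega
  · rw [hc, scale_mem_cubeFace hη]
    refine fun i => ⟨fun h0 => ?_, fun h0 => ?_⟩
    · simp only [hw, latticePoint, if_neg ((hs0 i).1 h0)]
      exact hyz i
    · rw [Ne, hs0, not_not] at h0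
      simp only [hw, latticePoint, if_pos h0]
  · by_cases hi : i ∈ I
    · have h1 := h i hi
      have h2 := abs_le.1 (hyz i)
      simp only [hw, if_pos hi, hs]
      rcases lt_trichotomy (y i - 2 * (z i : ℝ)) 0 with h3 | h3 | h3
      · rw [abs_of_neg h3] at h1
        rw [sign_neg h3, abs_lt]
        simp; constructor <;> linarith
      · rw [h3, abs_zero] at h1; linarith
      · rw [abs_of_pos h3] at h1
        rw [sign_pos h3, abs_lt]
        simp; constructor <;> linarith
    · simp only [hw, if_neg hi, sub_self, abs_zero]
      exact hr

end Skeletons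

/-! ### Change of coordinates -/

section Conjugation

variable {m : ℕ} {e : OrthonormalBasis (Fin m) ℝ (EuclideanSpace ℝ (Fin m))} {η : ℝ}
  {b : EuclideanSpace ℝ (Fin m)}

/-- The map `f`, read in the coordinates given by the origin `b`, the basis `e` and the unit `η`. -/
noncomputable def conj (e : OrthonormalBasis (Fin m) ℝ (EuclideanSpace ℝ (Fin m)))
    (b : EuclideanSpace ℝ (Fin m)) (η : ℝ)
    (f : EuclideanSpace ℝ (Fin m) → EuclideanSpace ℝ (Fin m)) (x : EuclideanSpace ℝ (Fin m)) :
    EuclideanSpace ℝ (Fin m) := scale e b η (f (unscale e b η x))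

lemma contDiff_scale : ContDiff ℝ ∞ (scale e b η) := by
  unfold scale
  exact contDiff_const.add (e.repr.symm.contDiff.const_smul η)

lemma contDiff_unscale : ContDiff ℝ ∞ (unscale e b η) := by
  unfold unscale
  exact (e.repr.contDiff.comp (contDiff_id.sub contDiff_const)).const_smul η⁻¹

lemma norm_iteratedFDeriv_comp_unscale_le (hη : 0 < η) {F : Type*} [NormedAddCommGroup F]
    [NormedSpace ℝ F] (f : EuclideanSpace ℝ (Fin m) → F) (n : ℕ) (x : EuclideanSpace ℝ (Fin m)) :
    ‖iteratedFDeriv ℝ n (fun x => f (unscale e b η x)) x‖ ≤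
      (η⁻¹) ^ n * ‖iteratedFDeriv ℝ n f (unscale e b η x)‖ := by
  set H : EuclideanSpace ℝ (Fin m) ≃L[ℝ] EuclideanSpace ℝ (Fin m) :=
    ContinuousLinearEquiv.smulLeft (Units.mk0 η⁻¹ (inv_ne_zero hη.ne')) with hH
  have hHa : ∀ v, H v = η⁻¹ • v := fun v => rfl
  have h1 : (fun x => f (unscale e b η x)) = fun x => ((f ∘ H) ∘ e.repr) (x - b) := rfl
  rw [h1, iteratedFDeriv_comp_sub, e.repr.norm_iteratedFDeriv_comp_right]
  have h2 := H.iteratedFDerivWithin_comp_right f uniqueDiffOn_univ (x := e.repr (x - b))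
    (mem_univ _) n
  rw [preimage_univ, iteratedFDerivWithin_univ, iteratedFDerivWithin_univ] at h2
  rw [h2]
  refine (ContinuousMultilinearMap.norm_compContinuousLinearMap_le _ _).trans ?_
  have h3 : ‖(H : EuclideanSpace ℝ (Fin m) →L[ℝ] EuclideanSpace ℝ (Fin m))‖ ≤ η⁻¹ := by
    refine ContinuousLinearMap.opNorm_le_bound _ (by positivity) fun v => ?_
    rw [ContinuousLinearEquiv.coe_coe, hHa, norm_smul, Real.norm_of_nonneg (by positivity)]
  rw [Finset.prod_const, Finset.card_univ, Fintype.card_fin, mul_comm]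
  exact mul_le_mul_of_nonneg_right (pow_le_pow_left₀ (norm_nonneg _) h3 n) (norm_nonneg _)

lemma norm_iteratedFDeriv_conj_le (hη : 0 < η)
    {f : EuclideanSpace ℝ (Fin m) → EuclideanSpace ℝ (Fin m)} {x : EuclideanSpace ℝ (Fin m)}
    (hf : ContDiffAt ℝ ∞ f (unscale e b η x)) {n : ℕ} (hn : 1 ≤ n) :
    η ^ (n - 1) * ‖iteratedFDeriv ℝ n (conj e b η f) x‖ ≤
      ‖iteratedFDeriv ℝ n f (unscale e b η x)‖ := by
  have hg : ContDiffAt ℝ n (fun x => f (unscale e b η x)) x :=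
    (hf.comp x contDiff_unscale.contDiffAt).of_le (by exact_mod_cast le_top)
  have h1 : conj e b η f = (fun _ => b) +
      (η • (e.repr.symm ∘ fun x => f (unscale e b η x))) := rfl
  have h2 : iteratedFDeriv ℝ n (conj e b η f) x =
      η • iteratedFDeriv ℝ n (e.repr.symm ∘ fun x => f (unscale e b η x)) x := by
    have hg' : ContDiffAt ℝ n (e.repr.symm ∘ fun x => f (unscale e b η x)) x :=
      e.repr.symm.contDiff.contDiffAt.comp x hg
    have hg'' : ContDiffAt ℝ n (η • (e.repr.symm ∘ fun x => f (unscale e b η x))) x :=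
      hg'.const_smul η
    rw [h1, iteratedFDeriv_add_apply contDiffAt_const hg'',
      iteratedFDeriv_const_of_ne (by omega)]
    rw [Pi.zero_apply, zero_add]
    exact iteratedFDeriv_const_smul_apply hg'
  rw [h2, norm_smul, Real.norm_of_nonneg hη.le, LinearIsometryEquiv.norm_iteratedFDeriv_comp_left,
    ← mul_assoc, ← pow_succ, Nat.sub_add_cancel hn]
  calc η ^ n * ‖iteratedFDeriv ℝ n (fun x => f (unscale e b η x)) x‖
      ≤ η ^ n * ((η⁻¹) ^ n * ‖iteratedFDeriv ℝ n f (unscale e b η x)‖) := by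
        gcongr
        exact norm_iteratedFDeriv_comp_unscale_le hη f n x
    _ = _ := by rw [← mul_assoc, ← mul_pow, mul_inv_cancel₀ hη.ne', one_pow, one_mul]

lemma jac_conj (hη : 0 < η) {f : EuclideanSpace ℝ (Fin m) → EuclideanSpace ℝ (Fin m)}
    {x : EuclideanSpace ℝ (Fin m)} (hf : ContDiffAt ℝ ∞ f (unscale e b η x)) :
    jac (conj e b η f) x = jac f (unscale e b η x) := by
  have hL : HasFDerivAt (unscale e b η)
      (η⁻¹ • (e.repr : EuclideanSpace ℝ (Fin m) →L[ℝ] EuclideanSpace ℝ (Fin m))) x := by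
    have h1 := (e.repr : EuclideanSpace ℝ (Fin m) →L[ℝ] EuclideanSpace ℝ (Fin m)).hasFDerivAt.comp x
      ((hasFDerivAt_id x).sub_const b)
    exact h1.const_smul η⁻¹
  have hf' := (hf.differentiableAt (by simp)).hasFDerivAt.comp x hL
  have hR := ((e.repr.symm : EuclideanSpace ℝ (Fin m) →L[ℝ] EuclideanSpace ℝ (Fin m)).hasFDerivAt.comp
    x hf').const_smul η |>.const_add b
  have hfd : HasFDerivAt (conj e b η f) _ x := hR
  unfold jac
  rw [hfd.fderiv]
  congr 1
  set D := fderiv ℝ f (unscale e b η x)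
  have h2 : ((η • (e.repr.symm : EuclideanSpace ℝ (Fin m) →L[ℝ] EuclideanSpace ℝ (Fin m)).comp
      (D.comp (η⁻¹ • (e.repr : EuclideanSpace ℝ (Fin m) →L[ℝ] EuclideanSpace ℝ (Fin m)))) :
      EuclideanSpace ℝ (Fin m) →L[ℝ] EuclideanSpace ℝ (Fin m)) : EuclideanSpace ℝ (Fin m) →ₗ[ℝ] _) =
      e.repr.symm.toLinearEquiv.toLinearMap ∘ₗ (D : EuclideanSpace ℝ (Fin m) →ₗ[ℝ] _) ∘ₗ
        e.repr.symm.toLinearEquiv.symm.toLinearMap := by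
    ext v : 1
    change η • e.repr.symm (D (η⁻¹ • e.repr v)) = e.repr.symm (D (e.repr v))
    rw [map_smul, map_smul, smul_smul, mul_inv_cancel₀ hη.ne', one_smul]
  exact (congr_arg LinearMap.det h2).trans (LinearMap.det_conj _ _)

lemma volume_hyperplane (hη : 0 < η) (i : Fin m) (t : ℝ) : volume {x | unscale e b η x i = t} = 0 := by
  have hmp := (PiLp.volume_preserving_ofLp (Fin m)).comp
    (e.measurePreserving_repr.comp (measurePreserving_sub_right volume b))
  have h0 : volume {f : Fin m → ℝ | f i = η * t} = 0 := Measure.pi_hyperplane _ i _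
  have h1 : {x | unscale e b η x i = t} ⊆ _ ⁻¹' {f : Fin m → ℝ | f i = η * t} := fun x hx => by
    have hx' : η⁻¹ * e.repr (x - b) i = t := hx
    change e.repr (x - b) i = η * t
    rw [← hx', mul_inv_cancel_left₀ hη.ne']
  refine measure_mono_null h1 (hmp.quasiMeasurePreserving.preimage_null h0)

end Conjugation

/-! ### Neighbourhoods of the family of cubes -/

section Support

variable {m : ℕ} {ρ A : ℝ} {V : Set (Fin m → ℤ)} {ℓ : ℕ}

/-- The points whose distance, in the maximum norm, to a center in `V` is at most `r`. -/
def closedNhd (V : Set (Fin m → ℤ)) (r : ℝ) : Set (EuclideanSpace ℝ (Fin m)) :=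
  {y | ∃ z ∈ V, ∀ i, |y i - 2 * (z i : ℝ)| ≤ r}

/-- The points whose distance, in the maximum norm, to a center in `V` is less than `r`. -/
def openNhd (V : Set (Fin m → ℤ)) (r : ℝ) : Set (EuclideanSpace ℝ (Fin m)) :=
  {y | ∃ z ∈ V, ∀ i, |y i - 2 * (z i : ℝ)| < r}

lemma isOpen_openNhd (r : ℝ) : IsOpen (openNhd V r) := by
  have h : openNhd V r = ⋃ z ∈ V, ⋂ i : Fin m,
      {y : EuclideanSpace ℝ (Fin m) | |y i - 2 * (z i : ℝ)| < r} := by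
    ext y; simp [openNhd]
  rw [h]
  exact isOpen_biUnion fun z _ => isOpen_iInter_of_finite fun i =>
    isOpen_lt (by fun_prop) continuous_const

lemma isClosed_closedNhd {r : ℝ} (hr : r ≤ 2) : IsClosed (closedNhd V r) := by
  have h : closedNhd V r = ⋃ z : V, ⋂ i : Fin m,
      {y : EuclideanSpace ℝ (Fin m) | |y i - 2 * ((z : Fin m → ℤ) i : ℝ)| ≤ r} := by
    ext y; simp [closedNhd]
  rw [h]
  refine LocallyFinite.isClosed_iUnion (fun x => ⟨Metric.ball x 1, Metric.ball_mem_nhds x one_pos, ?_⟩)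
    fun z => isClosed_iInter fun i => isClosed_le (by fun_prop) continuous_const
  refine Set.Finite.of_finite_image (f := fun z : V => (z : Fin m → ℤ))
    ((nearBox x).finite_toSet.subset ?_) Subtype.val_injective.injOn
  rintro _ ⟨z, ⟨y, hy, hyx⟩, rfl⟩
  refine Fintype.mem_piFinset.2 fun i => Finset.mem_Icc.2 ?_
  have h0 : |y i - 2 * ((z : Fin m → ℤ) i : ℝ)| ≤ r := mem_iInter.1 hy i
  have h1 := abs_le.1 h0
  have h2 := abs_lt.1 ((abs_apply_sub_le_dist x y i).trans_lt hyx)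
  exact ⟨Int.ceil_le.2 (by linarith [h1.2, h2.1]), Int.le_floor.2 (by linarith [h1.1, h2.2])⟩

/-- A coordinate which lies outside the range of a cell, at a distance at most `ρ / 3`, is not
moved. -/
lemma thick_apply_eq_of_one_lt (hρ₀ : 0 < ρ) (hρ₁ : ρ < 1) {x : EuclideanSpace ℝ (Fin m)}
    {i : Fin m} {z : ℤ} (h1 : 1 < |x i - 2 * (z : ℝ)|) (h2 : |x i - 2 * (z : ℝ)| ≤ 1 + ρ / 3) :
    thick ρ A V ℓ x i = x i := by
  -- the coordinate lies in the neighbouring cell, close to its boundary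
  obtain ⟨w, hw, hwd⟩ : ∃ w : ℤ, |x i - 2 * (w : ℝ)| ≤ 1 ∧ 1 - ρ / 3 ≤ |x i - 2 * (w : ℝ)| := by
    rcases le_total 0 (x i - 2 * (z : ℝ)) with h | h
    · rw [abs_of_nonneg h] at h1 h2
      refine ⟨z + 1, ?_⟩
      push_cast
      rw [abs_of_nonpos (by linarith)]
      constructor <;> linarith
    · rw [abs_of_nonpos h] at h1 h2
      refine ⟨z - 1, ?_⟩
      push_cast
      rw [abs_of_nonneg (by linarith)]
      constructor <;> linarith
  rcases thick_apply_eq_or (A := A) (V := V) (ℓ := ℓ) hρ₀ hρ₁ x i hw with ⟨h, _⟩ | ⟨h, _⟩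
  · exact h
  · rw [thick_apply, displacement_eq_zero hρ₀ hρ₁ _ _ (h ▸ hwd), add_zero]

lemma thick_mem_closedNhd (hρ₀ : 0 < ρ) (hρ₁ : ρ < 1) {x : EuclideanSpace ℝ (Fin m)}
    (hx : x ∈ closedNhd V (1 + ρ / 3)) : thick ρ A V ℓ x ∈ closedNhd V (1 + ρ / 3) := by
  obtain ⟨z, hz, h⟩ := hx
  refine ⟨z, hz, fun i => ?_⟩
  rcases le_or_gt (|x i - 2 * (z i : ℝ)|) 1 with h1 | h1
  · exact (abs_thick_sub_le_one hρ₀ hρ₁ h1).trans (by linarith)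
  · rw [thick_apply_eq_of_one_lt hρ₀ hρ₁ h1 (h i)]
    exact h i

lemma thick_eq_of_notMem (hρ₀ : 0 < ρ) {x : EuclideanSpace ℝ (Fin m)}
    (hx : x ∉ closedNhd V (1 + ρ / 3)) : thick ρ A V ℓ x = x := by
  by_contra h
  obtain ⟨z, hz, hzx⟩ := exists_near_of_thick_ne hρ₀ h
  exact hx ⟨z, hz, fun i => (hzx i).le⟩

lemma closedNhd_subset_openNhd {r s : ℝ} (h : r < s) : closedNhd V r ⊆ openNhd V s :=
  fun _ ⟨z, hz, hy⟩ => ⟨z, hz, fun i => (hy i).trans_lt h⟩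

lemma norm_thick_sub_le (hρ₀ : 0 < ρ) (hρ₁ : ρ < 1) (x : EuclideanSpace ℝ (Fin m)) :
    ‖thick ρ A V ℓ x - x‖ ≤ m * 2 := by
  have h1 : thick ρ A V ℓ x - x =
      ∑ i, (thick ρ A V ℓ x i - x i) • EuclideanSpace.single i (1 : ℝ) := by
    rw [← euclidean_eq_sum]; rfl
  rw [h1]
  refine (norm_sum_le_of_le (n := fun _ => (2 : ℝ)) _ fun i _ => ?_).trans_eq (by simp)
  rw [norm_smul, PiLp.norm_single, norm_one, mul_one, Real.norm_eq_abs]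
  -- the cell is preserved
  have h2 : |x i - 2 * (round (x i / 2) : ℝ)| ≤ 1 := abs_ctr_le_one (x i)
  have h3 := abs_thick_sub_le_one (A := A) (V := V) (ℓ := ℓ) hρ₀ hρ₁ h2
  rw [abs_le] at h2 h3 ⊢
  constructor <;> linarith [h2.1, h2.2, h3.1, h3.2]

/-- Compact subsets of the open neighbourhood are mapped into compact subsets: the map preserves a
smaller closed neighbourhood, is the identity outside it, and moves points a bounded distance. -/
lemma exists_isCompact_thick (hρ₀ : 0 < ρ) (hρ₁ : ρ < 1) {K : Set (EuclideanSpace ℝ (Fin m))}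
    (hK : IsCompact K) (hKV : K ⊆ openNhd V (1 + ρ)) :
    ∃ K' ⊆ openNhd V (1 + ρ), IsCompact K' ∧ thick ρ A V ℓ '' K ⊆ K' := by
  obtain ⟨R, hR⟩ := hK.isBounded.exists_norm_le
  refine ⟨K ∪ (closedNhd V (1 + ρ / 3) ∩ Metric.closedBall 0 (R + m * 2)),
    union_subset hKV (inter_subset_left.trans (closedNhd_subset_openNhd (by linarith))),
    hK.union ((isCompact_closedBall _ _).inter_left (isClosed_closedNhd (by linarith))), ?_⟩
  rintro _ ⟨x, hx, rfl⟩
  by_cases h : x ∈ closedNhd V (1 + ρ / 3)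
  · refine Or.inr ⟨thick_mem_closedNhd hρ₀ hρ₁ h, mem_closedBall_zero_iff.2 ?_⟩
    calc ‖thick ρ A V ℓ x‖ = ‖x + (thick ρ A V ℓ x - x)‖ := by rw [add_sub_cancel]
      _ ≤ R + m * 2 := (norm_add_le _ _).trans (add_le_add (hR x hx) (norm_thick_sub_le hρ₀ hρ₁ x))
  · exact Or.inl ((thick_eq_of_notMem hρ₀ h).symm ▸ hx)

/-- Rounding the coordinates in `J` to even integers. -/
noncomputable def roundOn (J : Finset (Fin m)) (x : EuclideanSpace ℝ (Fin m)) :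
    EuclideanSpace ℝ (Fin m) := by
  classical exact WithLp.toLp 2 fun i => if i ∈ J then 2 * (round (x i / 2) : ℝ) else x i

lemma roundOn_mem_evenSet {J : Finset (Fin m)} (hJ : J.card = ℓ + 1)
    (x : EuclideanSpace ℝ (Fin m)) : roundOn J x ∈ evenSet m ℓ :=
  mem_evenSet_iff.2 ⟨J, hJ, fun j hj => ⟨round (x j / 2), by simp [roundOn, hj]⟩⟩

lemma abs_roundOn_sub_le (J : Finset (Fin m)) {x : EuclideanSpace ℝ (Fin m)} {i : Fin m} {z : ℤ}
    (h : |x i - 2 * (z : ℝ)| < 2) : |roundOn J x i - 2 * (z : ℝ)| ≤ 2 := by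
  unfold roundOn
  by_cases hi : i ∈ J
  · simp only [hi, if_true]
    have h1 := abs_lt.1 h
    have h2 := abs_le.1 (abs_ctr_le_one (x i))
    have h3 := two_mul_round_add_ctr (x i)
    have h4 : ((round (x i / 2) - z : ℤ) : ℝ) < 2 := by push_cast; linarith [h1.2, h2.1]
    have h5 : (-2 : ℝ) < ((round (x i / 2) - z : ℤ) : ℝ) := by push_cast; linarith [h1.1, h2.2]
    have h6 : round (x i / 2) - z ≤ 1 := by
      have : round (x i / 2) - z < 2 := by exact_mod_cast h4
      omega
    have h7 : -1 ≤ round (x i / 2) - z := by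
      have : -2 < round (x i / 2) - z := by exact_mod_cast h5
      omega
    have h8 : (round (x i / 2) : ℝ) - z ≤ 1 := by exact_mod_cast h6
    have h9 : (-1 : ℝ) ≤ (round (x i / 2) : ℝ) - z := by exact_mod_cast h7
    rw [abs_le]
    constructor <;> linarith
  · simp only [hi, if_false]
    exact h.le

lemma dist_roundOn_sq (J : Finset (Fin m)) (x : EuclideanSpace ℝ (Fin m)) :
    dist x (roundOn J x) ^ 2 = ∑ j ∈ J, ctr (x j) ^ 2 := by
  classical
  rw [EuclideanSpace.dist_eq, Real.sq_sqrt (Finset.sum_nonneg fun i _ => sq_nonneg _),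
    ← Finset.sum_subset (Finset.subset_univ J)]
  · refine Finset.sum_congr rfl fun j hj => ?_
    rw [Real.dist_eq, sq_abs]
    simp [roundOn, hj, ctr]
  · intro j _ hj
    simp [roundOn, hj]

end Support

/-! ### The map in the original coordinates -/

section Main

variable {m : ℕ} {e : OrthonormalBasis (Fin m) ℝ (EuclideanSpace ℝ (Fin m))} {η ρ A : ℝ}
  {b : EuclideanSpace ℝ (Fin m)} {V : Set (Fin m → ℤ)} {ℓ : ℕ}

lemma dist_scale (hη : 0 < η) (y w : EuclideanSpace ℝ (Fin m)) :
    dist (scale e b η y) (scale e b η w) = η * dist y w := by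
  unfold scale
  rw [dist_add_left, dist_smul₀, e.repr.symm.dist_map, Real.norm_of_nonneg hη.le]

/-- The singular set of the thickening map in the original coordinates. -/
def singularSet (e : OrthonormalBasis (Fin m) ℝ (EuclideanSpace ℝ (Fin m)))
    (b : EuclideanSpace ℝ (Fin m)) (η ρ : ℝ) (V : Set (Fin m → ℤ)) (ℓ : ℕ) :
    Set (EuclideanSpace ℝ (Fin m)) := {x | unscale e b η x ∉ regularSet ρ V ℓ}

lemma volume_singularSet (hη : 0 < η) (hρ₀ : 0 < ρ) : volume (singularSet e b η ρ V ℓ) = 0 := by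
  have h : singularSet e b η ρ V ℓ ⊆
      ⋃ i : Fin m, ⋃ n : ℤ, {x | unscale e b η x i = 2 * (n : ℝ)} := by
    intro x hx
    obtain ⟨J, hJ, h1⟩ := mem_evenSet_iff.1 (near_of_notMem_regularSet hρ₀ hx).1
    obtain ⟨j, hj⟩ := Finset.card_pos.1 (by omega : 0 < J.card)
    obtain ⟨n, hn⟩ := h1 j hj
    exact mem_iUnion.2 ⟨j, mem_iUnion.2 ⟨n, hn⟩⟩
  refine measure_mono_null h ?_
  simp only [measure_iUnion_null_iff]
  exact fun i n => volume_hyperplane hη i _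

/-- The thickening map in the original coordinates is a singular diffeomorphism. -/
lemma isSingularDiffeo_conj_thick (hη : 0 < η) (hρ₀ : 0 < ρ) (hρ₁ : ρ < 1) (hA : 1 ≤ A)
    (hℓ : ℓ < m) : IsSingularDiffeo (singularSet e b η ρ V ℓ)
      (unscale e b η ⁻¹' openNhd V (1 + ρ)) (conj e b η (thick ρ A V ℓ)) where
  isOpen := (isOpen_openNhd _).preimage contDiff_unscale.continuous
  isClosed := (isOpen_regularSet hρ₀ hρ₁).isClosed_compl.preimage contDiff_unscale.continuous
  measure_eq_zero := volume_singularSet hη hρ₀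
  contDiffAt x hx := contDiff_scale.contDiffAt.comp x
    ((contDiffAt_thick hρ₀ hρ₁ hA hℓ (not_not.1 hx)).comp x contDiff_unscale.contDiffAt)
  injOn x hx y hy hxy := by
    have h1 := congr_arg (unscale e b η) hxy
    simp only [conj, unscale_scale hη] at h1
    have h2 := injOn_thick hρ₀ hρ₁ hA hℓ (not_not.1 hx) (not_not.1 hy) h1
    rw [← scale_unscale (e := e) hη b x, h2, scale_unscale hη]
  exists_isCompact K hK hKc := by
    obtain ⟨K', hK', hKc', hKK'⟩ := exists_isCompact_thick (A := A) (ℓ := ℓ) hρ₀ hρ₁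
      (hKc.image (contDiff_unscale (e := e) (b := b) (η := η)).continuous) (image_subset_iff.2 hK)
    refine ⟨scale e b η '' K', ?_, hKc'.image contDiff_scale.continuous, ?_⟩
    · rintro _ ⟨y, hy, rfl⟩
      rw [mem_preimage, unscale_scale hη]
      exact hK' hy
    · rintro _ ⟨x, hx, rfl⟩
      exact ⟨_, hKK' ⟨_, ⟨x, hx.1, rfl⟩, rfl⟩, rfl⟩
  exists_le_jac := by
    obtain ⟨c, hc, h⟩ := exists_mul_rpow_weight_le_jac_thick hρ₀ hρ₁ hA hℓ le_rfl
      (by positivity : (0 : ℝ) < ℓ + 1)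
    refine ⟨c, hc, fun x hx => ?_⟩
    rw [jac_conj hη (contDiffAt_thick hρ₀ hρ₁ hA hℓ (not_not.1 hx))]
    simpa using h V _ (not_not.1 hx)

lemma isSingularCutoff_conj_thick (hη : 0 < η) (hρ₀ : 0 < ρ) (hρ₁ : ρ < 1) (hA : 1 ≤ A)
    (hℓ : ℓ < m) {k : ℕ} (hk : k < ℓ + 1) : IsSingularCutoff (singularSet e b η ρ V ℓ)
      (conj e b η (thick ρ A V ℓ)) k (fun n x => singularCutoff ρ V ℓ n (unscale e b η x)) where
  contDiff n := (contDiff_singularCutoff hρ₀ hρ₁ hℓ n).comp contDiff_unscale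
  eventuallyEq_zero n x hx :=
    contDiff_unscale.continuous.continuousAt.eventually (singularCutoff_eventuallyEq_zero hρ₀ hρ₁ hx n)
  eventuallyEq_one x hx := by
    filter_upwards [singularCutoff_eventuallyEq_one hρ₀ hρ₁ hℓ (not_not.1 hx)] with n hn
    exact contDiff_unscale.continuous.continuousAt.eventually hn
  abs_le_one n x := by
    have h := singularCutoff_mem_Icc ρ V ℓ n (unscale e b η x)
    rw [abs_of_nonneg h.1]
    exact h.2
  norm_iteratedFDeriv_le i hi := by
    obtain ⟨C, hC, h⟩ := exists_bound_iteratedFDeriv_singularCutoff hρ₀ hρ₁ hℓ V i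
    obtain ⟨c, hc, h'⟩ := exists_mul_rpow_weight_le_jac_thick (β := i) hρ₀ hρ₁ hA hℓ (by positivity)
      (by exact_mod_cast hi.trans_lt hk)
    refine ⟨(η⁻¹) ^ i * C / c, by positivity, fun n x hx => ?_⟩
    refine (norm_iteratedFDeriv_comp_unscale_le hη _ i x).trans ?_
    rw [jac_conj hη (contDiffAt_thick hρ₀ hρ₁ hA hℓ (not_not.1 hx))]
    have h1 := h n _ (not_not.1 hx)
    have h2 := h' V _ (not_not.1 hx)
    rw [Real.rpow_natCast] at h2
    calc (η⁻¹) ^ i * ‖iteratedFDeriv ℝ i (singularCutoff ρ V ℓ n) (unscale e b η x)‖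
        ≤ (η⁻¹) ^ i * (C * weight ρ V ℓ (unscale e b η x) ^ i) := by gcongr
      _ = (η⁻¹) ^ i * C / c * (c * weight ρ V ℓ (unscale e b η x) ^ i) := by field_simp
      _ ≤ _ := by gcongr

/-- The pointwise estimates, with constants which depend only on the order of the derivative, the
exponent, the dimension and `ρ`. -/
lemma exists_derivLEJac (m : ℕ) (hρ₀ : 0 < ρ) (hρ₁ : ρ < 1) (hA : 1 ≤ A) :
    ∃ M : ℝ → ℕ → ℝ, (∀ β j, 0 < M β j) ∧
      ∀ (e : OrthonormalBasis (Fin m) ℝ (EuclideanSpace ℝ (Fin m))) (b : EuclideanSpace ℝ (Fin m))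
        (η : ℝ) (V : Set (Fin m → ℤ)) (ℓ : ℕ), 0 < η → ℓ < m →
        DerivLEJac (singularSet e b η ρ V ℓ) (conj e b η (thick ρ A V ℓ)) η (ℓ + 1) M := by
  have h1 : ∀ j : ℕ, 1 ≤ j → ∃ C, 0 ≤ C ∧ ∀ (V : Set (Fin m → ℤ)) (ℓ : ℕ), ℓ < m →
      ∀ x ∈ regularSet ρ V ℓ, ‖iteratedFDeriv ℝ j (thick ρ A V ℓ) x‖ ≤ C * weight ρ V ℓ x ^ j :=
    fun j hj => exists_bound_iteratedFDeriv_thick m hρ₀ hρ₁ hA hj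
  have h2 : ∀ (β : ℝ) (ℓ : ℕ), ∃ c, 0 < c ∧ (0 < β → β < ℓ + 1 → ℓ < m →
      ∀ (V : Set (Fin m → ℤ)), ∀ x ∈ regularSet ρ V ℓ,
        c * weight ρ V ℓ x ^ β ≤ jac (thick ρ A V ℓ) x) := by
    intro β ℓ
    by_cases h : 0 < β ∧ β < ℓ + 1 ∧ ℓ < m
    · obtain ⟨c, hc, hb⟩ := exists_mul_rpow_weight_le_jac_thick hρ₀ hρ₁ hA h.2.2 h.1.le h.2.1
      exact ⟨c, hc, fun _ _ _ => hb⟩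
    · exact ⟨1, one_pos, fun h1 h2 h3 => absurd ⟨h1, h2, h3⟩ h⟩
  choose! C hC using h1
  choose c hc hcb using h2
  refine ⟨fun β j => 1 + ∑ ℓ ∈ Finset.range m, |C j| * (c β ℓ)⁻¹ ^ ((j : ℝ) / β), fun β j => ?_,
    fun e b η V ℓ hη hℓ β hβ hβℓ j hj x hx => ?_⟩
  · have : 0 ≤ ∑ ℓ ∈ Finset.range m, |C j| * (c β ℓ)⁻¹ ^ ((j : ℝ) / β) :=
      Finset.sum_nonneg fun ℓ _ => by have := hc β ℓ; positivity
    linarith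
  have hx' := not_not.1 hx
  have hd := contDiffAt_thick hρ₀ hρ₁ hA hℓ hx'
  rw [jac_conj hη hd]
  refine (norm_iteratedFDeriv_conj_le hη hd hj).trans (((hC j hj).2 V ℓ hℓ _ hx').trans ?_)
  have h3 := hcb β ℓ hβ hβℓ hℓ V _ hx'
  set w := weight ρ V ℓ (unscale e b η x) with hw
  have hw0 : 0 ≤ w := weight_nonneg _ _ _ _
  set J := jac (thick ρ A V ℓ) (unscale e b η x) with hJ
  have hJ0 : 0 ≤ J := abs_nonneg _
  have hc0 := hc β ℓ
  have h4 : w ^ j ≤ (c β ℓ)⁻¹ ^ ((j : ℝ) / β) * J ^ ((j : ℝ) / β) := by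
    have h5 : w ^ β ≤ (c β ℓ)⁻¹ * J := by
      rw [inv_mul_eq_div, le_div_iff₀ hc0, mul_comm]
      exact h3
    calc w ^ j = (w ^ β) ^ ((j : ℝ) / β) := by
          rw [← Real.rpow_mul hw0, mul_div_cancel₀ _ hβ.ne', Real.rpow_natCast]
      _ ≤ ((c β ℓ)⁻¹ * J) ^ ((j : ℝ) / β) := Real.rpow_le_rpow (by positivity) h5 (by positivity)
      _ = _ := Real.mul_rpow (by positivity) hJ0
  calc C j * w ^ j ≤ |C j| * ((c β ℓ)⁻¹ ^ ((j : ℝ) / β) * J ^ ((j : ℝ) / β)) :=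
        mul_le_mul (le_abs_self _) h4 (by positivity) (abs_nonneg _)
    _ = |C j| * (c β ℓ)⁻¹ ^ ((j : ℝ) / β) * J ^ ((j : ℝ) / β) := by ring
    _ ≤ _ := by
        refine mul_le_mul_of_nonneg_right ?_ (by positivity)
        have h6 := Finset.single_le_sum (f := fun ℓ => |C j| * (c β ℓ)⁻¹ ^ ((j : ℝ) / β))
          (fun ℓ _ => by have := hc β ℓ; positivity) (Finset.mem_range.2 hℓ)
        linarith

/-- The weight is controlled by the distance to the dual skeleton. -/
lemma weight_le_div_infDist (hη : 0 < η) (hℓ : ℓ < m)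
    {U : Set (Set (EuclideanSpace ℝ (Fin m)))} (hU : U ⊆ range (cell e b η))
    {y : EuclideanSpace ℝ (Fin m)} (hy : scale e b η y ∉ ⋃₀ dualSkeleton e η U ℓ)
    (hyU : y ∈ openNhd (cellIndices e b η U) 2) :
    0 < Metric.infDist (scale e b η y) (⋃₀ dualSkeleton e η U ℓ) ∧
      weight ρ V ℓ y ≤ √(2 ^ m) * η / Metric.infDist (scale e b η y) (⋃₀ dualSkeleton e η U ℓ) := by
  set T := ⋃₀ dualSkeleton e η U ℓ with hT
  obtain ⟨z, hz, hyz⟩ := hyU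
  have hround : ∀ J : Finset (Fin m), J.card = ℓ + 1 → scale e b η (roundOn J y) ∈ T := fun J hJ =>
    mem_dualSkeleton_of_mem_evenSet hη (roundOn_mem_evenSet hJ y) hz fun i =>
      abs_roundOn_sub_le J (hyz i)
  obtain ⟨J₀, -, hJ₀⟩ := Finset.exists_subset_card_eq
    (show ℓ + 1 ≤ (Finset.univ : Finset (Fin m)).card by simpa using hℓ)
  have hpos : 0 < Metric.infDist (scale e b η y) T := by
    have h1 : y ∉ evenSet m ℓ := fun h =>
      hy (mem_dualSkeleton_of_mem_evenSet hη h hz fun i => (hyz i).le)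
    have h2 := (isClosed_evenSet.notMem_iff_infDist_pos ⟨_, roundOn_mem_evenSet hJ₀ y⟩).1 h1
    refine (mul_pos hη h2).trans_le ((Metric.le_infDist ⟨_, hround J₀ hJ₀⟩).2 fun t ht => ?_)
    rw [← scale_unscale (e := e) hη b t] at ht ⊢
    rw [dist_scale hη]
    exact mul_le_mul_of_nonneg_left
      (Metric.infDist_le_dist_of_mem (mem_evenSet_of_mem_dualSkeleton hη hU hℓ ht)) hη.le
  refine ⟨hpos, (weight_le_div (div_pos hpos hη) fun J hJ => ?_).trans_eq (div_div_eq_mul_div _ _ _)⟩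
  rw [← dist_roundOn_sq]
  refine pow_le_pow_left₀ (by positivity) ?_ 2
  rw [div_le_iff₀ hη, mul_comm, ← dist_scale (e := e) (b := b) hη]
  exact Metric.infDist_le_dist_of_mem (hround J hJ)

end Main

end Thickening

open Thickening

theorem mainTheorem5 (m : ℕ) (ρ : ℝ) (hρ₀ : 0 < ρ) (hρ₁ : ρ < 1) :
    ∃ (C : ℕ → ℝ) (C' : ℝ → ℕ → ℝ) (C'' : ℕ → ℝ → ℝ),
      (∀ j, 0 < C j) ∧ (∀ β j, 0 < C' β j) ∧ (∀ k p, 0 < C'' k p) ∧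
      ∀ (e : OrthonormalBasis (Fin m) ℝ (EuclideanSpace ℝ (Fin m)))
        (ℓ : ℕ) (_hℓ : ℓ < m) (η : ℝ) (_hη : 0 < η)
        (S : Set (Set (EuclideanSpace ℝ (Fin m))))
        (_hS : Thickening.IsCubication e η S Set.univ)
        (U : Set (Set (EuclideanSpace ℝ (Fin m)))) (_hU : U ⊆ S),
        let T : Set (EuclideanSpace ℝ (Fin m)) := ⋃₀ Thickening.dualSkeleton e η U ℓ
        let Q : Set (EuclideanSpace ℝ (Fin m)) := Thickening.openCube e 0 (ρ * η)
        let Ω : Set (EuclideanSpace ℝ (Fin m)) := ⋃₀ U + Q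
        ∃ Φ : EuclideanSpace ℝ (Fin m) → EuclideanSpace ℝ (Fin m),
          ContDiffOn ℝ ∞ Φ Tᶜ ∧
          Set.InjOn Φ Tᶜ ∧
          (∀ σ ∈ S, Φ '' (σ \ T) ⊆ σ \ T) ∧
          Thickening.geomSupport T Φ ⊆ Ω ∧
          Φ '' (⋃₀ U \ T) ⊆ ⋃₀ Thickening.skeleton e η U ℓ + Q ∧
          (∀ j : ℕ, 1 ≤ j → ∀ x ∉ T, (2 ≤ j ∨ x ∈ Ω) →
            ‖iteratedFDeriv ℝ j Φ x‖ ≤ C j * η / Metric.infDist x T ^ j) ∧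
          (∀ β : ℝ, 0 < β → β < ℓ + 1 → ∀ j : ℕ, 1 ≤ j → ∀ x ∉ T,
            η ^ (j - 1) * ‖iteratedFDeriv ℝ j Φ x‖ ≤
              C' β j * Thickening.jac Φ x ^ ((j : ℝ) / β)) ∧
          (∀ (k : ℕ) (p : ℝ), 1 ≤ k → 1 ≤ p → (k : ℝ) * p < ℓ + 1 →
            ∀ (ν : ℕ) (u : EuclideanSpace ℝ (Fin m) → EuclideanSpace ℝ (Fin ν)),
              Thickening.MemSobolev k p u Ω →
              Thickening.MemSobolev k p (u ∘ Φ) Ω ∧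
              ∀ j ∈ Finset.Icc 1 k,
                ∀ (D : (i : ℕ) → EuclideanSpace ℝ (Fin m) →
                    (EuclideanSpace ℝ (Fin m) [×i]→L[ℝ] EuclideanSpace ℝ (Fin ν)))
                  (D' : EuclideanSpace ℝ (Fin m) →
                    (EuclideanSpace ℝ (Fin m) [×j]→L[ℝ] EuclideanSpace ℝ (Fin ν))),
                  (∀ i ∈ Finset.Icc 1 j, Thickening.IsWeakDeriv i u (D i) Ω) →
                  Thickening.IsWeakDeriv j (u ∘ Φ) D' Ω →
                  ENNReal.ofReal (η ^ j) *
                      eLpNorm D' (ENNReal.ofReal p) (volume.restrict Ω) ≤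
                    ENNReal.ofReal (C'' k p) * ∑ i ∈ Finset.Icc 1 j, ENNReal.ofReal (η ^ i) *
                      eLpNorm (D i) (ENNReal.ofReal p) (volume.restrict Ω)) := by
  obtain ⟨A, hA, hA'⟩ := exists_factor m hρ₀
  obtain ⟨M, hM, hMb⟩ := exists_derivLEJac m hρ₀ hρ₁ hA
  have hB : ∀ j : ℕ, 1 ≤ j → ∃ B, 0 ≤ B ∧ ∀ (V : Set (Fin m → ℤ)) (ℓ : ℕ), ℓ < m →
      ∀ x ∈ regularSet ρ V ℓ, ‖iteratedFDeriv ℝ j (thick ρ A V ℓ) x‖ ≤ B * weight ρ V ℓ x ^ j :=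
    fun j hj => exists_bound_iteratedFDeriv_thick m hρ₀ hρ₁ hA hj
  choose! B hB using hB
  -- the summand `1` makes the constants positive also when `B j` vanishes
  refine ⟨fun j => 1 + |B j| * √(2 ^ m) ^ j, M, sobolevConst M, fun j => by positivity, hM,
    fun k p => sobolevConst_pos M k p, fun e ℓ hℓ η hη S hS U hUS => ?_⟩
  obtain ⟨b, rfl⟩ := hS.exists_eq_range_cell hη
  intro T Q Ω
  set V := cellIndices e b η U with hV
  set Φ := conj e b η (thick ρ A V ℓ) with hΦ
  have hdiffeo := isSingularDiffeo_conj_thick (e := e) (b := b) (V := V) hη hρ₀ hρ₁ hA hℓ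
  have hΩ : Ω = unscale e b η ⁻¹' openNhd V (1 + ρ) := by
    ext x
    rw [← scale_unscale (e := e) hη b x, mem_preimage, unscale_scale hη]
    exact scale_mem_nhd hη hUS hρ₀
  have hregular : ∀ x ∉ T, unscale e b η x ∈ regularSet ρ V ℓ := by
    intro x hx
    by_contra h
    obtain ⟨h1, z, hz, h2⟩ := near_of_notMem_regularSet hρ₀ h
    refine hx (scale_unscale (e := e) hη b x ▸ mem_dualSkeleton_of_mem_evenSet hη h1 hz fun i => ?_)
    linarith [h2 i]
  have hsing : ∀ x ∉ T, x ∉ singularSet e b η ρ V ℓ := fun x hx => not_not.2 (hregular x hx)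
  -- the map is the identity off a closed subset of `Ω`
  have hid : ∀ x, x ∉ unscale e b η ⁻¹' closedNhd V (1 + ρ / 3) → Φ x = x := fun x hx => by
    rw [hΦ, conj, thick_eq_of_notMem hρ₀ hx, scale_unscale hη]
  have hclosed : IsClosed (unscale e b η ⁻¹' closedNhd V (1 + ρ / 3)) :=
    (isClosed_closedNhd (by linarith)).preimage contDiff_unscale.continuous
  have hclosedΩ : unscale e b η ⁻¹' closedNhd V (1 + ρ / 3) ⊆ Ω :=
    hΩ ▸ preimage_mono (closedNhd_subset_openNhd (by linarith))
  have hnotMem : ∀ x ∉ T, Φ x ∉ T := by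
    intro x hx
    by_cases h : x ∈ Ω
    · intro hcon
      have h1 := mem_evenSet_of_thick_mem hρ₀ hρ₁ hA hℓ (hregular x hx)
        (mem_evenSet_of_mem_dualSkeleton hη hUS hℓ hcon)
      rw [hΩ] at h
      obtain ⟨z, hz, h2⟩ := h
      refine hx (scale_unscale (e := e) hη b x ▸ mem_dualSkeleton_of_mem_evenSet hη h1 hz fun i => ?_)
      linarith [h2 i]
    · rwa [hid x fun hh => h (hclosedΩ hh)]
  refine ⟨Φ, fun x hx => (hdiffeo.contDiffAt x (hsing x hx)).contDiffWithinAt,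
    hdiffeo.injOn.mono fun x hx => hsing x hx, ?_, ?_, ?_, ?_, ?_, ?_⟩
  · rintro _ ⟨z, rfl⟩ _ ⟨x, ⟨hxz, hxT⟩, rfl⟩
    refine ⟨?_, hnotMem x hxT⟩
    rw [← scale_unscale (e := e) hη b x, scale_mem_cell hη] at hxz
    exact (scale_mem_cell hη).2 fun i => abs_thick_sub_le_one hρ₀ hρ₁ (hxz i)
  · refine (closure_minimal (fun x hx => ?_) hclosed).trans hclosedΩ
    by_contra h
    exact hx.2 (hid x h)
  · rintro _ ⟨x, ⟨hxU, hxT⟩, rfl⟩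
    rw [← scale_unscale (e := e) hη b x, scale_mem_sUnion hη hUS] at hxU
    obtain ⟨z, hz, hxz⟩ := hxU
    obtain ⟨I, hI, hpush⟩ := exists_pushed_coords hρ₀ hρ₁ hA hA' (hregular x hxT) hz hxz
    exact scale_mem_skeleton_add hη hℓ hρ₀ hρ₁ hz
      (fun i => abs_thick_sub_le_one hρ₀ hρ₁ (hxz i)) hI hpush
  · intro j hj x hx hjx
    by_cases h : x ∈ Ω
    · rw [hΩ] at h
      obtain ⟨z, hz, h2⟩ := h
      have hx' : scale e b η (unscale e b η x) ∉ T := by rwa [scale_unscale hη]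
      have h3 := weight_le_div_infDist (ρ := ρ) (V := V) hη hℓ hUS hx'
        ⟨z, hz, fun i => (h2 i).trans (by linarith)⟩
      rw [scale_unscale hη] at h3
      obtain ⟨hd, hw⟩ := h3
      change 0 < Metric.infDist x T at hd
      change weight ρ V ℓ (unscale e b η x) ≤ √(2 ^ m) * η / Metric.infDist x T at hw
      set d := Metric.infDist x T
      have h4 := norm_iteratedFDeriv_conj_le (e := e) hη
        (contDiffAt_thick hρ₀ hρ₁ hA hℓ (hregular x hx)) hj
      have h5 : η ^ (j - 1) * ‖iteratedFDeriv ℝ j Φ x‖ ≤ |B j| * (√(2 ^ m) * η / d) ^ j := by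
        refine h4.trans (((hB j hj).2 V ℓ hℓ _ (hregular x hx)).trans ?_)
        exact mul_le_mul (le_abs_self _) (pow_le_pow_left₀ (weight_nonneg _ _ _ _) hw j)
          (pow_nonneg (weight_nonneg _ _ _ _) j) (abs_nonneg _)
      have hηj : η ^ j = η ^ (j - 1) * η := by rw [← pow_succ, Nat.sub_add_cancel hj]
      refine le_of_mul_le_mul_left (h5.trans ?_) (pow_pos hη (j - 1))
      calc |B j| * (√(2 ^ m) * η / d) ^ j
          = η ^ (j - 1) * (|B j| * √(2 ^ m) ^ j * η / d ^ j) := by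
            rw [div_pow, mul_pow, hηj]; ring
        _ ≤ _ := by gcongr; linarith
    · -- near such a point the map is the identity
      have hj2 : 2 ≤ j := hjx.resolve_right h
      have h1 : Φ =ᶠ[nhds x] id := by
        filter_upwards [hclosed.isOpen_compl.mem_nhds fun hh => h (hclosedΩ hh)] with y hy
        exact hid y hy
      rw [(h1.iteratedFDeriv ℝ j).eq_of_nhds]
      obtain ⟨i, rfl⟩ := Nat.exists_eq_add_of_le' hj2
      have h2 : fderiv ℝ (id : EuclideanSpace ℝ (Fin m) → _) =
          fun _ => ContinuousLinearMap.id ℝ _ := funext fun y => fderiv_id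
      rw [← norm_iteratedFDeriv_fderiv, h2, iteratedFDeriv_const_of_ne i.succ_ne_zero,
        Pi.zero_apply, norm_zero]
      have := Metric.infDist_nonneg (x := x) (s := T)
      positivity
  · exact fun β hβ hβℓ j hj x hx => hMb e b η V ℓ hη hℓ β hβ hβℓ j hj x (hsing x hx)
  · intro k p hk hp hkp ν u hu
    have hkℓ : k < ℓ + 1 := by
      have h1 : (k : ℝ) ≤ k * p := le_mul_of_one_le_right (Nat.cast_nonneg _) hp
      exact_mod_cast h1.trans_lt hkp
    rw [hΩ] at hu ⊢
    exact hdiffeo.memSobolev_comp hη (hMb e b η V ℓ hη hℓ) hp hkp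
      (isSingularCutoff_conj_thick hη hρ₀ hρ₁ hA hℓ hkℓ) hu
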